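/- **Proposition 3.1 (Poisson approximation).** Let $d \ge 2$ and $k \ge 1$ be integers. Let $\nu$ be a probability measure on $\mathbb{R}^d$ with compact support $A$ and with a density $f:\mathbb{R}^d\to[0,\infty)$ that is continuous and bounded away from zero on $A$. Assume that either - $A$ has $C^2$ boundary, that is, each $x\in\partial A$ has an open neighbourhood $U$ such that, for some rigid motion $\rho$ of $\mathbb{R}^d=\mathbb{R}^{d-1}\times\mathbb{R}$ and some $C^2$ function $\phi:\mathbb{R}^{d-1}\to\mathbb{R}$, $\rho(A\cap U)=\rho(U)\cap\{(u,z): z\ge\phi(u)\}$; or - $d=2$ and $A$ is polygonal, that is, $\partial A$ is a finite union of closed line segments. For $n \geq 1$ let $\eta_n$ be a Poisson point process in $\mathbb{R}^d$ with intensity measure $n\nu$, regarded as a random set of points. For $r\ge 0$ let $G(\eta_n,r)$ be the graph with vertex set $\eta_n$ in which two distinct points are adjacent if their Euclidean distance is at most $r$, and let $\xi_{n,r}$ be the number of vertices of degree less than $k$ in $G(\eta_n,r)$. Let $$L_{n,k} = \max_{x\in\eta_n}\,\inf\{s>0 : |\eta_n\cap B(x,s)|>k\}\quad\text{if } |\eta_n|\ge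 k+1,\qquad L_{n,k}=0 \quad\text{otherwise},$$ where $B(x,s)$ is the closed Euclidean ball. For random variables $X,Z$ with values in $\mathbb{N}_0=\{0,1,2,\dots\}$ let $d_{\mathrm{TV}}(X,Z)=\sup_{B\subset\mathbb{N}_0}|\mathbb{P}[X\in B]-\mathbb{P}[Z\in B]|$, and let $\mathsf{Po}_\alpha$ be a Poisson variable with mean $\alpha$. Let $\beta'>0$ and let $r_n\ge 0$ be such that $\mathbb{E}[\xi_{n,r_n}]\to\beta'$ as $n\to\infty$. Then, as $n\to\infty$, $$d_{\mathrm{TV}}\big(\xi_{n,r_n},\mathsf{Po}_{\mathbb{E}[\xi_{n,r_n}]}\big)=O\big((\log n)^{1-d}\big)$$ and $$\mathbb{P}[L_{n,k}\le r_n]-\exp\big(-\mathbb{E}[\xi_{n,r_n}]\big)=O\big((\log n)^{1-d}\big).$$ Here $n$ may tend to infinity through any given set $S\subseteq[1,\infty)$, for instance the positive integers or all real numbers $n\ge1$. -/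

import Mathlib

open MeasureTheory ProbabilityTheory Filter Topology Set
open scoped ENNReal NNReal

/-- Euclidean space `ℝ^d`. -/
abbrev Euc (d : ℕ) : Type := EuclideanSpace ℝ (Fin d)

section Geometry

/-- The closed epigraph `{(u, z) : z ≥ φ(u)}` in `ℝ^m × ℝ`, the product carrying the Euclidean
distance. -/
def closedEpigraph {m : ℕ} (φ : Euc m → ℝ) : Set (WithLp 2 (Euc m × ℝ)) :=
  {p | φ p.fst ≤ p.snd}

/-- `A ⊆ ℝ^d` has `C²` boundary: near each boundary point, after a rigid motion onto
`ℝ^{d-1} × ℝ`, the set `A` coincides with the closed epigraph of a `C²` function on `ℝ^{d-1}`. -/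
def HasC2Boundary {d : ℕ} (A : Set (Euc d)) : Prop :=
  ∀ x ∈ frontier A, ∃ (ρ : Euc d ≃ᵢ WithLp 2 (Euc (d - 1) × ℝ)) (U : Set (Euc d))
    (φ : Euc (d - 1) → ℝ),
    IsOpen U ∧ x ∈ U ∧ ContDiff ℝ 2 φ ∧ ρ '' (A ∩ U) = ρ '' U ∩ closedEpigraph φ

/-- The boundary of `A` is the union of finitely many closed line segments. -/
def HasPolygonalBoundary {d : ℕ} (A : Set (Euc d)) : Prop :=
  ∃ s : Finset (Euc d × Euc d), frontier A = ⋃ p ∈ s, segment ℝ p.1 p.2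

end Geometry

section GeometricGraph

variable {d : ℕ}

/-- The geometric graph `G(X, r)`: its vertex set is `X`, and two distinct vertices are adjacent
if their Euclidean distance is at most `r`. -/
def geometricGraph (X : Set (Euc d)) (r : ℝ) : SimpleGraph X where
  Adj x y := x ≠ y ∧ dist (x : Euc d) (y : Euc d) ≤ r
  symm := ⟨fun _ _ h => ⟨h.1.symm, by rw [dist_comm]; exact h.2⟩⟩
  loopless := ⟨fun _ h => h.1 rfl⟩

/-- The number of vertices of degree less than `k` in `G(X, r)`. -/
noncomputable def numIsolated (k : ℕ) (X : Set (Euc d)) (r : ℝ) : ℕ :=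
  {x : X | ((geometricGraph X r).neighborSet x).encard < k}.ncard

open Classical in
/-- The largest `k`-nearest-neighbour link `L_k(X)` of a finite set `X`: the maximum over `x ∈ X`
of `inf {r > 0 : |X ∩ B(x, r)| > k}` if `X` has at least `k + 1` points, and `0` otherwise. -/
noncomputable def largestLink (k : ℕ) (X : Set (Euc d)) : ℝ :=
  if ((k + 1 : ℕ) : ℕ∞) ≤ X.encard then
    ⨆ x : X, sInf {r : ℝ | 0 < r ∧ (k : ℕ∞) < (X ∩ Metric.closedBall (x : Euc d) r).encard}
  else 0

end GeometricGraph

section Probability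

/-- The measure on `ℝ^d` with Lebesgue density `f`. -/
noncomputable def densityMeasure {d : ℕ} (f : Euc d → ℝ) : Measure (Euc d) :=
  volume.withDensity (fun x => ENNReal.ofReal (f x))

/-- `f` is a probability density on `ℝ^d` whose distribution has compact (topological) support
`A`, and `f` is continuous and bounded away from zero on `A`. -/
structure WorkingAssumption {d : ℕ} (f : Euc d → ℝ) (A : Set (Euc d)) : Prop where
  nonneg : ∀ x, 0 ≤ f x
  measurable : Measurable f
  isProbability : IsProbabilityMeasure (densityMeasure f)
  support_eq : (densityMeasure f).support = A
  isCompact : IsCompact A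
  continuousOn : ContinuousOn f A
  bounded_below : ∃ c : ℝ, 0 < c ∧ ∀ x ∈ A, c ≤ f x

/-- `η` is (the random set of points of) a Poisson point process in `ℝ^d` with intensity measure
`Λ` on the probability space `(Ω, P)`: a random locally finite set whose number of points in a
measurable set `B` with `Λ B < ∞` is Poisson distributed with mean `Λ B`, the numbers of points in
finitely many pairwise disjoint measurable sets being independent. (For a random *set* of points
this is the usual notion when `Λ` is diffuse, in particular when it has a density.) -/
structure IsPoissonProcess {d : ℕ} {Ω : Type*} [MeasurableSpace Ω] (P : Measure Ω)
    (η : Ω → Set (Euc d)) (Λ : Measure (Euc d)) : Prop where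
  locallyFinite : ∀ ω (B : Set (Euc d)), Bornology.IsBounded B → (η ω ∩ B).Finite
  measurable_count : ∀ B : Set (Euc d), MeasurableSet B →
    Measurable (fun ω => (η ω ∩ B).encard)
  count_law : ∀ B : Set (Euc d), MeasurableSet B → Λ B ≠ ∞ → ∀ m : ℕ,
    P {ω | (η ω ∩ B).encard = (m : ℕ∞)} = poissonMeasure (Λ B).toNNReal {m}
  indep_count : ∀ (m : ℕ) (B : Fin m → Set (Euc d)), (∀ i, MeasurableSet (B i)) →
    Pairwise (Function.onFun Disjoint B) → iIndepFun (fun i ω => (η ω ∩ B i).encard) P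

/-- The total variation distance `sup_{B ⊆ ℕ} |P[X ∈ B] - Q[Z ∈ B]|` between (the laws of) two
random variables with values in `{0, 1, 2, …}`. -/
noncomputable def dTV {Ω Ω' : Type*} [MeasurableSpace Ω] [MeasurableSpace Ω']
    (X : Ω → ℕ) (P : Measure Ω) (Z : Ω' → ℕ) (Q : Measure Ω') : ℝ :=
  ⨆ B : Set ℕ, |P.real (X ⁻¹' B) - Q.real (Z ⁻¹' B)|

/-- The expectation of the number of vertices of degree less than `k` in `G(η, r)`. -/
noncomputable def meanIsolated {d : ℕ} {Ω : Type*} [MeasurableSpace Ω] (P : Measure Ω)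
    (η : Ω → Set (Euc d)) (k : ℕ) (r : ℝ) : ℝ :=
  ∫ ω, (numIsolated k (η ω) r : ℝ) ∂P

end Probability

/-! # Poisson approximation for the vertices of low degree in a geometric graph

Write `Λ = n • ν` for the intensity measure, `B x` for the closed ball of radius `r` around `x`, and
`ψ t` for the probability that a Poisson variable of mean `t` is less than `k` (`poissonBelow`). A
vertex at `x` has degree less than `k` with probability `ψ (Λ (B x))`, and vertices at distance more
than `2r` do not influence each other. The Chen–Stein method for locally dependent indicators
(`abs_measureReal_sum_sub_poissonMeasure_le`) therefore gives a Poisson approximation whose error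
is at most `2 exp (E ξ)` times the integral, over pairs `x`, `y` with `dist x y ≤ 2r`, of
`ψ (Λ (B x)) ψ (Λ (B y))` plus the joint isolation probability. The latter is at most
`ψ (Λ (B x)) ψ (Λ (B y \ B x))`, and the same with `x` and `y` exchanged. The Chen–Stein bound is
applied to a finite partition of space, on which the count is a sum of indicators of cells, and the
partition is refined; almost surely the discretised count is eventually exact, since almost surely
no two points are at distance exactly `r`. This yields the formula for the mean
(`IsPoissonProcess.meanIsolated_eq`) and the bound `IsPoissonProcess.abs_numIsolated_sub_le` for a
fixed intensity; no Palm calculus is needed.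

The geometry of the support `A` enters through `HasBallGrowth`: `A ∩ B x` has volume of order
`r ^ d`, and at least one of `A ∩ (B y \ B x)`, `A ∩ (B x \ B y)` has volume at least of order
`r ^ (d - 1) * dist x y`. Both follow from a local condition (`HasLocalCones`): for two points of
`A` close to each other one can move from one of them, inside `A`, along a cone of directions that
lead away from the other one. At interior points and at `C²` boundary points one common cone serves
all nearby points. At a boundary point of a polygonal set, `A` agrees locally with a closed cone
with finitely many boundary rays. Pairs of points of the cone with nearly equal directions have a
common cone of directions, and otherwise it helps to move radially outwards.

Put `T = n r ^ d`. The mean is at least `n exp (-C T)`, so its convergence forces `T` to be at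
least of order `log n`, and since the limit is positive, `r` is eventually small. The first part of
the error is of order `T exp (-c T)`. The second part is at most a constant multiple of
`∫ n exp (-c n r ^ (d - 1) ‖y‖) dy`, which is of order `T ^ (1 - d)`, and so the total variation
distance is of order `(log n) ^ (1 - d)` (`WorkingAssumption.exists_eventually_poisson_bound`). The
event that the largest link is at most `r` is, unless there are at most `k` points, the event that
no vertex has degree less than `k` (`largestLink_le_iff`), which gives the second assertion.
-/

set_option linter.unusedSectionVars false

/-! ### Stein's method for the Poisson distribution -/

/-- The weight `e^{-l} l^j / j!` that the Poisson law of mean `l` gives to `j`. -/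
noncomputable def poissonWeight (l : ℝ) (j : ℕ) : ℝ := Real.exp (-l) * l ^ j / (j.factorial : ℝ)

lemma poissonWeight_nonneg {l : ℝ} (hl : 0 ≤ l) (j : ℕ) : 0 ≤ poissonWeight l j := by
  unfold poissonWeight; positivity

lemma poissonWeight_pos {l : ℝ} (hl : 0 < l) (j : ℕ) : 0 < poissonWeight l j := by
  unfold poissonWeight; positivity

lemma poissonWeight_succ (l : ℝ) (j : ℕ) :
    ((j : ℝ) + 1) * poissonWeight l (j + 1) = l * poissonWeight l j := by
  unfold poissonWeight
  rw [Nat.factorial_succ]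
  push_cast
  field_simp
  ring

lemma hasSum_poissonWeight (l : ℝ≥0) : HasSum (poissonWeight l) 1 :=
  hasSum_one_poissonMeasure l

lemma hasSum_poissonWeight_indicator (l : ℝ≥0) (B : Set ℕ) :
    HasSum (fun j => poissonWeight l j * B.indicator 1 j) ((poissonMeasure l).real B) := by
  have h := hasSum_integral_poissonMeasure (r := l) (f := B.indicator (1 : ℕ → ℝ))
    ((integrable_const (1 : ℝ)).indicator (MeasurableSet.of_discrete))
  rw [integral_indicator_one MeasurableSet.of_discrete] at h
  simpa [poissonWeight] using h

/-- Partial sums of the centred indicator of `B`, weighted by the Poisson law. -/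
noncomputable def steinPartial (l : ℝ≥0) (B : Set ℕ) (j : ℕ) : ℝ :=
  ∑ i ∈ Finset.range (j + 1), poissonWeight l i * (B.indicator 1 i - (poissonMeasure l).real B)

/-- The solution of the Stein equation `l g(j + 1) - j g(j) = 1_B(j) - Po_l(B)` for the Poisson
law, normalised by `g(0) = 0`. -/
noncomputable def steinSolution (l : ℝ≥0) (B : Set ℕ) : ℕ → ℝ
  | 0 => 0
  | j + 1 => steinPartial l B j / (l * poissonWeight l j)

lemma steinSolution_eq {l : ℝ≥0} (hl : 0 < l) (B : Set ℕ) (j : ℕ) :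
    l * steinSolution l B (j + 1) - j * steinSolution l B j
      = B.indicator 1 j - (poissonMeasure l).real B := by
  have hl' : (0 : ℝ) < l := by exact_mod_cast hl
  have hl0 := hl'.ne'
  cases j with
  | zero =>
    have hw := (poissonWeight_pos hl' 0).ne'
    simp only [steinSolution, steinPartial, zero_add, Finset.range_one, Finset.sum_singleton]
    field_simp
    simp
  | succ j =>
    have hw := (poissonWeight_pos hl' j).ne'
    have hw' := (poissonWeight_pos hl' (j + 1)).ne'
    have hs := poissonWeight_succ (l : ℝ) j
    have hp : steinPartial l B (j + 1) = steinPartial l B j + poissonWeight l (j + 1) *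
        (B.indicator 1 (j + 1) - (poissonMeasure l).real B) := by
      simp only [steinPartial]; rw [Finset.sum_range_succ]
    simp only [steinSolution]
    rw [hp, ← hs]
    push_cast
    field_simp
    ring

lemma poissonWeight_shift_le {l : ℝ} (hl : 0 ≤ l) (j m : ℕ) :
    poissonWeight l (m + (j + 1)) ≤ l * poissonWeight l j * (l ^ m / (m.factorial : ℝ)) := by
  unfold poissonWeight
  have h : ((j.factorial : ℝ) * m.factorial) ≤ ((m + (j + 1)).factorial : ℝ) := by
    have h1 : j.factorial * m.factorial ≤ (j + m).factorial :=
      Nat.le_of_dvd (Nat.factorial_pos _) (Nat.factorial_mul_factorial_dvd_factorial_add j m)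
    have h2 : (j + m).factorial ≤ (m + (j + 1)).factorial := Nat.factorial_le (by omega)
    exact_mod_cast h1.trans h2
  have h0 : (0 : ℝ) < (j.factorial : ℝ) * m.factorial := by positivity
  calc Real.exp (-l) * l ^ (m + (j + 1)) / ((m + (j + 1)).factorial : ℝ)
      ≤ Real.exp (-l) * l ^ (m + (j + 1)) / ((j.factorial : ℝ) * m.factorial) := by gcongr
    _ = _ := by rw [pow_add, pow_succ]; field_simp

/-- As the full series of the centred indicator vanishes, a partial sum is minus a tail, which is at
most the tail of the exponential series. -/
lemma abs_steinPartial_le (l : ℝ≥0) (B : Set ℕ) (j : ℕ) :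
    |steinPartial l B j| ≤ l * poissonWeight l j * Real.exp l := by
  set p := (poissonMeasure l).real B with hp
  have hp0 : 0 ≤ p := measureReal_nonneg
  have hp1 : p ≤ 1 := measureReal_le_one
  have hsum : HasSum (fun i => poissonWeight l i * (B.indicator 1 i - p)) 0 := by
    have := (hasSum_poissonWeight_indicator l B).sub ((hasSum_poissonWeight l).mul_right p)
    simpa [mul_sub, hp] using this
  -- The full series vanishes, so a partial sum is minus the tail.
  have htail := (hasSum_nat_add_iff' (j + 1)).2 hsum
  rw [zero_sub] at htail
  have hexp : HasSum (fun m : ℕ => l * poissonWeight l j * ((l : ℝ) ^ m / (m.factorial : ℝ)))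
      (l * poissonWeight l j * Real.exp l) := by
    have := (NormedSpace.expSeries_div_hasSum_exp (l : ℝ)).mul_left (l * poissonWeight l j)
    rwa [← Real.exp_eq_exp_ℝ] at this
  have hle : ∀ m : ℕ, ‖poissonWeight l (m + (j + 1)) * (B.indicator 1 (m + (j + 1)) - p)‖
      ≤ l * poissonWeight l j * ((l : ℝ) ^ m / (m.factorial : ℝ)) := by
    intro m
    refine le_trans ?_ (poissonWeight_shift_le l.coe_nonneg j m)
    rw [norm_mul, Real.norm_of_nonneg (poissonWeight_nonneg l.coe_nonneg _)]
    refine mul_le_of_le_one_right (poissonWeight_nonneg l.coe_nonneg _) ?_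
    rw [Real.norm_eq_abs, abs_le]
    by_cases h : m + (j + 1) ∈ B
    · simp only [h, indicator_of_mem, Pi.one_apply]; constructor <;> linarith
    · simp only [h, not_false_eq_true, indicator_of_notMem]; constructor <;> linarith
  have := tsum_of_norm_bounded hexp hle
  rw [htail.tsum_eq, norm_neg, Real.norm_eq_abs] at this
  exact this

lemma abs_steinSolution_le {l : ℝ≥0} (hl : 0 < l) (B : Set ℕ) (j : ℕ) :
    |steinSolution l B j| ≤ Real.exp l := by
  have hl' : (0 : ℝ) < l := by exact_mod_cast hl
  cases j with
  | zero => simpa [steinSolution] using (Real.exp_pos _).le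
  | succ j =>
    have h := mul_pos hl' (poissonWeight_pos hl' j)
    rw [steinSolution, abs_div, abs_of_pos h, div_le_iff₀ h, mul_comm]
    exact abs_steinPartial_le l B j

/-- A bound for increments that is linear in their length, so that its expectation is a sum over
the neighbours of an index. -/
lemma abs_steinSolution_sub_le {l : ℝ≥0} (hl : 0 < l) (B : Set ℕ) (a b : ℕ) :
    |steinSolution l B (a + b) - steinSolution l B a| ≤ 2 * Real.exp l * b := by
  rcases Nat.eq_zero_or_pos b with rfl | hb
  · simp
  have h1 := abs_steinSolution_le hl B (a + b)
  have h2 := abs_steinSolution_le hl B a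
  have hb' : (1 : ℝ) ≤ b := by exact_mod_cast hb
  have h3 := abs_sub (steinSolution l B (a + b)) (steinSolution l B a)
  have := Real.exp_pos l
  nlinarith

section ChenStein

variable {Ω : Type*} [MeasurableSpace Ω] {P : Measure Ω} [IsProbabilityMeasure P]

lemma integrable_comp_of_bounded {X : Ω → ℕ} (hX : Measurable X) {g : ℕ → ℝ} {C : ℝ}
    (hg : ∀ j, |g j| ≤ C) : Integrable (fun ω => g (X ω)) P :=
  Integrable.of_bound ((measurable_from_nat.comp hX).aestronglyMeasurable) C
    (ae_of_all _ fun ω => by simpa using hg (X ω))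

/-- **Chen–Stein Poisson approximation** for a sum of locally dependent Bernoulli variables: if
`I i` is independent of the sum of the `I j` over all `j` that are not related to `i`, then the law
of `∑ i, I i` is close to a Poisson law as soon as the two sums over related pairs are small. -/
theorem abs_measureReal_sum_sub_poissonMeasure_le {ι : Type*} [DecidableEq ι] (s : Finset ι)
    (I : ι → Ω → ℕ)
    (hI : ∀ i, Measurable (I i)) (hI1 : ∀ i ω, I i ω ≤ 1)
    (R : ι → ι → Prop) [DecidableRel R] (hR : ∀ i, R i i)
    (hind : ∀ i ∈ s, IndepFun (I i) (fun ω => ∑ j ∈ s with ¬ R i j, I j ω) P)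
    {l : ℝ≥0} (hl : 0 < l) (hlsum : (l : ℝ) = ∑ i ∈ s, ∫ ω, (I i ω : ℝ) ∂P) (B : Set ℕ) :
    |P.real ((fun ω => ∑ i ∈ s, I i ω) ⁻¹' B) - (poissonMeasure l).real B| ≤
      2 * Real.exp l * (∑ i ∈ s, ∑ j ∈ s with R i j,
        ((∫ ω, (I i ω : ℝ) ∂P) * (∫ ω, (I j ω : ℝ) ∂P)
          + if i = j then 0 else ∫ ω, (I i ω : ℝ) * (I j ω : ℝ) ∂P)) := by
  set g := steinSolution l B with hg
  set W : Ω → ℕ := fun ω => ∑ i ∈ s, I i ω with hW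
  have hWm : Measurable W := Finset.measurable_sum _ fun i _ => hI i
  have hgb : ∀ j, |g j| ≤ Real.exp l := abs_steinSolution_le hl B
  have hIb : ∀ i ω, |(I i ω : ℝ)| ≤ 1 := fun i ω => by
    rw [abs_of_nonneg (Nat.cast_nonneg _)]; exact_mod_cast hI1 i ω
  have hIint : ∀ i, Integrable (fun ω => (I i ω : ℝ)) P := fun i =>
    Integrable.of_bound ((measurable_from_nat.comp (hI i)).aestronglyMeasurable) 1
      (ae_of_all _ fun ω => by simpa using hIb i ω)
  have hIIint : ∀ i (f : Ω → ℝ), Integrable f P → Integrable (fun ω => (I i ω : ℝ) * f ω) P :=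
    fun i f hf => hf.bdd_mul (c := 1) ((measurable_from_nat.comp (hI i)).aestronglyMeasurable)
      (ae_of_all _ fun ω => by rw [Real.norm_eq_abs]; exact hIb i ω)
  have hgint : ∀ X : Ω → ℕ, Measurable X → Integrable (fun ω => g (X ω)) P := fun X hX =>
    integrable_comp_of_bounded hX hgb
  -- The Stein equation turns the difference of probabilities into an expectation.
  have hstein : P.real (W ⁻¹' B) - (poissonMeasure l).real B
      = ∫ ω, (l * g (W ω + 1) - W ω * g (W ω)) ∂P := by
    have h1 : ∀ ω, l * g (W ω + 1) - W ω * g (W ω)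
        = (W ⁻¹' B).indicator 1 ω - (poissonMeasure l).real B := fun ω => by
      rw [hg, steinSolution_eq hl B (W ω)]; rfl
    simp_rw [h1]
    rw [integral_sub, integral_indicator_one (hWm MeasurableSet.of_discrete)]
    · simp
    · exact (integrable_const (1 : ℝ)).indicator (hWm MeasurableSet.of_discrete)
    · exact integrable_const _
  have hsplit : ∫ ω, (l * g (W ω + 1) - W ω * g (W ω)) ∂P
      = ∑ i ∈ s, ((∫ ω, (I i ω : ℝ) ∂P) * (∫ ω, g (W ω + 1) ∂P)
          - ∫ ω, (I i ω : ℝ) * g (W ω) ∂P) := by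
    have hWg : (fun ω => (W ω : ℝ) * g (W ω)) = fun ω => ∑ i ∈ s, (I i ω : ℝ) * g (W ω) := by
      ext ω; rw [← Finset.sum_mul]; simp [hW]
    have hint1 : Integrable (fun ω => ∑ i ∈ s, (I i ω : ℝ) * g (W ω)) P :=
      integrable_finsetSum _ fun i _ => hIIint i _ (hgint W hWm)
    rw [integral_sub ((hgint _ (hWm.add_const 1)).const_mul _) (by rw [hWg]; exact hint1), hWg,
      integral_finsetSum _ (fun i _ => hIIint i _ (hgint W hWm)), integral_const_mul, hlsum,
      Finset.sum_sub_distrib, Finset.sum_mul]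
  rw [hstein, hsplit]
  refine (Finset.abs_sum_le_sum_abs _ _).trans ?_
  rw [Finset.mul_sum]
  refine Finset.sum_le_sum fun i hi => ?_
  -- `V` is the part of the sum that is independent of `I i`, `N` the other neighbours of `i`.
  set V : Ω → ℕ := fun ω => ∑ j ∈ s with ¬ R i j, I j ω with hV
  set N : Ω → ℕ := fun ω => ∑ j ∈ s with R i j, I j ω with hN
  set N' : Ω → ℕ := fun ω => ∑ j ∈ s with R i j, (if i = j then 0 else I j ω) with hN'
  have hVm : Measurable V := Finset.measurable_sum _ fun i _ => hI i
  have hNm : Measurable N := Finset.measurable_sum _ fun i _ => hI i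
  have hWVN : ∀ ω, W ω = V ω + N ω := fun ω => by
    simp only [hW, hV, hN]; rw [add_comm, Finset.sum_filter_add_sum_filter_not]
  have hNN' : ∀ ω, N ω = N' ω + I i ω := fun ω => by
    simp only [hN, hN']
    have : I i ω = ∑ j ∈ s with R i j, (if i = j then I j ω else 0) := by
      rw [Finset.sum_ite_eq]; simp [hi, hR]
    rw [this, ← Finset.sum_add_distrib]
    refine Finset.sum_congr rfl fun j _ => ?_
    split_ifs <;> simp
  have hindep : ∫ ω, (I i ω : ℝ) * g (V ω + 1) ∂P
      = (∫ ω, (I i ω : ℝ) ∂P) * ∫ ω, g (V ω + 1) ∂P := by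
    have hcast : Measurable (fun n : ℕ => (n : ℝ)) := measurable_from_nat
    have hgm : Measurable (fun n : ℕ => g (n + 1)) := measurable_from_nat
    have := (hind i hi).comp hcast hgm
    exact this.integral_fun_mul_eq_mul_integral (hIint i).aestronglyMeasurable
      (hgint _ (hVm.add_const 1)).aestronglyMeasurable
  have hgW1 := hgint _ (hWm.add_const 1)
  have hgV1 := hgint _ (hVm.add_const 1)
  have hpos : ∫ ω, (I i ω : ℝ) ∂P = |∫ ω, (I i ω : ℝ) ∂P| :=
    (abs_of_nonneg (integral_nonneg fun ω => Nat.cast_nonneg _)).symm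
  have hNint : ∫ ω, (N ω : ℝ) ∂P = ∑ j ∈ s with R i j, ∫ ω, (I j ω : ℝ) ∂P := by
    simp only [hN]; push_cast; exact integral_finsetSum _ fun j _ => hIint j
  have hNi : Integrable (fun ω => (N ω : ℝ)) P := by
    simp only [hN]; push_cast; exact integrable_finsetSum _ fun j _ => hIint j
  have e1 : |(∫ ω, g (W ω + 1) ∂P) - ∫ ω, g (V ω + 1) ∂P|
      ≤ 2 * Real.exp l * ∑ j ∈ s with R i j, ∫ ω, (I j ω : ℝ) ∂P := by
    rw [← integral_sub hgW1 hgV1, ← hNint, ← integral_const_mul]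
    refine (abs_integral_le_integral_abs).trans
      (integral_mono (hgW1.sub hgV1).abs (hNi.const_mul _) fun ω => ?_)
    have := abs_steinSolution_sub_le hl B (V ω + 1) (N ω)
    simpa only [hWVN, add_right_comm] using this
  have hN'cast : ∀ ω, (I i ω : ℝ) * (N' ω : ℝ)
      = ∑ j ∈ s with R i j, (if i = j then 0 else (I i ω : ℝ) * (I j ω : ℝ)) := fun ω => by
    simp only [hN']; push_cast; rw [Finset.mul_sum]
    refine Finset.sum_congr rfl fun j _ => ?_
    split_ifs <;> simp
  have hIIi : ∀ j, Integrable (fun ω => if i = j then (0 : ℝ) else (I i ω : ℝ) * (I j ω : ℝ)) P := by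
    intro j
    split_ifs
    · exact integrable_zero _ _ _
    · exact hIIint i _ (hIint j)
  have e2 : |(∫ ω, (I i ω : ℝ) * g (V ω + 1) ∂P) - ∫ ω, (I i ω : ℝ) * g (W ω) ∂P|
      ≤ 2 * Real.exp l * ∑ j ∈ s with R i j,
        if i = j then 0 else ∫ ω, (I i ω : ℝ) * (I j ω : ℝ) ∂P := by
    have hsum : ∑ j ∈ s with R i j, (if i = j then 0 else ∫ ω, (I i ω : ℝ) * (I j ω : ℝ) ∂P)
        = ∫ ω, (I i ω : ℝ) * (N' ω : ℝ) ∂P := by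
      simp_rw [hN'cast]
      rw [integral_finsetSum _ fun j _ => hIIi j]
      refine Finset.sum_congr rfl fun j _ => ?_
      split_ifs <;> simp
    have hIN' : Integrable (fun ω => (I i ω : ℝ) * (N' ω : ℝ)) P := by
      simp_rw [hN'cast]; exact integrable_finsetSum _ fun j _ => hIIi j
    have hA := hIIint i _ hgV1
    have hB := hIIint i _ (hgint W hWm)
    rw [hsum, ← integral_sub hA hB, ← integral_const_mul]
    refine (abs_integral_le_integral_abs).trans
      (integral_mono (hA.sub hB).abs (hIN'.const_mul _) fun ω => ?_)
    -- On `I i = 1` the total is `W = (V + 1) + N'`.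
    have h01 : I i ω = 0 ∨ I i ω = 1 := by have := hI1 i ω; omega
    rcases h01 with h | h
    · simp [h]
    · have := abs_steinSolution_sub_le hl B (V ω + 1) (N' ω)
      have hW1 : W ω = V ω + 1 + N' ω := by rw [hWVN, hNN', h]; ring
      simp only [h, hW1, Nat.cast_one, one_mul]
      rw [abs_sub_comm]; exact this
  calc _ = |(∫ ω, (I i ω : ℝ) ∂P) * ((∫ ω, g (W ω + 1) ∂P) - ∫ ω, g (V ω + 1) ∂P)
          + ((∫ ω, (I i ω : ℝ) * g (V ω + 1) ∂P) - ∫ ω, (I i ω : ℝ) * g (W ω) ∂P)| := by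
        rw [hindep]; congr 1; ring
    _ ≤ (∫ ω, (I i ω : ℝ) ∂P) * (2 * Real.exp l * ∑ j ∈ s with R i j, ∫ ω, (I j ω : ℝ) ∂P)
          + 2 * Real.exp l * ∑ j ∈ s with R i j,
            if i = j then 0 else ∫ ω, (I i ω : ℝ) * (I j ω : ℝ) ∂P := by
        refine (abs_add_le _ _).trans (add_le_add ?_ e2)
        rw [abs_mul, ← hpos]
        exact mul_le_mul_of_nonneg_left e1 (integral_nonneg fun ω => Nat.cast_nonneg _)
    _ = _ := by
        rw [Finset.sum_add_distrib, ← Finset.mul_sum]; ring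

end ChenStein

/-! ### Counts of a Poisson process -/

/-- The probability `∑_{j < k} e^{-t} t^j / j!` that a Poisson variable of mean `t` is less
than `k`. -/
noncomputable def poissonBelow (k : ℕ) (t : ℝ) : ℝ := ∑ j ∈ Finset.range k, poissonWeight t j

lemma continuous_poissonBelow (k : ℕ) : Continuous (poissonBelow k) := by
  unfold poissonBelow poissonWeight; fun_prop

lemma poissonBelow_nonneg (k : ℕ) {t : ℝ} (ht : 0 ≤ t) : 0 ≤ poissonBelow k t :=
  Finset.sum_nonneg fun j _ => poissonWeight_nonneg ht j

lemma poissonBelow_le_one (k : ℕ) {t : ℝ} (ht : 0 ≤ t) : poissonBelow k t ≤ 1 :=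
  sum_le_hasSum _ (fun j _ => poissonWeight_nonneg ht j) (hasSum_poissonWeight ⟨t, ht⟩)

section PoissonProcess

variable {d : ℕ} {Ω : Type*} [MeasurableSpace Ω] {P : Measure Ω} [IsProbabilityMeasure P]
  {η : Ω → Set (Euc d)} {Λ : Measure (Euc d)} [IsFiniteMeasure Λ]

lemma IsPoissonProcess.measurableSet_count (h : IsPoissonProcess P η Λ) {B : Set (Euc d)}
    (hB : MeasurableSet B) (S : Set ℕ∞) : MeasurableSet {ω | (η ω ∩ B).encard ∈ S} :=
  h.measurable_count B hB MeasurableSet.of_discrete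

lemma IsPoissonProcess.measureReal_count_eq (h : IsPoissonProcess P η Λ) {B : Set (Euc d)}
    (hB : MeasurableSet B) (m : ℕ) :
    P.real {ω | (η ω ∩ B).encard = (m : ℕ∞)} = poissonWeight (Λ.real B) m := by
  rw [measureReal_def, h.count_law B hB (measure_ne_top _ _) m, ← measureReal_def,
    poissonMeasure_real_singleton]
  rfl

lemma IsPoissonProcess.measureReal_count_lt (h : IsPoissonProcess P η Λ) {B : Set (Euc d)}
    (hB : MeasurableSet B) (k : ℕ) :
    P.real {ω | (η ω ∩ B).encard < (k : ℕ∞)} = poissonBelow k (Λ.real B) := by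
  have hU : {ω | (η ω ∩ B).encard < (k : ℕ∞)}
      = ⋃ m ∈ Finset.range k, {ω | (η ω ∩ B).encard = (m : ℕ∞)} := by
    ext ω
    simp only [mem_ofPred_eq, mem_iUnion, Finset.mem_range, exists_prop]
    constructor
    · intro hlt
      obtain ⟨m, hm⟩ := ENat.ne_top_iff_exists.1 hlt.ne_top
      exact ⟨m, by rw [← hm] at hlt; exact_mod_cast hlt, hm.symm⟩
    · rintro ⟨m, hm, he⟩
      rw [he]; exact_mod_cast hm
  rw [hU, measureReal_biUnion_finset]
  · exact Finset.sum_congr rfl fun m _ => h.measureReal_count_eq hB m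
  · intro m _ m' _ hne
    refine Set.disjoint_left.2 fun ω h1 h2 => hne ?_
    simp only [mem_ofPred_eq] at h1 h2
    rw [h1] at h2; exact_mod_cast h2
  · intro m _
    exact h.measurableSet_count hB {(m : ℕ∞)}

lemma IsPoissonProcess.measureReal_one_le_count (h : IsPoissonProcess P η Λ) {B : Set (Euc d)}
    (hB : MeasurableSet B) :
    P.real {ω | 1 ≤ (η ω ∩ B).encard} = 1 - Real.exp (-Λ.real B) := by
  have h0 : {ω | 1 ≤ (η ω ∩ B).encard} = {ω | (η ω ∩ B).encard = ((0 : ℕ) : ℕ∞)}ᶜ := by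
    ext ω
    simp only [mem_ofPred_eq, mem_compl_iff, Nat.cast_zero]
    exact Order.one_le_iff_pos.trans pos_iff_ne_zero
  have hm : MeasurableSet {ω | (η ω ∩ B).encard = ((0 : ℕ) : ℕ∞)} :=
    h.measurableSet_count hB {((0 : ℕ) : ℕ∞)}
  rw [h0, probReal_compl_eq_one_sub hm, h.measureReal_count_eq hB 0]
  simp [poissonWeight]

lemma IsPoissonProcess.measureReal_one_le_count_le (h : IsPoissonProcess P η Λ) {B : Set (Euc d)}
    (hB : MeasurableSet B) :
    P.real {ω | 1 ≤ (η ω ∩ B).encard} ≤ Λ.real B := by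
  rw [h.measureReal_one_le_count hB]
  linarith [Real.add_one_le_exp (-Λ.real B)]

/-- Counts in finitely many disjoint sets are independent, in product form. -/
lemma IsPoissonProcess.measureReal_iInter_count (h : IsPoissonProcess P η Λ) {m : ℕ}
    (B : Fin m → Set (Euc d)) (hB : ∀ i, MeasurableSet (B i))
    (hd : Pairwise (Function.onFun Disjoint B)) (S : Fin m → Set ℕ∞) :
    P.real {ω | ∀ i, (η ω ∩ B i).encard ∈ S i}
      = ∏ i, P.real {ω | (η ω ∩ B i).encard ∈ S i} := by
  have := (h.indep_count m B hB hd).measure_inter_preimage_eq_mul Finset.univ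
    (sets := S) (fun i _ => MeasurableSet.of_discrete)
  have he : {ω | ∀ i, (η ω ∩ B i).encard ∈ S i}
      = ⋂ i ∈ (Finset.univ : Finset (Fin m)), (fun ω => (η ω ∩ B i).encard) ⁻¹' S i := by
    ext ω; simp
  rw [he, measureReal_def, this, ENNReal.toReal_prod]
  rfl

lemma IsPoissonProcess.ae_finite (h : IsPoissonProcess P η Λ) : ∀ᵐ ω ∂P, (η ω).Finite := by
  have hU : {ω | (η ω).Finite} = ⋃ m : ℕ, {ω | (η ω ∩ univ).encard = (m : ℕ∞)} := by
    ext ω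
    simp only [mem_ofPred_eq, mem_iUnion, inter_univ]
    rw [← Set.encard_ne_top_iff, ENat.ne_top_iff_exists]
    exact ⟨fun ⟨m, hm⟩ => ⟨m, hm.symm⟩, fun ⟨m, hm⟩ => ⟨m, hm.symm⟩⟩
  have hm : ∀ m : ℕ, MeasurableSet {ω | (η ω ∩ univ).encard = (m : ℕ∞)} := fun m =>
    h.measurableSet_count MeasurableSet.univ {(m : ℕ∞)}
  have hP : P {ω | (η ω).Finite} = 1 := by
    rw [hU, measure_iUnion _ hm]
    · rw [tsum_congr (h.count_law univ MeasurableSet.univ (measure_ne_top _ _))]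
      have hd : Pairwise (Function.onFun Disjoint fun m : ℕ => ({m} : Set ℕ)) := fun m m' hne => by
        simpa [Function.onFun] using hne
      rw [← measure_iUnion hd (fun _ => MeasurableSet.of_discrete), iUnion_of_singleton,
        measure_univ]
    · intro m m' hne
      refine Set.disjoint_left.2 fun ω h1 h2 => hne ?_
      simp only [mem_ofPred_eq] at h1 h2
      rw [h1] at h2; exact_mod_cast h2
  exact (mem_ae_iff_prob_eq_one (by rw [hU]; exact MeasurableSet.iUnion hm)).2 hP

/-- The number of points has finite expectation. -/
lemma IsPoissonProcess.integrable_card (h : IsPoissonProcess P η Λ) :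
    Integrable (fun ω => ((η ω).ncard : ℝ)) P := by
  set l : ℝ≥0 := (Λ univ).toNNReal
  have hX : Measurable (fun ω => (η ω).ncard) := by
    have := h.measurable_count univ MeasurableSet.univ
    simp only [inter_univ] at this
    exact (Measurable.of_discrete (f := ENat.toNat)).comp this
  have hmap : P.map (fun ω => (η ω).ncard) = poissonMeasure l := by
    refine Measure.ext_of_singleton fun m => ?_
    rw [Measure.map_apply hX MeasurableSet.of_discrete,
      ← h.count_law univ MeasurableSet.univ (measure_ne_top _ _)]
    refine measure_congr ?_
    filter_upwards [h.ae_finite] with ω hω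
    refine propext ?_
    change (η ω).ncard = m ↔ (η ω ∩ univ).encard = m
    rw [inter_univ, ← hω.cast_ncard_eq]
    exact_mod_cast Iff.rfl
  have hint : Integrable (fun n : ℕ => (n : ℝ)) (poissonMeasure l) := by
    rw [integrable_poissonMeasure_iff]
    rw [← summable_nat_add_iff 1]
    have := ((hasSum_poissonWeight l).summable).mul_left (l : ℝ)
    refine this.congr fun n => ?_
    rw [← poissonWeight_succ, poissonWeight]
    simp only [Real.norm_natCast]
    push_cast
    ring
  rw [← hmap] at hint
  exact hint.comp_measurable hX

end PoissonProcess

/-! ### Discretisation of the point process -/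

section Discretisation

variable {d : ℕ}

open Classical in
/-- A discretisation of the event that `v` is an isolated vertex. The simple function `c` sends
every point to the representative of its cell. The indicator is `1` if the cell represented by `v`
is occupied and there are fewer than `k` points in the other cells whose representatives are within
distance `r` of `v`. -/
noncomputable def cellIsolated (c : SimpleFunc (Euc d) (Euc d)) (k : ℕ) (r : ℝ) (v : Euc d)
    (X : Set (Euc d)) : ℕ :=
  if 1 ≤ (X ∩ c ⁻¹' {v}).encard ∧
    (X ∩ c ⁻¹' (Metric.closedBall v r \ {v})).encard < (k : ℕ∞) then 1 else 0

lemma cellIsolated_le_one (c : SimpleFunc (Euc d) (Euc d)) (k : ℕ) (r : ℝ) (v : Euc d)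
    (X : Set (Euc d)) : cellIsolated c k r v X ≤ 1 := by
  unfold cellIsolated; split_ifs <;> simp

/-- The number of occupied isolated cells. -/
noncomputable def numCellIsolated (c : SimpleFunc (Euc d) (Euc d)) (k : ℕ) (r : ℝ)
    (X : Set (Euc d)) : ℕ :=
  ∑ v ∈ c.range, cellIsolated c k r v X

/-- The discretised count is the number of representatives of points with fewer than `k` points in
other cells nearby. -/
lemma numCellIsolated_eq_ncard (c : SimpleFunc (Euc d) (Euc d)) (k : ℕ) (r : ℝ)
    (X : Set (Euc d)) :
    numCellIsolated c k r X = {v | v ∈ c '' X ∧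
      (X ∩ c ⁻¹' (Metric.closedBall v r \ {v})).encard < (k : ℕ∞)}.ncard := by
  classical
  have hocc : ∀ v, 1 ≤ (X ∩ c ⁻¹' {v}).encard ↔ v ∈ c '' X := fun v => by
    rw [Set.one_le_encard_iff_nonempty]
    constructor
    · rintro ⟨x, hx, hv⟩; exact ⟨x, hx, hv⟩
    · rintro ⟨x, hx, hv⟩; exact ⟨x, hx, hv⟩
  have : {v | v ∈ c '' X ∧ (X ∩ c ⁻¹' (Metric.closedBall v r \ {v})).encard < (k : ℕ∞)}
      = (c.range.filter fun v => 1 ≤ (X ∩ c ⁻¹' {v}).encard ∧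
          (X ∩ c ⁻¹' (Metric.closedBall v r \ {v})).encard < (k : ℕ∞) : Finset (Euc d)) := by
    ext v
    simp only [mem_ofPred_eq, Finset.coe_filter, hocc]
    constructor
    · rintro ⟨⟨x, hx, rfl⟩, h⟩; exact ⟨c.mem_range_self x, ⟨x, hx, rfl⟩, h⟩
    · exact fun h => h.2
  rw [this, Set.ncard_coe_finset, Finset.card_filter]
  rfl

lemma numCellIsolated_le_ncard (c : SimpleFunc (Euc d) (Euc d)) (k : ℕ) (r : ℝ)
    {X : Set (Euc d)} (hX : X.Finite) : numCellIsolated c k r X ≤ X.ncard := by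
  rw [numCellIsolated_eq_ncard]
  exact (Set.ncard_le_ncard (fun v hv => hv.1) (hX.image _)).trans (Set.ncard_image_le hX)

/-- On a finite configuration the discretised count is exact as soon as the cells separate the
points and the representatives have the same adjacencies as the points. -/
lemma numCellIsolated_eq_numIsolated (c : SimpleFunc (Euc d) (Euc d)) (k : ℕ) (r : ℝ)
    {X : Set (Euc d)} (hinj : InjOn c X)
    (hdist : ∀ x ∈ X, ∀ y ∈ X, dist (c x) (c y) ≤ r ↔ dist x y ≤ r) :
    numCellIsolated c k r X = numIsolated k X r := by
  rw [numCellIsolated_eq_ncard]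
  unfold numIsolated
  have hdeg : ∀ x : X, (X ∩ c ⁻¹' (Metric.closedBall (c x) r \ {c x})).encard
      = ((geometricGraph X r).neighborSet x).encard := by
    intro x
    rw [← Subtype.val_injective.encard_image]
    congr 1
    ext y
    simp only [mem_inter_iff, mem_preimage, Set.mem_sdiff, Metric.mem_closedBall, mem_singleton_iff,
      mem_image, SimpleGraph.mem_neighborSet]
    constructor
    · rintro ⟨hy, h1, h2⟩
      refine ⟨⟨y, hy⟩, ⟨fun h => h2 (by rw [h]), ?_⟩, rfl⟩
      rw [dist_comm]; exact (hdist y hy x x.2).1 h1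
    · rintro ⟨y, ⟨h1, h2⟩, rfl⟩
      refine ⟨y.2, (hdist y y.2 x x.2).2 (by rw [dist_comm]; exact h2), fun h => h1 ?_⟩
      exact (Subtype.ext (hinj y.2 x.2 h)).symm
  have : {v | v ∈ c '' X ∧ (X ∩ c ⁻¹' (Metric.closedBall v r \ {v})).encard < (k : ℕ∞)}
      = (fun x : X => c x) '' {x : X | ((geometricGraph X r).neighborSet x).encard < k} := by
    ext v
    constructor
    · rintro ⟨⟨x, hx, rfl⟩, h⟩
      exact ⟨⟨x, hx⟩, by rw [mem_ofPred_eq, ← hdeg]; exact h, rfl⟩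
    · rintro ⟨x, h, rfl⟩
      exact ⟨⟨x, x.2, rfl⟩, by rw [hdeg]; exact h⟩
  rw [this, Set.ncard_image_of_injective]
  exact fun x y h => Subtype.ext (hinj x.2 y.2 h)

/-- For simple functions `c n` that converge pointwise to the identity, the discretised count is
eventually exact on any finite configuration without pairs at distance exactly `r`. -/
lemma eventually_numCellIsolated_eq {c : ℕ → SimpleFunc (Euc d) (Euc d)}
    (hc : ∀ x, Tendsto (fun n => c n x) atTop (𝓝 x)) (k : ℕ) (r : ℝ) {X : Set (Euc d)}
    (hX : X.Finite) (hr : ∀ x ∈ X, ∀ y ∈ X, x ≠ y → dist x y ≠ r) :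
    ∀ᶠ n in atTop, numCellIsolated (c n) k r X = numIsolated k X r := by
  have h1 : ∀ x ∈ X, ∀ y ∈ X, ∀ᶠ n in atTop,
      (c n x = c n y → x = y) ∧ (dist (c n x) (c n y) ≤ r ↔ dist x y ≤ r) := by
    intro x hx y hy
    by_cases hxy : x = y
    · subst hxy; exact Eventually.of_forall fun n => ⟨fun _ => rfl, by simp⟩
    have hd : Tendsto (fun n => dist (c n x) (c n y)) atTop (𝓝 (dist x y)) :=
      (hc x).dist (hc y)
    have hpos : ∀ᶠ n in atTop, 0 < dist (c n x) (c n y) :=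
      hd.eventually_const_lt (dist_pos.2 hxy)
    rcases lt_or_gt_of_ne (hr x hx y hy hxy) with hlt | hlt
    · filter_upwards [hpos, hd.eventually_lt_const hlt] with n hn hn'
      exact ⟨fun h => absurd h (dist_pos.1 hn), by simp [hn'.le, hlt.le]⟩
    · filter_upwards [hpos, hd.eventually_const_lt hlt] with n hn hn'
      exact ⟨fun h => absurd h (dist_pos.1 hn), by simp [hn'.not_ge, hlt.not_ge]⟩
  have h2 : ∀ᶠ n in atTop, ∀ x ∈ X, ∀ y ∈ X,
      (c n x = c n y → x = y) ∧ (dist (c n x) (c n y) ≤ r ↔ dist x y ≤ r) := by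
    refine (eventually_all_finite hX).2 fun x hx => (eventually_all_finite hX).2 fun y hy => ?_
    exact h1 x hx y hy
  filter_upwards [h2] with n hn
  exact numCellIsolated_eq_numIsolated _ k r (fun x hx y hy h => (hn x hx y hy).1 h)
    fun x hx y hy => (hn x hx y hy).2

/-- The integral of a function of the cell is a finite sum over the cells. -/
lemma integral_comp_simpleFunc (Λ : Measure (Euc d)) [IsFiniteMeasure Λ]
    (c : SimpleFunc (Euc d) (Euc d)) (G : Euc d → ℝ) :
    ∫ x, G (c x) ∂Λ = ∑ v ∈ c.range, Λ.real (c ⁻¹' {v}) * G v := by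
  have h : ∀ x, G (c x) = ∑ v ∈ c.range, (c ⁻¹' {v}).indicator (fun _ => G v) x := by
    intro x
    rw [Finset.sum_eq_single (c x)]
    · simp
    · intro v _ hv
      exact indicator_of_notMem (fun h => hv h.symm) _
    · intro hx; exact absurd (c.mem_range_self x) hx
  simp_rw [h]
  rw [integral_finsetSum _ fun v _ =>
    (integrable_const (G v)).indicator (c.measurableSet_preimage _)]
  refine Finset.sum_congr rfl fun v _ => ?_
  rw [integral_indicator_const _ (c.measurableSet_preimage _), smul_eq_mul]

section PoissonProcess

variable {Ω : Type*} [MeasurableSpace Ω] {P : Measure Ω} [IsProbabilityMeasure P]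
  {η : Ω → Set (Euc d)} {Λ : Measure (Euc d)} [IsFiniteMeasure Λ]
  (c : SimpleFunc (Euc d) (Euc d)) (k : ℕ) (r : ℝ)

lemma IsPoissonProcess.measurable_cellIsolated (h : IsPoissonProcess P η Λ) (v : Euc d) :
    Measurable (fun ω => cellIsolated c k r v (η ω)) := by
  unfold cellIsolated
  refine Measurable.ite ?_ measurable_const measurable_const
  exact (h.measurableSet_count (c.measurableSet_preimage _) (Ici 1)).inter
    (h.measurableSet_count (c.measurableSet_preimage _) (Iio (k : ℕ∞)))

lemma IsPoissonProcess.measurable_numCellIsolated (h : IsPoissonProcess P η Λ) :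
    Measurable (fun ω => numCellIsolated c k r (η ω)) :=
  Finset.measurable_sum _ fun v _ => h.measurable_cellIsolated c k r v

lemma IsPoissonProcess.integral_cellIsolated (h : IsPoissonProcess P η Λ) (v : Euc d) :
    ∫ ω, (cellIsolated c k r v (η ω) : ℝ) ∂P
      = (1 - Real.exp (-Λ.real (c ⁻¹' {v}))) *
        poissonBelow k (Λ.real (c ⁻¹' (Metric.closedBall v r \ {v}))) := by
  classical
  have hd : Disjoint (c ⁻¹' {v}) (c ⁻¹' (Metric.closedBall v r \ {v})) :=
    Disjoint.preimage _ disjoint_sdiff_right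
  have hi := h.measureReal_iInter_count
    ![c ⁻¹' {v}, c ⁻¹' (Metric.closedBall v r \ {v})]
    (by simp only [Fin.forall_fin_two]; exact ⟨c.measurableSet_preimage _, c.measurableSet_preimage _⟩)
    (by
      intro i j hij
      fin_cases i <;> fin_cases j
      · exact absurd rfl hij
      · exact hd
      · exact hd.symm
      · exact absurd rfl hij)
    ![Ici 1, Iio (k : ℕ∞)]
  simp only [Fin.forall_fin_two, Fin.prod_univ_two] at hi
  have hm : MeasurableSet {ω | 1 ≤ (η ω ∩ c ⁻¹' {v}).encard ∧
      (η ω ∩ c ⁻¹' (Metric.closedBall v r \ {v})).encard < (k : ℕ∞)} :=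
    (h.measurableSet_count (c.measurableSet_preimage _) (Ici 1)).inter
      (h.measurableSet_count (c.measurableSet_preimage _) (Iio (k : ℕ∞)))
  rw [← h.measureReal_one_le_count (c.measurableSet_preimage _),
    ← h.measureReal_count_lt (c.measurableSet_preimage _)]
  refine Eq.trans ?_ (show P.real {ω | 1 ≤ (η ω ∩ c ⁻¹' {v}).encard ∧
      (η ω ∩ c ⁻¹' (Metric.closedBall v r \ {v})).encard < (k : ℕ∞)} = _ from hi)
  rw [← integral_indicator_one hm]
  refine integral_congr_ae (ae_of_all _ fun ω => ?_)
  change (cellIsolated c k r v (η ω) : ℝ) = indicator {ω | 1 ≤ (η ω ∩ c ⁻¹' {v}).encard ∧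
      (η ω ∩ c ⁻¹' (Metric.closedBall v r \ {v})).encard < (k : ℕ∞)} 1 ω
  simp only [cellIsolated, indicator, mem_ofPred_eq]
  split_ifs <;> simp

lemma IsPoissonProcess.integral_cellIsolated_le (h : IsPoissonProcess P η Λ) (v : Euc d) :
    ∫ ω, (cellIsolated c k r v (η ω) : ℝ) ∂P
      ≤ Λ.real (c ⁻¹' {v}) *
        poissonBelow k (Λ.real (c ⁻¹' (Metric.closedBall v r \ {v}))) := by
  rw [h.integral_cellIsolated]
  refine mul_le_mul_of_nonneg_right ?_ (poissonBelow_nonneg k measureReal_nonneg)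
  linarith [Real.add_one_le_exp (-Λ.real (c ⁻¹' {v}))]

/-- A bound for the probability that the cells of both `v` and `w` are isolated, given that both
are occupied: apart from these two cells, there are fewer than `k` points near `v`, and fewer than
`k` points that are near `w` but not near `v`. -/
noncomputable def cellPairBound (Λ : Measure (Euc d)) (v w : Euc d) : ℝ :=
  poissonBelow k (Λ.real (c ⁻¹' (Metric.closedBall v r \ {v, w}))) *
    poissonBelow k (Λ.real (c ⁻¹' ((Metric.closedBall w r \ Metric.closedBall v r) \ {v, w})))

/-- Two different cells are both isolated only if both are occupied and, independently of this, there
are few points in the remaining cells near them. -/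
lemma IsPoissonProcess.integral_cellIsolated_mul_le (h : IsPoissonProcess P η Λ) {v w : Euc d}
    (hvw : v ≠ w) :
    ∫ ω, (cellIsolated c k r v (η ω) : ℝ) * (cellIsolated c k r w (η ω) : ℝ) ∂P
      ≤ Λ.real (c ⁻¹' {v}) * Λ.real (c ⁻¹' {w}) * cellPairBound c k r Λ v w := by
  classical
  set B : Fin 4 → Set (Euc d) := ![{v}, {w}, Metric.closedBall v r \ {v, w},
    (Metric.closedBall w r \ Metric.closedBall v r) \ {v, w}] with hB
  set S : Fin 4 → Set ℕ∞ := ![Ici 1, Ici 1, Iio (k : ℕ∞), Iio (k : ℕ∞)] with hS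
  have hdis : ∀ i j, i < j → Disjoint (B i) (B j) := by
    intro i j hij
    fin_cases i <;> fin_cases j <;> first
      | exact absurd hij (by decide)
      | (simp only [hB]
         refine Set.disjoint_left.2 fun z h1 h2 => ?_
         simp at h1 h2
         grind)
  have hpd : Pairwise (Function.onFun Disjoint fun i => c ⁻¹' B i) := by
    intro i j hij
    rcases lt_or_gt_of_ne hij with h | h
    · exact (hdis i j h).preimage _
    · exact ((hdis j i h).preimage _).symm
  have hi := h.measureReal_iInter_count (fun i => c ⁻¹' B i) (fun i => c.measurableSet_preimage _)
    hpd S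
  rw [Fin.prod_univ_four] at hi
  have hm : MeasurableSet {ω | ∀ i, (η ω ∩ c ⁻¹' B i).encard ∈ S i} := by
    rw [ofPred_forall]
    exact MeasurableSet.iInter fun i => h.measurableSet_count (c.measurableSet_preimage _) _
  have hle : ∫ ω, (cellIsolated c k r v (η ω) : ℝ) * (cellIsolated c k r w (η ω) : ℝ) ∂P
      ≤ P.real {ω | ∀ i, (η ω ∩ c ⁻¹' B i).encard ∈ S i} := by
    rw [← integral_indicator_one hm]
    refine integral_mono_of_nonneg (ae_of_all _ fun ω => by positivity)
      ((integrable_const (1 : ℝ)).indicator hm) (ae_of_all _ fun ω => ?_)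
    by_cases h1 : 1 ≤ (η ω ∩ c ⁻¹' {v}).encard ∧
        (η ω ∩ c ⁻¹' (Metric.closedBall v r \ {v})).encard < (k : ℕ∞)
    · by_cases h2 : 1 ≤ (η ω ∩ c ⁻¹' {w}).encard ∧
          (η ω ∩ c ⁻¹' (Metric.closedBall w r \ {w})).encard < (k : ℕ∞)
      · have hmem : ω ∈ {ω | ∀ i, (η ω ∩ c ⁻¹' B i).encard ∈ S i} := by
          intro i
          fin_cases i
          · exact h1.1
          · exact h2.1
          · refine lt_of_le_of_lt (Set.encard_le_encard ?_) h1.2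
            refine inter_subset_inter_right _ (preimage_mono fun z hz => ⟨hz.1, fun h => hz.2 ?_⟩)
            exact Or.inl h
          · refine lt_of_le_of_lt (Set.encard_le_encard ?_) h2.2
            refine inter_subset_inter_right _ (preimage_mono fun z hz => ⟨hz.1.1, fun h => hz.2 ?_⟩)
            exact Or.inr h
        simp only [cellIsolated, if_pos h1, if_pos h2, indicator_of_mem hmem]
        simp
      · simp only [cellIsolated, if_neg h2, Nat.cast_zero, mul_zero]
        exact indicator_nonneg (fun _ _ => zero_le_one) _
    · simp only [cellIsolated, if_neg h1, Nat.cast_zero, zero_mul]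
      exact indicator_nonneg (fun _ _ => zero_le_one) _
  refine hle.trans ?_
  rw [hi]
  have e0 : P.real {ω | (η ω ∩ c ⁻¹' B 0).encard ∈ S 0} ≤ Λ.real (c ⁻¹' {v}) :=
    h.measureReal_one_le_count_le (c.measurableSet_preimage _)
  have e1 : P.real {ω | (η ω ∩ c ⁻¹' B 1).encard ∈ S 1} ≤ Λ.real (c ⁻¹' {w}) :=
    h.measureReal_one_le_count_le (c.measurableSet_preimage _)
  have e2 := h.measureReal_count_lt
    (c.measurableSet_preimage (Metric.closedBall v r \ {v, w})) k
  have e3 := h.measureReal_count_lt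
    (c.measurableSet_preimage ((Metric.closedBall w r \ Metric.closedBall v r) \ {v, w})) k
  rw [cellPairBound, ← e2, ← e3, ← mul_assoc]
  refine mul_le_mul_of_nonneg_right (mul_le_mul_of_nonneg_right ?_ measureReal_nonneg)
    measureReal_nonneg
  exact mul_le_mul e0 e1 measureReal_nonneg measureReal_nonneg

/-- The counts in the cells are independent. -/
lemma IsPoissonProcess.iIndepFun_cells (h : IsPoissonProcess P η Λ) :
    iIndepFun (fun (v : Euc d) ω => (η ω ∩ c ⁻¹' {v}).encard) P := by
  rw [iIndepFun_iff_finset]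
  intro s
  have hi := (h.indep_count s.card (fun i => c ⁻¹' {(s.equivFin.symm i : Euc d)})
    (fun i => c.measurableSet_preimage _) (fun i j hij => by
      refine Disjoint.preimage _ (disjoint_singleton.2 fun he => hij ?_)
      exact s.equivFin.symm.injective (Subtype.ext he))).precomp s.equivFin.injective
  convert hi using 2 with v
  ext ω
  simp

/-- The events that depend only on the counts in the cells represented by points of `S`. -/
@[reducible] noncomputable def cellSigma (η : Ω → Set (Euc d)) (S : Set (Euc d)) : MeasurableSpace Ω :=
  ⨆ v ∈ S, MeasurableSpace.comap (fun ω => (η ω ∩ c ⁻¹' {v}).encard) inferInstance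

lemma IsPoissonProcess.indep_cellSigma (h : IsPoissonProcess P η Λ) {S T : Set (Euc d)}
    (hST : Disjoint S T) : Indep (cellSigma c η S) (cellSigma c η T) P :=
  indep_iSup_of_disjoint
    (fun _ => (h.measurable_count _ (c.measurableSet_preimage _)).comap_le)
    (h.iIndepFun_cells c) hST

lemma measurable_cellSigma_count (η : Ω → Set (Euc d)) {S T : Set (Euc d)} (hST : S ⊆ T) :
    Measurable[cellSigma c η T] (fun ω => (η ω ∩ c ⁻¹' S).encard) := by
  classical
  have hsum : (fun ω => (η ω ∩ c ⁻¹' S).encard)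
      = fun ω => ∑ v ∈ c.range with v ∈ S, (η ω ∩ c ⁻¹' {v}).encard := by
    ext ω
    have hU : η ω ∩ c ⁻¹' S = ⋃ v ∈ ((c.range.filter (· ∈ S) : Finset (Euc d)) : Set (Euc d)),
        (η ω ∩ c ⁻¹' {v}) := by
      ext z
      simp only [mem_inter_iff, mem_preimage, Finset.coe_filter, mem_iUnion, mem_singleton_iff,
        mem_ofPred_eq]
      constructor
      · rintro ⟨hz, hS⟩; exact ⟨c z, ⟨c.mem_range_self z, hS⟩, hz, rfl⟩
      · rintro ⟨v, ⟨_, hS⟩, hz, rfl⟩; exact ⟨hz, hS⟩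
    rw [hU, Set.Finite.encard_biUnion (Finset.finite_toSet _), finsum_mem_coe_finset]
    intro v _ w _ hvw
    exact (Disjoint.preimage c (disjoint_singleton.2 hvw)).mono inter_subset_right
      inter_subset_right
  rw [hsum]
  refine Finset.measurable_sum _ fun v hv => ?_
  have hv' : v ∈ T := hST (Finset.mem_filter.1 hv).2
  have hle : MeasurableSpace.comap (fun ω => (η ω ∩ c ⁻¹' {v}).encard) inferInstance
      ≤ cellSigma c η T := le_iSup₂_of_le v hv' le_rfl
  exact Measurable.mono (comap_measurable _) hle le_rfl

lemma measurable_cellSigma_cellIsolated (η : Ω → Set (Euc d)) (hr : 0 ≤ r) {v : Euc d}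
    {T : Set (Euc d)} (hT : Metric.closedBall v r ⊆ T) :
    Measurable[cellSigma c η T] (fun ω => cellIsolated c k r v (η ω)) := by
  unfold cellIsolated
  have h1 := measurable_cellSigma_count c η (S := {v}) (T := T)
    (singleton_subset_iff.2 (hT (Metric.mem_closedBall_self hr)))
  have h2 := measurable_cellSigma_count c η (S := Metric.closedBall v r \ {v}) (T := T)
    (sdiff_subset.trans hT)
  refine Measurable.ite (m := cellSigma c η T) ?_ ?_ ?_
  rotate_left
  · exact @measurable_const _ _ _ (cellSigma c η T) _
  · exact @measurable_const _ _ _ (cellSigma c η T) _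
  exact @MeasurableSet.inter _ (cellSigma c η T) _ _
    (h1 (MeasurableSet.of_discrete (s := Ici (1 : ℕ∞))))
    (h2 (MeasurableSet.of_discrete (s := Iio (k : ℕ∞))))

open Classical in
/-- Isolation of a cell is independent of the isolation of all cells at distance more
than `2 * r`. -/
lemma IsPoissonProcess.indepFun_cellIsolated (h : IsPoissonProcess P η Λ) (hr : 0 ≤ r)
    (v : Euc d) :
    IndepFun (fun ω => cellIsolated c k r v (η ω))
      (fun ω => ∑ w ∈ c.range with ¬ dist v w ≤ 2 * r, cellIsolated c k r w (η ω)) P := by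
  have hS := measurable_cellSigma_cellIsolated c k r η hr (v := v) (T := Metric.closedBall v r)
    le_rfl
  have hT : Measurable[cellSigma c η (Metric.closedBall v r)ᶜ]
      (fun ω => ∑ w ∈ c.range with ¬ dist v w ≤ 2 * r, cellIsolated c k r w (η ω)) := by
    refine Finset.measurable_sum _ fun w hw => ?_
    refine measurable_cellSigma_cellIsolated c k r η hr fun z hz hz' => ?_
    have h1 := (Finset.mem_filter.1 hw).2
    rw [Metric.mem_closedBall] at hz hz'
    have := dist_triangle_left v w z
    linarith
  rw [IndepFun_iff_Indep]
  exact indep_of_indep_of_le_left (indep_of_indep_of_le_right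
    (h.indep_cellSigma c disjoint_compl_right) hT.comap_le) hS.comap_le

open Classical in
/-- The Poisson approximation for the discretised count. -/
lemma IsPoissonProcess.abs_numCellIsolated_sub_le (h : IsPoissonProcess P η Λ) (hr : 0 ≤ r)
    {l : ℝ≥0} (hl : 0 < l) (hlW : (l : ℝ) = ∫ ω, (numCellIsolated c k r (η ω) : ℝ) ∂P)
    (B : Set ℕ) :
    |P.real ((fun ω => numCellIsolated c k r (η ω)) ⁻¹' B) - (poissonMeasure l).real B| ≤
      2 * Real.exp l * ∫ x, (∫ y, (if dist (c x) (c y) ≤ 2 * r then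
        poissonBelow k (Λ.real (c ⁻¹' (Metric.closedBall (c x) r \ {c x}))) *
          poissonBelow k (Λ.real (c ⁻¹' (Metric.closedBall (c y) r \ {c y})))
        + min (cellPairBound c k r Λ (c x) (c y)) (cellPairBound c k r Λ (c y) (c x))
        else 0) ∂Λ) ∂Λ := by
  have hint : ∀ v, Integrable (fun ω => (cellIsolated c k r v (η ω) : ℝ)) P := fun v =>
    Integrable.of_bound ((measurable_from_nat.comp
      (h.measurable_cellIsolated c k r v)).aestronglyMeasurable) 1
      (ae_of_all _ fun ω => by
        simpa using cellIsolated_le_one c k r v (η ω))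
  have hCS := abs_measureReal_sum_sub_poissonMeasure_le (P := P) c.range
    (fun v ω => cellIsolated c k r v (η ω)) (fun v => h.measurable_cellIsolated c k r v)
    (fun v ω => cellIsolated_le_one c k r v (η ω)) (fun v w => dist v w ≤ 2 * r)
    (fun v => by simpa using hr) (fun v _ => h.indepFun_cellIsolated c k r hr v) hl
    (by rw [hlW, ← integral_finsetSum _ fun v _ => hint v]
        simp [numCellIsolated]) B
  refine hCS.trans (mul_le_mul_of_nonneg_left ?_ (by positivity))
  rw [integral_comp_simpleFunc Λ c (fun v => ∫ y, (if dist v (c y) ≤ 2 * r then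
        poissonBelow k (Λ.real (c ⁻¹' (Metric.closedBall v r \ {v}))) *
          poissonBelow k (Λ.real (c ⁻¹' (Metric.closedBall (c y) r \ {c y})))
        + min (cellPairBound c k r Λ v (c y)) (cellPairBound c k r Λ (c y) v)
        else 0) ∂Λ)]
  refine Finset.sum_le_sum fun v _ => ?_
  rw [integral_comp_simpleFunc Λ c (fun w => if dist v w ≤ 2 * r then
        poissonBelow k (Λ.real (c ⁻¹' (Metric.closedBall v r \ {v}))) *
          poissonBelow k (Λ.real (c ⁻¹' (Metric.closedBall w r \ {w})))
        + min (cellPairBound c k r Λ v w) (cellPairBound c k r Λ w v)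
        else 0), Finset.mul_sum, Finset.sum_filter]
  refine Finset.sum_le_sum fun w _ => ?_
  by_cases hvw : dist v w ≤ 2 * r
  swap
  · simp [hvw]
  rw [if_pos hvw, if_pos hvw]
  have hb0 : ∀ S, 0 ≤ poissonBelow k (Λ.real S) := fun S =>
    poissonBelow_nonneg k measureReal_nonneg
  have hp := mul_le_mul (h.integral_cellIsolated_le c k r v) (h.integral_cellIsolated_le c k r w)
    (integral_nonneg fun ω => Nat.cast_nonneg _)
    (mul_nonneg measureReal_nonneg (hb0 _))
  have hq : (if v = w then 0 else
      ∫ ω, (cellIsolated c k r v (η ω) : ℝ) * (cellIsolated c k r w (η ω) : ℝ) ∂P)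
      ≤ Λ.real (c ⁻¹' {v}) * Λ.real (c ⁻¹' {w}) *
        min (cellPairBound c k r Λ v w) (cellPairBound c k r Λ w v) := by
    split_ifs with hvw'
    · exact mul_nonneg (mul_nonneg measureReal_nonneg measureReal_nonneg)
        (le_min (mul_nonneg (hb0 _) (hb0 _)) (mul_nonneg (hb0 _) (hb0 _)))
    · rw [mul_min_of_nonneg _ _ (mul_nonneg measureReal_nonneg measureReal_nonneg)]
      refine le_min (h.integral_cellIsolated_mul_le c k r hvw') ?_
      have := h.integral_cellIsolated_mul_le c k r (Ne.symm hvw')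
      simp_rw [mul_comm (cellIsolated c k r w _ : ℝ)] at this
      rwa [mul_comm (Λ.real (c ⁻¹' {w}))] at this
  calc _ ≤ _ := add_le_add hp hq
    _ = _ := by ring

/-- The mean of the discretised count, up to the probability of a doubly occupied cell. -/
lemma IsPoissonProcess.integral_numCellIsolated_mem (h : IsPoissonProcess P η Λ) :
    ∫ ω, (numCellIsolated c k r (η ω) : ℝ) ∂P ∈ Icc
      (∫ x, (poissonBelow k (Λ.real (c ⁻¹' (Metric.closedBall (c x) r \ {c x})))
        - Λ.real (c ⁻¹' {c x})) ∂Λ)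
      (∫ x, poissonBelow k (Λ.real (c ⁻¹' (Metric.closedBall (c x) r \ {c x}))) ∂Λ) := by
  have hint : ∀ v, Integrable (fun ω => (cellIsolated c k r v (η ω) : ℝ)) P := fun v =>
    Integrable.of_bound ((measurable_from_nat.comp
      (h.measurable_cellIsolated c k r v)).aestronglyMeasurable) 1
      (ae_of_all _ fun ω => by
        simpa using cellIsolated_le_one c k r v (η ω))
  have hsum : ∫ ω, (numCellIsolated c k r (η ω) : ℝ) ∂P
      = ∑ v ∈ c.range, ∫ ω, (cellIsolated c k r v (η ω) : ℝ) ∂P := by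
    rw [← integral_finsetSum _ fun v _ => hint v]
    simp [numCellIsolated]
  rw [hsum, integral_comp_simpleFunc Λ c (fun v =>
      poissonBelow k (Λ.real (c ⁻¹' (Metric.closedBall v r \ {v}))) - Λ.real (c ⁻¹' {v})),
    integral_comp_simpleFunc Λ c (fun v =>
      poissonBelow k (Λ.real (c ⁻¹' (Metric.closedBall v r \ {v}))))]
  refine ⟨Finset.sum_le_sum fun v _ => ?_,
    Finset.sum_le_sum fun v _ => h.integral_cellIsolated_le c k r v⟩
  rw [h.integral_cellIsolated]
  set t := Λ.real (c ⁻¹' {v}) with ht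
  set p := poissonBelow k (Λ.real (c ⁻¹' (Metric.closedBall v r \ {v}))) with hp
  have ht0 : 0 ≤ t := measureReal_nonneg
  have hp0 : 0 ≤ p := poissonBelow_nonneg k measureReal_nonneg
  have hp1 : p ≤ 1 := poissonBelow_le_one k measureReal_nonneg
  -- Since `exp t ≥ 1 + t`, we have `1 - exp (-t) ≥ t / (1 + t) ≥ t - t ^ 2`.
  have he : t - t ^ 2 ≤ 1 - Real.exp (-t) := by
    have h1 : Real.exp (-t) * Real.exp t = 1 := by rw [← Real.exp_add]; simp
    have h2 := Real.add_one_le_exp t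
    have h3 := Real.exp_pos (-t)
    have h4 : Real.exp (-t) * (1 + t) ≤ 1 := by nlinarith
    have h5 : (1 - t + t ^ 2) * (1 + t) = 1 + t ^ 3 := by ring
    have h6 : 0 ≤ t ^ 3 := by positivity
    by_contra hc
    push Not at hc
    nlinarith
  nlinarith [mul_le_mul_of_nonneg_right he hp0, mul_nonneg (mul_nonneg ht0 ht0) (sub_nonneg.2 hp1)]

end PoissonProcess

end Discretisation

/-! ### Limits of the discretised quantities -/

section Limit

variable {d : ℕ}

/-- The probability that a point at `x` has degree less than `k`. -/
noncomputable def isolationProb (k : ℕ) (r : ℝ) (Λ : Measure (Euc d)) (x : Euc d) : ℝ :=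
  poissonBelow k (Λ.real (Metric.closedBall x r))

/-- A bound for the probability that points at `x` and `y` both have degree less than `k`: there
are fewer than `k` points near `x`, and fewer than `k` points that are near `y` but not near `x`. -/
noncomputable def pairIsolationBound (k : ℕ) (r : ℝ) (Λ : Measure (Euc d)) (x y : Euc d) : ℝ :=
  poissonBelow k (Λ.real (Metric.closedBall x r)) *
    poissonBelow k (Λ.real (Metric.closedBall y r \ Metric.closedBall x r))

variable {c : ℕ → SimpleFunc (Euc d) (Euc d)}

lemma eventually_dist_le_iff (hc : ∀ x, Tendsto (fun n => c n x) atTop (𝓝 x)) {x y : Euc d}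
    {r : ℝ} (h : dist x y ≠ r) : ∀ᶠ n in atTop, dist (c n x) (c n y) ≤ r ↔ dist x y ≤ r := by
  have hd : Tendsto (fun n => dist (c n x) (c n y)) atTop (𝓝 (dist x y)) := (hc x).dist (hc y)
  rcases lt_or_gt_of_ne h with hlt | hlt
  · filter_upwards [hd.eventually_lt_const hlt] with n hn
    simp [hn.le, hlt.le]
  · filter_upwards [hd.eventually_const_lt hlt] with n hn
    simp [hn.not_ge, hlt.not_ge]

lemma eventually_comp_ne (hc : ∀ x, Tendsto (fun n => c n x) atTop (𝓝 x)) {x y : Euc d}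
    (h : x ≠ y) : ∀ᶠ n in atTop, c n x ≠ c n y := by
  have hd : Tendsto (fun n => dist (c n x) (c n y)) atTop (𝓝 (dist x y)) := (hc x).dist (hc y)
  filter_upwards [hd.eventually_const_lt (dist_pos.2 h)] with n hn using dist_pos.1 hn

variable {Λ : Measure (Euc d)} [IsFiniteMeasure Λ]

lemma ae_dist_ne_of_sphere (hΛ : ∀ x ρ, Λ (Metric.sphere x ρ) = 0) (x : Euc d) (ρ : ℝ) :
    ∀ᵐ z ∂Λ, dist z x ≠ ρ :=
  measure_eq_zero_iff_ae_notMem.1 (hΛ x ρ)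

lemma ae_ne_of_sphere (hΛ : ∀ x ρ, Λ (Metric.sphere x ρ) = 0) (x : Euc d) :
    ∀ᵐ z ∂Λ, z ≠ x := by
  filter_upwards [ae_dist_ne_of_sphere hΛ x 0] with z hz using dist_ne_zero.1 hz

lemma tendsto_measureReal_preimage {S : ℕ → Set (Euc d)} {A : Set (Euc d)} (hA : MeasurableSet A)
    (h : ∀ᵐ z ∂Λ, ∀ᶠ n in atTop, c n z ∈ S n ↔ z ∈ A) :
    Tendsto (fun n => Λ.real (c n ⁻¹' S n)) atTop (𝓝 (Λ.real A)) :=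
  (ENNReal.tendsto_toReal (measure_ne_top _ _)).comp
    (tendsto_measure_of_ae_tendsto_indicator_of_isFiniteMeasure atTop hA
      (fun n => (c n).measurableSet_preimage _) h)

lemma tendsto_measureReal_cell (hc : ∀ x, Tendsto (fun n => c n x) atTop (𝓝 x))
    (hΛ : ∀ x ρ, Λ (Metric.sphere x ρ) = 0) (x : Euc d) :
    Tendsto (fun n => Λ.real (c n ⁻¹' {c n x})) atTop (𝓝 0) := by
  have h := tendsto_measureReal_preimage (Λ := Λ) (c := c) (S := fun n => {c n x}) (A := ∅)
    MeasurableSet.empty (by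
      filter_upwards [ae_ne_of_sphere hΛ x] with z hz
      filter_upwards [eventually_comp_ne hc hz] with n hn
      simpa using hn)
  simpa using h

lemma tendsto_isolationProb (hc : ∀ x, Tendsto (fun n => c n x) atTop (𝓝 x))
    (hΛ : ∀ x ρ, Λ (Metric.sphere x ρ) = 0) (k : ℕ) (r : ℝ) (x : Euc d) :
    Tendsto (fun n => poissonBelow k (Λ.real (c n ⁻¹' (Metric.closedBall (c n x) r \ {c n x}))))
      atTop (𝓝 (isolationProb k r Λ x)) := by
  refine ((continuous_poissonBelow k).tendsto _).comp
    (tendsto_measureReal_preimage measurableSet_closedBall ?_)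
  filter_upwards [ae_ne_of_sphere hΛ x, ae_dist_ne_of_sphere hΛ x r] with z hz hzr
  filter_upwards [eventually_comp_ne hc hz, eventually_dist_le_iff hc hzr] with n h1 h2
  simp [h1, h2]

lemma tendsto_pairIsolationBound (hc : ∀ x, Tendsto (fun n => c n x) atTop (𝓝 x))
    (hΛ : ∀ x ρ, Λ (Metric.sphere x ρ) = 0) (k : ℕ) (r : ℝ) (x y : Euc d) :
    Tendsto (fun n => cellPairBound (c n) k r Λ (c n x) (c n y))
      atTop (𝓝 (pairIsolationBound k r Λ x y)) := by
  refine Tendsto.mul ?_ ?_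
  · refine ((continuous_poissonBelow k).tendsto _).comp
      (tendsto_measureReal_preimage measurableSet_closedBall ?_)
    filter_upwards [ae_ne_of_sphere hΛ x, ae_ne_of_sphere hΛ y, ae_dist_ne_of_sphere hΛ x r]
      with z hz hz' hzr
    filter_upwards [eventually_comp_ne hc hz, eventually_comp_ne hc hz',
      eventually_dist_le_iff hc hzr] with n h1 h1' h2
    simp [h1, h1', h2]
  · refine ((continuous_poissonBelow k).tendsto _).comp
      (tendsto_measureReal_preimage (measurableSet_closedBall.diff measurableSet_closedBall) ?_)
    filter_upwards [ae_ne_of_sphere hΛ x, ae_ne_of_sphere hΛ y, ae_dist_ne_of_sphere hΛ x r,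
      ae_dist_ne_of_sphere hΛ y r] with z hz hz' hzr hzr'
    filter_upwards [eventually_comp_ne hc hz, eventually_comp_ne hc hz',
      eventually_dist_le_iff hc hzr, eventually_dist_le_iff hc hzr'] with n h1 h1' h2 h2'
    simp [h1, h1', h2, h2']

lemma tendsto_integral_integral_of_bounded {F : ℕ → Euc d → Euc d → ℝ} {G : Euc d → Euc d → ℝ}
    {C : ℝ} (hF : ∀ n x y, ‖F n x y‖ ≤ C)
    (hm : ∀ n x, AEStronglyMeasurable (F n x) Λ)
    (hm' : ∀ n, AEStronglyMeasurable (fun x => ∫ y, F n x y ∂Λ) Λ)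
    (hlim : ∀ x, ∀ᵐ y ∂Λ, Tendsto (fun n => F n x y) atTop (𝓝 (G x y))) :
    Tendsto (fun n => ∫ x, ∫ y, F n x y ∂Λ ∂Λ) atTop (𝓝 (∫ x, ∫ y, G x y ∂Λ ∂Λ)) := by
  refine tendsto_integral_of_dominated_convergence (fun _ => C * Λ.real univ) hm'
    (integrable_const _) (fun n => ae_of_all _ fun x => ?_) (ae_of_all _ fun x => ?_)
  · exact norm_integral_le_of_norm_le_const (ae_of_all _ (hF n x))
  · exact tendsto_integral_of_dominated_convergence (fun _ => C) (hm · x)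
      (integrable_const _) (fun n => ae_of_all _ (hF n x)) (hlim x)

/-- No measurability of `G` is needed, since `c` takes finitely many values. -/
lemma aestronglyMeasurable_comp_simpleFunc (c : SimpleFunc (Euc d) (Euc d)) (G : Euc d → ℝ) :
    AEStronglyMeasurable (fun x => G (c x)) Λ :=
  (c.map G).aestronglyMeasurable

lemma tendsto_integral_integral_cells {F : ℕ → Euc d → Euc d → ℝ} {G : Euc d → Euc d → ℝ}
    {C : ℝ} (hF : ∀ n x y, ‖F n x y‖ ≤ C)
    (hlim : ∀ x, ∀ᵐ y ∂Λ, Tendsto (fun n => F n (c n x) (c n y)) atTop (𝓝 (G x y))) :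
    Tendsto (fun n => ∫ x, ∫ y, F n (c n x) (c n y) ∂Λ ∂Λ) atTop
      (𝓝 (∫ x, ∫ y, G x y ∂Λ ∂Λ)) :=
  tendsto_integral_integral_of_bounded (fun n _ _ => hF n _ _)
    (fun n x => aestronglyMeasurable_comp_simpleFunc (c n) (F n (c n x)))
    (fun n => aestronglyMeasurable_comp_simpleFunc (c n) fun v => ∫ y, F n v (c n y) ∂Λ) hlim

section PoissonProcess

variable {Ω : Type*} [MeasurableSpace Ω] {P : Measure Ω} [IsProbabilityMeasure P]
  {η : Ω → Set (Euc d)}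

/-- The probability that some pair of points has a distance where the test function `φ` equals `1`
is at most twice the integral of `φ` over all pairs. -/
lemma IsPoissonProcess.measure_exists_pair_le (h : IsPoissonProcess P η Λ)
    (hc : ∀ x, Tendsto (fun n => c n x) atTop (𝓝 x)) {r : ℝ} {φ : ℝ → ℝ} (hφ : Continuous φ)
    (h0 : ∀ t, 0 ≤ φ t) (h1 : ∀ t, φ t ≤ 1) (hr : φ r = 1) :
    P {ω | ∃ x ∈ η ω, ∃ y ∈ η ω, x ≠ y ∧ dist x y = r}
      ≤ ENNReal.ofReal (2 * ∫ x, ∫ y, φ (dist x y) ∂Λ ∂Λ) := by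
  classical
  -- `F n` is the event that two distinct occupied cells have a distance with `φ > 1 / 2`.
  set F : ℕ → Set Ω := fun n => ⋃ v ∈ (c n).range, ⋃ w ∈ (c n).range,
    {ω | v ≠ w ∧ 1 / 2 < φ (dist v w) ∧ 1 ≤ (η ω ∩ c n ⁻¹' {v}).encard ∧
      1 ≤ (η ω ∩ c n ⁻¹' {w}).encard} with hFdef
  have hF : ∀ n, P.real (F n) ≤ 2 * ∫ x, ∫ y, φ (dist (c n x) (c n y)) ∂Λ ∂Λ := by
    intro n
    rw [integral_comp_simpleFunc Λ (c n) (fun v => ∫ y, φ (dist v (c n y)) ∂Λ), Finset.mul_sum]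
    refine (measureReal_biUnion_finset_le _ _).trans (Finset.sum_le_sum fun v _ => ?_)
    rw [integral_comp_simpleFunc Λ (c n) (fun w => φ (dist v w)), Finset.mul_sum, Finset.mul_sum]
    refine (measureReal_biUnion_finset_le _ _).trans (Finset.sum_le_sum fun w _ => ?_)
    have hm : ∀ v, MeasurableSet (c n ⁻¹' {v}) := fun v => (c n).measurableSet_preimage _
    by_cases hvw : v ≠ w ∧ 1 / 2 < φ (dist v w)
    · have hi := h.measureReal_iInter_count ![c n ⁻¹' {v}, c n ⁻¹' {w}]
        (by simp only [Fin.forall_fin_two]; exact ⟨hm v, hm w⟩)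
        (by
          have hd : Disjoint (c n ⁻¹' {v}) (c n ⁻¹' {w}) :=
            Disjoint.preimage _ (disjoint_singleton.2 hvw.1)
          intro i j hij
          fin_cases i <;> fin_cases j
          · exact absurd rfl hij
          · exact hd
          · exact hd.symm
          · exact absurd rfl hij)
        ![Ici 1, Ici 1]
      simp only [Fin.forall_fin_two, Fin.prod_univ_two] at hi
      have e1 := h.measureReal_one_le_count_le (hm v)
      have e2 := h.measureReal_one_le_count_le (hm w)
      have e3 : P.real {ω | v ≠ w ∧ 1 / 2 < φ (dist v w) ∧ 1 ≤ (η ω ∩ c n ⁻¹' {v}).encard ∧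
          1 ≤ (η ω ∩ c n ⁻¹' {w}).encard} ≤ Λ.real (c n ⁻¹' {v}) * Λ.real (c n ⁻¹' {w}) :=
        calc _ ≤ P.real {ω | 1 ≤ (η ω ∩ c n ⁻¹' {v}).encard ∧
              1 ≤ (η ω ∩ c n ⁻¹' {w}).encard} := measureReal_mono fun ω hω => hω.2.2
          _ = _ := hi
          _ ≤ _ := mul_le_mul e1 e2 measureReal_nonneg measureReal_nonneg
      have e4 := mul_nonneg (measureReal_nonneg (μ := Λ) (s := c n ⁻¹' {v}))
        (measureReal_nonneg (μ := Λ) (s := c n ⁻¹' {w}))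
      nlinarith [hvw.2]
    · have : {ω | v ≠ w ∧ 1 / 2 < φ (dist v w) ∧ 1 ≤ (η ω ∩ c n ⁻¹' {v}).encard ∧
          1 ≤ (η ω ∩ c n ⁻¹' {w}).encard} = ∅ :=
        eq_empty_of_forall_notMem fun ω hω => hvw ⟨hω.1, hω.2.1⟩
      rw [this, measureReal_empty]
      have := h0 (dist v w)
      positivity
  have hlim : Tendsto (fun n => 2 * ∫ x, ∫ y, φ (dist (c n x) (c n y)) ∂Λ ∂Λ) atTop
      (𝓝 (2 * ∫ x, ∫ y, φ (dist x y) ∂Λ ∂Λ)) :=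
    (tendsto_integral_integral_cells (F := fun _ v w => φ (dist v w)) (C := 1)
      (fun _ v w => by rw [Real.norm_of_nonneg (h0 _)]; exact h1 _)
      fun x => ae_of_all _ fun y => (hφ.tendsto _).comp ((hc x).dist (hc y))).const_mul 2
  have hsub : {ω | ∃ x ∈ η ω, ∃ y ∈ η ω, x ≠ y ∧ dist x y = r}
      ⊆ ⋃ m, ⋂ n ≥ m, F n := by
    rintro ω ⟨x, hx, y, hy, hxy, hd⟩
    have hev : ∀ᶠ n in atTop, c n x ≠ c n y ∧ 1 / 2 < φ (dist (c n x) (c n y)) := by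
      refine (eventually_comp_ne hc hxy).and ?_
      refine ((hφ.tendsto _).comp ((hc x).dist (hc y))).eventually_const_lt ?_
      rw [hd, hr]; norm_num
    obtain ⟨m, hm⟩ := eventually_atTop.1 hev
    refine mem_iUnion.2 ⟨m, mem_iInter₂.2 fun n hn => ?_⟩
    simp only [hFdef, mem_iUnion, exists_prop]
    refine ⟨_, (c n).mem_range_self x, _, (c n).mem_range_self y, (hm n hn).1, (hm n hn).2, ?_, ?_⟩
    · exact Set.one_le_encard_iff_nonempty.2 ⟨x, hx, rfl⟩
    · exact Set.one_le_encard_iff_nonempty.2 ⟨y, hy, rfl⟩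
  refine (measure_mono hsub).trans ?_
  have hmono : Monotone fun m => ⋂ n ≥ m, F n := fun m m' hmm => by
    refine subset_iInter₂ fun n hn => iInter₂_subset n (hmm.trans hn)
  rw [hmono.measure_iUnion]
  refine iSup_le fun m => ?_
  refine ge_of_tendsto (ENNReal.tendsto_ofReal hlim) ?_
  filter_upwards [eventually_ge_atTop m] with n hn
  calc P (⋂ n ≥ m, F n) ≤ P (F n) := measure_mono (iInter₂_subset n hn)
    _ = ENNReal.ofReal (P.real (F n)) := (ofReal_measureReal (measure_ne_top _ _)).symm
    _ ≤ _ := ENNReal.ofReal_le_ofReal (hF n)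

/-- Almost surely no two points are at distance exactly `r`. -/
lemma IsPoissonProcess.ae_dist_ne (h : IsPoissonProcess P η Λ)
    (hc : ∀ x, Tendsto (fun n => c n x) atTop (𝓝 x)) (hΛ : ∀ x ρ, Λ (Metric.sphere x ρ) = 0)
    (r : ℝ) : ∀ᵐ ω ∂P, ∀ x ∈ η ω, ∀ y ∈ η ω, x ≠ y → dist x y ≠ r := by
  -- Tent functions at `r` of decreasing width.
  set φ : ℕ → ℝ → ℝ := fun j t => max 0 (1 - j * |t - r|) with hφ
  have hφc : ∀ j, Continuous (φ j) := fun j => by simp only [hφ]; fun_prop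
  have hφ0 : ∀ j t, 0 ≤ φ j t := fun j t => le_max_left _ _
  have hφ1 : ∀ j t, φ j t ≤ 1 := fun j t =>
    max_le zero_le_one (sub_le_self _ (by positivity))
  have hlim : Tendsto (fun j => ∫ x, ∫ y, φ j (dist x y) ∂Λ ∂Λ) atTop
      (𝓝 (∫ _x : Euc d, ∫ _y : Euc d, (0 : ℝ) ∂Λ ∂Λ)) := by
    refine tendsto_integral_integral_of_bounded (C := 1)
      (fun j x y => by rw [Real.norm_of_nonneg (hφ0 j _)]; exact hφ1 j _) (fun j x => ?_)
      (fun j => ?_) (fun x => ?_)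
    · exact ((hφc j).comp (continuous_const.dist continuous_id)).aestronglyMeasurable
    · have hu : StronglyMeasurable (Function.uncurry fun x y : Euc d => φ j (dist x y)) :=
        ((hφc j).comp continuous_dist).stronglyMeasurable
      exact hu.integral_prod_right.aestronglyMeasurable
    · filter_upwards [ae_dist_ne_of_sphere hΛ x r] with y hy
      rw [dist_comm] at hy
      have hpos : 0 < |dist x y - r| := abs_pos.2 (sub_ne_zero.2 hy)
      refine tendsto_const_nhds.congr' ?_
      obtain ⟨m, hm⟩ := exists_nat_gt (1 / |dist x y - r|)
      filter_upwards [eventually_ge_atTop m] with j hj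
      have hjm : (m : ℝ) ≤ j := by exact_mod_cast hj
      rw [div_lt_iff₀ hpos] at hm
      exact (max_eq_left (by nlinarith)).symm
  have hzero : P {ω | ∃ x ∈ η ω, ∃ y ∈ η ω, x ≠ y ∧ dist x y = r} ≤ 0 := by
    have hlim' := ENNReal.tendsto_ofReal (hlim.const_mul 2)
    simp only [integral_zero, mul_zero, ENNReal.ofReal_zero] at hlim'
    exact ge_of_tendsto hlim' (Eventually.of_forall fun j =>
      h.measure_exists_pair_le hc (hφc j) (hφ0 j) (hφ1 j) (by simp [hφ]))
  refine measure_mono_null (fun ω hω => ?_) (le_antisymm hzero bot_le)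
  simp only [mem_compl_iff, mem_ofPred_eq] at hω
  push Not at hω
  exact hω

end PoissonProcess

end Limit

/-! ### Poisson approximation for a fixed intensity -/

lemma tendsto_poissonMeasure_real {l : ℕ → ℝ≥0} {l₀ : ℝ≥0} (hl : Tendsto l atTop (𝓝 l₀))
    (B : Set ℕ) :
    Tendsto (fun n => (poissonMeasure (l n)).real B) atTop (𝓝 ((poissonMeasure l₀).real B)) := by
  simp_rw [← (hasSum_poissonWeight_indicator _ B).tsum_eq]
  have hl' : Tendsto (fun n => (l n : ℝ)) atTop (𝓝 (l₀ : ℝ)) :=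
    (NNReal.continuous_coe.tendsto _).comp hl
  refine tendsto_tsum_of_dominated_convergence
    (bound := fun j => ((l₀ : ℝ) + 1) ^ j / (j.factorial : ℝ))
    (Real.summable_pow_div_factorial _) (fun j => ?_) ?_
  · refine Tendsto.mul_const _ ?_
    have hcont : Continuous fun t : ℝ => poissonWeight t j := by
      unfold poissonWeight; fun_prop
    exact (hcont.tendsto _).comp hl'
  · filter_upwards [hl'.eventually_lt_const (lt_add_one (l₀ : ℝ))] with n hn j
    have h0 : (0 : ℝ) ≤ l n := (l n).coe_nonneg
    have hw : poissonWeight (l n) j ≤ ((l₀ : ℝ) + 1) ^ j / (j.factorial : ℝ) := by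
      unfold poissonWeight
      have : Real.exp (-(l n : ℝ)) ≤ 1 := Real.exp_le_one_iff.2 (by linarith)
      gcongr
      calc Real.exp (-(l n : ℝ)) * (l n : ℝ) ^ j ≤ 1 * (l n : ℝ) ^ j := by gcongr
        _ ≤ _ := by rw [one_mul]; gcongr
    have hi : ‖B.indicator (1 : ℕ → ℝ) j‖ ≤ 1 := by
      by_cases hj : j ∈ B <;> simp [hj]
    rw [norm_mul, Real.norm_of_nonneg (poissonWeight_nonneg h0 j)]
    exact (mul_le_of_le_one_right (poissonWeight_nonneg h0 j) hi).trans hw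

section Limit

variable {d : ℕ} {Ω : Type*} [MeasurableSpace Ω] {P : Measure Ω} [IsProbabilityMeasure P]
  {η : Ω → Set (Euc d)} {Λ : Measure (Euc d)} [IsFiniteMeasure Λ]

lemma exists_simpleFunc_tendsto_self (d : ℕ) : ∃ c : ℕ → SimpleFunc (Euc d) (Euc d),
    ∀ x, Tendsto (fun n => c n x) atTop (𝓝 x) :=
  ⟨SimpleFunc.nearestPt (TopologicalSpace.denseSeq (Euc d)), fun x =>
    SimpleFunc.tendsto_nearestPt (TopologicalSpace.denseRange_denseSeq (Euc d) x)⟩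

lemma IsPoissonProcess.ae_eventually_numCellIsolated_eq (h : IsPoissonProcess P η Λ)
    {c : ℕ → SimpleFunc (Euc d) (Euc d)} (hc : ∀ x, Tendsto (fun n => c n x) atTop (𝓝 x))
    (hΛ : ∀ x ρ, Λ (Metric.sphere x ρ) = 0) (k : ℕ) (r : ℝ) :
    ∀ᵐ ω ∂P, ∀ᶠ n in atTop, numCellIsolated (c n) k r (η ω) = numIsolated k (η ω) r := by
  filter_upwards [h.ae_finite, h.ae_dist_ne hc hΛ r] with ω h1 h2
  exact eventually_numCellIsolated_eq hc k r h1 h2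

/-- The count is almost everywhere a limit of the measurable discretised counts. -/
lemma IsPoissonProcess.aemeasurable_numIsolated (h : IsPoissonProcess P η Λ)
    (hΛ : ∀ x ρ, Λ (Metric.sphere x ρ) = 0) (k : ℕ) (r : ℝ) :
    AEMeasurable (fun ω => numIsolated k (η ω) r) P := by
  obtain ⟨c, hc⟩ := exists_simpleFunc_tendsto_self d
  refine aemeasurable_of_tendsto_metrizable_ae atTop
    (fun n => (h.measurable_numCellIsolated (c n) k r).aemeasurable) ?_
  filter_upwards [h.ae_eventually_numCellIsolated_eq hc hΛ k r] with ω hω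
  exact tendsto_const_nhds.congr' (hω.mono fun n hn => hn.symm)

lemma IsPoissonProcess.tendsto_integral_numCellIsolated (h : IsPoissonProcess P η Λ)
    {c : ℕ → SimpleFunc (Euc d) (Euc d)} (hc : ∀ x, Tendsto (fun n => c n x) atTop (𝓝 x))
    (hΛ : ∀ x ρ, Λ (Metric.sphere x ρ) = 0) (k : ℕ) (r : ℝ) :
    Tendsto (fun n => ∫ ω, (numCellIsolated (c n) k r (η ω) : ℝ) ∂P) atTop
      (𝓝 (meanIsolated P η k r)) := by
  refine tendsto_integral_of_dominated_convergence (fun ω => ((η ω).ncard : ℝ))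
    (fun n => (measurable_from_nat.comp
      (h.measurable_numCellIsolated (c n) k r)).aestronglyMeasurable)
    h.integrable_card (fun n => ?_) ?_
  · filter_upwards [h.ae_finite] with ω hω
    rw [Real.norm_natCast]
    exact_mod_cast numCellIsolated_le_ncard (c n) k r hω
  · filter_upwards [h.ae_eventually_numCellIsolated_eq hc hΛ k r] with ω hω
    exact tendsto_const_nhds.congr' (hω.mono fun n hn => by simp only [hn])

/-- The expected number of vertices of degree less than `k`: every point of the process sees
the process around it as if it were not a point of the process itself. -/
theorem IsPoissonProcess.meanIsolated_eq (h : IsPoissonProcess P η Λ)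
    (hΛ : ∀ x ρ, Λ (Metric.sphere x ρ) = 0) (k : ℕ) (r : ℝ) :
    meanIsolated P η k r = ∫ x, isolationProb k r Λ x ∂Λ := by
  obtain ⟨c, hc⟩ := exists_simpleFunc_tendsto_self d
  have hb : ∀ n x, ‖poissonBelow k (Λ.real (c n ⁻¹' (Metric.closedBall (c n x) r \ {c n x})))‖
      ≤ 1 := fun n x => by
    rw [Real.norm_of_nonneg (poissonBelow_nonneg k measureReal_nonneg)]
    exact poissonBelow_le_one k measureReal_nonneg
  have hm := fun n => aestronglyMeasurable_comp_simpleFunc (Λ := Λ) (c n) fun v =>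
    poissonBelow k (Λ.real (c n ⁻¹' (Metric.closedBall v r \ {v})))
  have hup : Tendsto (fun n => ∫ x, poissonBelow k
      (Λ.real (c n ⁻¹' (Metric.closedBall (c n x) r \ {c n x}))) ∂Λ) atTop
      (𝓝 (∫ x, isolationProb k r Λ x ∂Λ)) :=
    tendsto_integral_of_dominated_convergence (fun _ => 1) hm (integrable_const _)
      (fun n => ae_of_all _ (hb n)) (ae_of_all _ fun x => tendsto_isolationProb hc hΛ k r x)
  have hm2 := fun n => aestronglyMeasurable_comp_simpleFunc (Λ := Λ) (c n) fun v =>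
    Λ.real (c n ⁻¹' {v})
  have hb2 : ∀ n x, ‖Λ.real (c n ⁻¹' {c n x})‖ ≤ Λ.real univ := fun n x => by
    rw [Real.norm_of_nonneg measureReal_nonneg]
    exact measureReal_mono (subset_univ _)
  have hlow : Tendsto (fun n => ∫ x, (poissonBelow k
      (Λ.real (c n ⁻¹' (Metric.closedBall (c n x) r \ {c n x}))) - Λ.real (c n ⁻¹' {c n x})) ∂Λ)
      atTop (𝓝 (∫ x, isolationProb k r Λ x ∂Λ)) := by
    refine tendsto_integral_of_dominated_convergence (fun _ => 1 + Λ.real univ)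
      (fun n => (hm n).sub (hm2 n)) (integrable_const _)
      (fun n => ae_of_all _ fun x => (norm_sub_le _ _).trans (add_le_add (hb n x) (hb2 n x)))
      (ae_of_all _ fun x => ?_)
    simpa using (tendsto_isolationProb hc hΛ k r x).sub (tendsto_measureReal_cell hc hΛ x)
  exact tendsto_nhds_unique (h.tendsto_integral_numCellIsolated hc hΛ k r)
    (tendsto_of_tendsto_of_tendsto_of_le_of_le hlow hup
      (fun n => (h.integral_numCellIsolated_mem (c n) k r).1)
      (fun n => (h.integral_numCellIsolated_mem (c n) k r).2))

open Classical in
/-- **Poisson approximation** for the number of vertices of degree less than `k` in the geometric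
graph on a Poisson process. -/
theorem IsPoissonProcess.abs_numIsolated_sub_le (h : IsPoissonProcess P η Λ)
    (hΛ : ∀ x ρ, Λ (Metric.sphere x ρ) = 0) (k : ℕ) {r : ℝ} (hr : 0 ≤ r)
    (hpos : 0 < meanIsolated P η k r) (B : Set ℕ) :
    |P.real ((fun ω => numIsolated k (η ω) r) ⁻¹' B)
        - (poissonMeasure (meanIsolated P η k r).toNNReal).real B| ≤
      2 * Real.exp (meanIsolated P η k r) * ∫ x, (∫ y, (if dist x y ≤ 2 * r then
        isolationProb k r Λ x * isolationProb k r Λ y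
          + min (pairIsolationBound k r Λ x y) (pairIsolationBound k r Λ y x) else 0) ∂Λ) ∂Λ := by
  obtain ⟨c, hc⟩ := exists_simpleFunc_tendsto_self d
  set m : ℕ → ℝ := fun n => ∫ ω, (numCellIsolated (c n) k r (η ω) : ℝ) ∂P with hmdef
  have hm : Tendsto m atTop (𝓝 (meanIsolated P η k r)) :=
    h.tendsto_integral_numCellIsolated hc hΛ k r
  have hm0 : ∀ n, 0 ≤ m n := fun n => integral_nonneg fun ω => Nat.cast_nonneg _
  have hmN : Tendsto (fun n => (m n).toNNReal) atTop (𝓝 (meanIsolated P η k r).toNNReal) :=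
    (continuous_real_toNNReal.tendsto _).comp hm
  -- convergence of the probabilities
  have hprob : Tendsto (fun n => P.real ((fun ω => numCellIsolated (c n) k r (η ω)) ⁻¹' B)) atTop
      (𝓝 (P.real ((fun ω => numIsolated k (η ω) r) ⁻¹' B))) := by
    have hae := h.aemeasurable_numIsolated hΛ k r
    have hmk : P.real ((fun ω => numIsolated k (η ω) r) ⁻¹' B) = P.real (hae.mk _ ⁻¹' B) := by
      refine measureReal_congr ?_
      filter_upwards [hae.ae_eq_mk] with ω hω
      exact congrArg (fun z => z ∈ B) hω
    rw [hmk]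
    refine (ENNReal.tendsto_toReal (measure_ne_top _ _)).comp
      (tendsto_measure_of_ae_tendsto_indicator_of_isFiniteMeasure atTop
        (hae.measurable_mk MeasurableSet.of_discrete)
        (fun n => h.measurable_numCellIsolated (c n) k r MeasurableSet.of_discrete) ?_)
    filter_upwards [hae.ae_eq_mk, h.ae_eventually_numCellIsolated_eq hc hΛ k r] with ω h1 h2
    filter_upwards [h2] with n hn
    change numCellIsolated (c n) k r (η ω) ∈ B ↔ hae.mk _ ω ∈ B
    rw [hn, ← h1]
  have hiso0 : ∀ (S : Set (Euc d)), 0 ≤ poissonBelow k (Λ.real S) := fun S =>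
    poissonBelow_nonneg k measureReal_nonneg
  have hiso1 : ∀ (S : Set (Euc d)), poissonBelow k (Λ.real S) ≤ 1 := fun S =>
    poissonBelow_le_one k measureReal_nonneg
  have hpair0 : ∀ n v w, 0 ≤ cellPairBound (c n) k r Λ v w := fun n v w =>
    mul_nonneg (hiso0 _) (hiso0 _)
  have hpair1 : ∀ n v w, cellPairBound (c n) k r Λ v w ≤ 1 := fun n v w =>
    mul_le_one₀ (hiso1 _) (hiso0 _) (hiso1 _)
  have hJ := tendsto_integral_integral_cells (Λ := Λ) (c := c) (C := 2)
    (F := fun n v w => if dist v w ≤ 2 * r then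
        poissonBelow k (Λ.real (c n ⁻¹' (Metric.closedBall v r \ {v}))) *
          poissonBelow k (Λ.real (c n ⁻¹' (Metric.closedBall w r \ {w})))
        + min (cellPairBound (c n) k r Λ v w) (cellPairBound (c n) k r Λ w v) else 0)
    (G := fun x y => if dist x y ≤ 2 * r then isolationProb k r Λ x * isolationProb k r Λ y
          + min (pairIsolationBound k r Λ x y) (pairIsolationBound k r Λ y x) else 0)
    (fun n v w => by
      split_ifs with hvw
      · have e1 := mul_nonneg (hiso0 (c n ⁻¹' (Metric.closedBall v r \ {v})))
          (hiso0 (c n ⁻¹' (Metric.closedBall w r \ {w})))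
        have e2 : poissonBelow k (Λ.real (c n ⁻¹' (Metric.closedBall v r \ {v}))) *
          poissonBelow k (Λ.real (c n ⁻¹' (Metric.closedBall w r \ {w}))) ≤ 1 :=
          mul_le_one₀ (hiso1 _) (hiso0 _) (hiso1 _)
        have e3 := le_min (hpair0 n v w) (hpair0 n w v)
        have e4 := (min_le_left (cellPairBound (c n) k r Λ v w)
          (cellPairBound (c n) k r Λ w v)).trans (hpair1 n v w)
        rw [Real.norm_of_nonneg (by positivity)]
        linarith
      · simp)
    (fun x => by
      filter_upwards [ae_dist_ne_of_sphere hΛ x (2 * r)] with y hy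
      rw [dist_comm] at hy
      have hlim := ((tendsto_isolationProb hc hΛ k r x).mul
        (tendsto_isolationProb hc hΛ k r y)).add
        ((tendsto_pairIsolationBound hc hΛ k r x y).min
          (tendsto_pairIsolationBound hc hΛ k r y x))
      by_cases hxy : dist x y ≤ 2 * r
      · rw [if_pos hxy]
        refine hlim.congr' ?_
        filter_upwards [eventually_dist_le_iff hc hy] with n hn
        rw [if_pos (hn.2 hxy)]
      · rw [if_neg hxy]
        refine tendsto_const_nhds.congr' ?_
        filter_upwards [eventually_dist_le_iff hc hy] with n hn
        rw [if_neg (fun hle => hxy (hn.1 hle))])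
  refine le_of_tendsto_of_tendsto
    (hprob.sub (tendsto_poissonMeasure_real hmN B)).abs
    (((Real.continuous_exp.tendsto _).comp hm).const_mul 2 |>.mul hJ) ?_
  filter_upwards [hm.eventually_const_lt hpos] with n hn
  have hcoe : ((m n).toNNReal : ℝ) = m n := Real.coe_toNNReal _ (hm0 n)
  have := h.abs_numCellIsolated_sub_le (c n) k r hr (l := (m n).toNNReal)
    (Real.toNNReal_pos.2 hn) hcoe B
  rw [hcoe] at this
  exact this

end Limit

/-! ### The cone condition and volumes of neighbourhoods -/

section ConeCondition

variable {d : ℕ}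

/-- There is an open cone of directions (spanned by a ball of radius `ρ`) along which one can move
from `y` for a time `δ` without leaving `A`, and all of these directions lead away from `x`. -/
def PairCone (A : Set (Euc d)) (x y : Euc d) (ρ δ : ℝ) : Prop :=
  ∃ p : Euc d, ‖p‖ ≤ 1 ∧ ∀ u ∈ Metric.closedBall p ρ,
    (∀ t ∈ Icc 0 δ, y + t • u ∈ A) ∧ ρ * ‖y - x‖ ≤ inner ℝ u (y - x)

/-- For any two points of `A` near `x₀` one can move from one of them, in a cone of directions and
staying in `A`, away from the other one. -/
def HasLocalCones (A : Set (Euc d)) (x₀ : Euc d) : Prop :=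
  ∃ ρ > 0, ∃ δ > 0, ∀ x ∈ A ∩ Metric.ball x₀ δ, ∀ y ∈ A ∩ Metric.ball x₀ δ,
    PairCone A x y ρ δ ∨ PairCone A y x ρ δ

lemma PairCone.mono {A : Set (Euc d)} {x y : Euc d} {ρ ρ' δ δ' : ℝ} (h : PairCone A x y ρ δ)
    (hρ : ρ' ≤ ρ) (hδ : δ' ≤ δ) : PairCone A x y ρ' δ' := by
  obtain ⟨p, hp, h⟩ := h
  refine ⟨p, hp, fun u hu => ?_⟩
  obtain ⟨h1, h2⟩ := h u (Metric.closedBall_subset_closedBall hρ hu)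
  refine ⟨fun t ht => h1 t ⟨ht.1, ht.2.trans hδ⟩, le_trans ?_ h2⟩
  gcongr

/-- By compactness, the local cone condition holds with uniform constants. -/
lemma exists_uniform_pairCone {A : Set (Euc d)} (hA : IsCompact A)
    (h : ∀ x ∈ A, HasLocalCones A x) :
    ∃ ρ > 0, ∃ δ > 0, ρ ≤ 1 ∧ ∀ x ∈ A, ∀ y ∈ A, dist x y < δ →
      PairCone A x y ρ δ ∨ PairCone A y x ρ δ := by
  suffices hs : ∃ ρ > 0, ∃ δ > 0, ∀ x ∈ A, x ∈ A → ∀ y ∈ A, dist x y < δ →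
      PairCone A x y ρ δ ∨ PairCone A y x ρ δ by
    obtain ⟨ρ, hρ, δ, hδ, hs⟩ := hs
    refine ⟨min ρ 1, lt_min hρ one_pos, δ, hδ, min_le_right _ _, fun x hx y hy hxy => ?_⟩
    exact (hs x hx hx y hy hxy).imp (fun h => h.mono (min_le_left _ _) le_rfl)
      (fun h => h.mono (min_le_left _ _) le_rfl)
  refine hA.induction_on (p := fun S => ∃ ρ > 0, ∃ δ > 0, ∀ x ∈ S, x ∈ A → ∀ y ∈ A, dist x y < δ →
      PairCone A x y ρ δ ∨ PairCone A y x ρ δ) ?_ ?_ ?_ ?_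
  · exact ⟨1, one_pos, 1, one_pos, fun x hx => absurd hx (notMem_empty x)⟩
  · rintro S T hST ⟨ρ, hρ, δ, hδ, hT⟩
    exact ⟨ρ, hρ, δ, hδ, fun x hx => hT x (hST hx)⟩
  · rintro S T ⟨ρ, hρ, δ, hδ, hS⟩ ⟨ρ', hρ', δ', hδ', hT⟩
    refine ⟨min ρ ρ', lt_min hρ hρ', min δ δ', lt_min hδ hδ', ?_⟩
    rintro x (hx | hx) hxA y hy hxy
    · exact (hS x hx hxA y hy (hxy.trans_le (min_le_left _ _))).imp
        (fun h => h.mono (min_le_left _ _) (min_le_left _ _))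
        (fun h => h.mono (min_le_left _ _) (min_le_left _ _))
    · exact (hT x hx hxA y hy (hxy.trans_le (min_le_right _ _))).imp
        (fun h => h.mono (min_le_right _ _) (min_le_right _ _))
        (fun h => h.mono (min_le_right _ _) (min_le_right _ _))
  · intro x₀ hx₀
    obtain ⟨ρ, hρ, δ, hδ, h₀⟩ := h x₀ hx₀
    refine ⟨Metric.ball x₀ (δ / 2), mem_nhdsWithin_of_mem_nhds (Metric.ball_mem_nhds _ (by positivity)),
      ρ, hρ, δ / 2, by positivity, fun x hx hxA y hy hxy => ?_⟩
    rw [Metric.mem_ball] at hx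
    have hy' : dist y x₀ < δ := by
      have := dist_triangle y x x₀
      rw [dist_comm y x] at this
      linarith
    exact (h₀ x ⟨hxA, by rw [Metric.mem_ball]; linarith⟩ y ⟨hy, hy'⟩).imp
      (fun h => h.mono le_rfl (by linarith)) (fun h => h.mono le_rfl (by linarith))

/-- A cone of directions at `y` whose axis does not point towards `x` can be tilted away
from `x`. -/
lemma pairCone_of_inner_nonneg {A : Set (Euc d)} {x y v : Euc d} {κ δ : ℝ} (hκ : 0 < κ)
    (h : ∀ u ∈ Metric.closedBall v κ, ∀ t ∈ Icc 0 δ, y + t • u ∈ A)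
    (hv : 0 ≤ inner ℝ v (y - x)) : PairCone A x y (κ / (4 * (1 + ‖v‖ + κ))) δ := by
  set s := ‖y - x‖ with hs
  set e : Euc d := s⁻¹ • (y - x) with he
  set σ : ℝ := (1 + ‖v‖ + κ)⁻¹ with hσ
  have hM : 0 < 1 + ‖v‖ + κ := by positivity
  have hσ0 : 0 < σ := inv_pos.2 hM
  have hσM : σ * (1 + ‖v‖ + κ) = 1 := inv_mul_cancel₀ hM.ne'
  have hσ1 : σ ≤ 1 := inv_le_one_of_one_le₀ (by linarith [norm_nonneg v])
  have hρ : κ / (4 * (1 + ‖v‖ + κ)) = σ * (κ / 4) := by rw [hσ]; field_simp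
  have he1 : ‖e‖ ≤ 1 := by
    rw [he, norm_smul, norm_inv, Real.norm_of_nonneg (norm_nonneg _)]
    exact inv_mul_le_one
  have hes : inner ℝ e (y - x) = s := by
    rw [he, real_inner_smul_left, real_inner_self_eq_norm_sq, ← hs]
    rcases eq_or_ne s 0 with h0 | h0
    · simp [h0]
    · field_simp
  refine ⟨σ • (v + (κ / 2) • e), ?_, fun u hu => ?_⟩
  · rw [norm_smul, Real.norm_of_nonneg hσ0.le]
    calc σ * ‖v + (κ / 2) • e‖ ≤ σ * (1 + ‖v‖ + κ) := by
          gcongr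
          refine (norm_add_le _ _).trans ?_
          rw [norm_smul, Real.norm_of_nonneg (by positivity)]
          nlinarith
      _ = 1 := hσM
  · rw [hρ, Metric.mem_closedBall, dist_eq_norm] at hu
    set z := σ⁻¹ • u - (v + (κ / 2) • e) with hz
    have hu' : u = σ • (v + (κ / 2) • e + z) := by
      rw [hz, add_sub_cancel, smul_smul, mul_inv_cancel₀ hσ0.ne', one_smul]
    have hzn : ‖z‖ ≤ κ / 4 := by
      have : u - σ • (v + (κ / 2) • e) = σ • z := by rw [hu', ← smul_sub, add_sub_cancel_left]
      rw [this, norm_smul, Real.norm_of_nonneg hσ0.le] at hu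
      exact le_of_mul_le_mul_left hu hσ0
    constructor
    · intro t ht
      rw [hu', smul_smul]
      refine h _ ?_ _ ⟨mul_nonneg ht.1 hσ0.le, ?_⟩
      · rw [Metric.mem_closedBall, dist_eq_norm, add_assoc, add_sub_cancel_left]
        refine (norm_add_le _ _).trans ?_
        rw [norm_smul, Real.norm_of_nonneg (by positivity)]
        nlinarith
      · exact (mul_le_of_le_one_right ht.1 hσ1).trans ht.2
    · rw [hρ, hu', real_inner_smul_left, inner_add_left, inner_add_left, real_inner_smul_left, hes,
        mul_assoc]
      refine mul_le_mul_of_nonneg_left ?_ hσ0.le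
      have h1 : -(‖z‖ * s) ≤ inner ℝ z (y - x) := by
        have := abs_real_inner_le_norm z (y - x)
        exact (abs_le.1 this).1
      have h2 : 0 ≤ s := norm_nonneg _
      nlinarith

/-- A single cone of directions that works at all points of `A` near `x₀`. -/
lemma hasLocalCones_of_common {A : Set (Euc d)} {x₀ v : Euc d} {κ δ : ℝ} (hκ : 0 < κ) (hδ : 0 < δ)
    (h : ∀ x ∈ A ∩ Metric.ball x₀ δ, ∀ u ∈ Metric.closedBall v κ, ∀ t ∈ Icc 0 δ, x + t • u ∈ A) :
    HasLocalCones A x₀ := by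
  refine ⟨κ / (4 * (1 + ‖v‖ + κ)), by positivity, δ, hδ, fun x hx y hy => ?_⟩
  rcases le_total 0 (inner ℝ v (y - x)) with hv | hv
  · exact Or.inl (pairCone_of_inner_nonneg hκ (h y hy) hv)
  · refine Or.inr (pairCone_of_inner_nonneg hκ (h x hx) ?_)
    rw [← neg_sub, inner_neg_right]; linarith

lemma hasLocalCones_of_mem_interior {A : Set (Euc d)} {x₀ : Euc d} (hx : x₀ ∈ interior A) :
    HasLocalCones A x₀ := by
  obtain ⟨δ, hδ, hb⟩ := Metric.isOpen_iff.1 isOpen_interior x₀ hx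
  refine hasLocalCones_of_common (v := 0) (κ := 1 / 2) (δ := δ / 2) (by norm_num) (by positivity)
    fun x hx u hu t ht => interior_subset (hb ?_)
  have h1 := hx.2
  rw [Metric.mem_ball, dist_eq_norm] at h1 ⊢
  rw [mem_closedBall_zero_iff] at hu
  have h2 : ‖t • u‖ ≤ δ / 2 * (1 / 2) := by
    rw [norm_smul, Real.norm_of_nonneg ht.1]
    exact mul_le_mul ht.2 hu (norm_nonneg _) (by positivity)
  calc ‖x + t • u - x₀‖ = ‖(x - x₀) + t • u‖ := by congr 1; abel
    _ ≤ ‖x - x₀‖ + ‖t • u‖ := norm_add_le _ _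
    _ < δ := by linarith

/-- The neighbourhood of a point in `A` has volume of the maximal order. -/
lemma PairCone.volume_closedBall_ge {A : Set (Euc d)} {x : Euc d} {ρ δ r : ℝ}
    (h : PairCone A x x ρ δ) (hρ1 : ρ ≤ 1) (hr : 0 < r) (hrδ : r ≤ δ) :
    volume.real (Metric.closedBall (0 : Euc d) (ρ / 2)) * r ^ d
      ≤ volume.real (A ∩ Metric.closedBall x r) := by
  obtain ⟨p, hp, h⟩ := h
  have hsub : Metric.closedBall (x + (r / 2) • p) (r * (ρ / 2)) ⊆ A ∩ Metric.closedBall x r := by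
    intro z hz
    set u := (r / 2)⁻¹ • (z - x) with hu
    have hzu : z = x + (r / 2) • u := by
      rw [hu, smul_smul, mul_inv_cancel₀ (by positivity), one_smul, add_sub_cancel]
    have hup : ‖u - p‖ ≤ ρ := by
      rw [Metric.mem_closedBall, dist_eq_norm, hzu, add_sub_add_left_eq_sub, ← smul_sub, norm_smul,
        Real.norm_of_nonneg (by positivity)] at hz
      refine le_of_mul_le_mul_left (a := r / 2) ?_ (by positivity)
      linarith
    have hun : ‖u‖ ≤ 2 := by
      calc ‖u‖ = ‖(u - p) + p‖ := by rw [sub_add_cancel]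
        _ ≤ ‖u - p‖ + ‖p‖ := norm_add_le _ _
        _ ≤ 2 := by linarith
    rw [hzu]
    refine ⟨(h u (by rwa [Metric.mem_closedBall, dist_eq_norm])).1 _ ⟨by positivity, by linarith⟩, ?_⟩
    rw [Metric.mem_closedBall, dist_eq_norm, add_sub_cancel_left, norm_smul,
      Real.norm_of_nonneg (by positivity)]
    nlinarith
  have hvol : volume.real (Metric.closedBall (x + (r / 2) • p) (r * (ρ / 2)))
      = volume.real (Metric.closedBall (0 : Euc d) (ρ / 2)) * r ^ d := by
    rw [measureReal_def, Measure.addHaar_closedBall_mul_of_pos volume _ hr,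
      finrank_euclideanSpace_fin, ENNReal.toReal_mul, ENNReal.toReal_ofReal (by positivity),
      mul_comm, measureReal_def]
  rw [← hvol]
  exact measureReal_mono hsub (measure_ne_top_of_subset inter_subset_right
    (measure_closedBall_lt_top).ne)

open scoped Pointwise in
/-- The ball around `y` contains a part of `A` outside the ball around `x` whose volume is at least
proportional to the distance of `x` and `y`: it consists of the points `y + w`, where `w` is in a
cone of directions leading away from `x` and has length between `r - ρ * dist x y / 4` and `r`. -/
lemma PairCone.volume_diff_ge {A : Set (Euc d)} (hd : 1 ≤ d) {x y : Euc d} {ρ δ r : ℝ}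
    (h : PairCone A x y ρ δ) (hρ : 0 < ρ) (hρ1 : ρ ≤ 1) (hr : 0 < r) (hrδ : r ≤ ρ * δ)
    (hxy : dist x y ≤ 2 * r) :
    volume.real (Metric.closedBall (0 : Euc d) (ρ / 2)) * (ρ / 4) * (r ^ (d - 1) * dist x y)
      ≤ volume.real (A ∩ (Metric.closedBall y r \ Metric.closedBall x r)) := by
  obtain ⟨p, hp, h⟩ := h
  rw [dist_comm, dist_eq_norm] at hxy ⊢
  set s := ‖y - x‖ with hs
  have hs0 : 0 ≤ s := norm_nonneg _
  rcases hs0.eq_or_lt with h0 | hspos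
  · rw [← h0]; simp
  set S : Set (Euc d) := {w | ‖w‖ ≤ 1 ∧ ∃ t ≥ (0 : ℝ), ∃ u ∈ Metric.closedBall p ρ, w = t • u} with hS
  set a := r - ρ * s / 4 with ha
  have ha0 : 0 < a := by nlinarith
  have hun : ∀ u ∈ Metric.closedBall p ρ, ρ ≤ ‖u‖ ∧ ‖u‖ ≤ 2 := by
    intro u hu
    constructor
    · have h1 := (h u hu).2
      have h2 := real_inner_le_norm u (y - x)
      exact le_of_mul_le_mul_right (h1.trans h2) hspos
    · rw [Metric.mem_closedBall, dist_eq_norm] at hu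
      calc ‖u‖ = ‖(u - p) + p‖ := by rw [sub_add_cancel]
        _ ≤ ‖u - p‖ + ‖p‖ := norm_add_le _ _
        _ ≤ 2 := by linarith
  have hsub : (fun w => y + w) '' (r • S \ a • S)
      ⊆ A ∩ (Metric.closedBall y r \ Metric.closedBall x r) := by
    rintro _ ⟨w, ⟨⟨w', ⟨hw1, t, ht, u, hu, rfl⟩, rfl⟩, hwa⟩, rfl⟩
    simp only at hwa ⊢
    have hu' := hun u hu
    rw [norm_smul, Real.norm_of_nonneg ht] at hw1
    have htρ : t * ρ ≤ 1 := (mul_le_mul_of_nonneg_left hu'.1 ht).trans hw1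
    set w := r • t • u with hw
    have hwn : ‖w‖ = r * (t * ‖u‖) := by
      rw [hw, norm_smul, norm_smul, Real.norm_of_nonneg hr.le, Real.norm_of_nonneg ht]
    have hwr : ‖w‖ ≤ r := by rw [hwn]; exact mul_le_of_le_one_right hr.le hw1
    have haw : a < ‖w‖ := by
      by_contra hcon
      push Not at hcon
      refine hwa ⟨a⁻¹ • w, ⟨?_, a⁻¹ * (r * t), by positivity, u, hu, ?_⟩, ?_⟩
      · rw [norm_smul, norm_inv, Real.norm_of_nonneg ha0.le, inv_mul_le_iff₀ ha0]
        linarith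
      · rw [hw, smul_smul, smul_smul, mul_assoc]
      · simp only [smul_smul, mul_inv_cancel₀ ha0.ne', one_smul]
    have hin : ρ * s * ‖w‖ ≤ 2 * inner ℝ w (y - x) := by
      have h2 := (h u hu).2
      have h3 : inner ℝ w (y - x) = r * (t * inner ℝ u (y - x)) := by
        rw [hw, real_inner_smul_left, real_inner_smul_left]
      rw [h3, hwn]
      have h4 : 0 ≤ r * t := by positivity
      have h5 : ρ * s * ‖u‖ ≤ 2 * (ρ * s) := by
        have : 0 ≤ ρ * s := by positivity
        nlinarith
      nlinarith
    refine ⟨?_, ?_, ?_⟩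
    · rw [hw, smul_smul]
      refine (h u hu).1 _ ⟨by positivity, ?_⟩
      have : ρ * (r * t) ≤ ρ * δ := by nlinarith
      exact le_of_mul_le_mul_left this hρ
    · rw [Metric.mem_closedBall, dist_eq_norm, add_sub_cancel_left]; exact hwr
    · rw [Metric.mem_closedBall, dist_eq_norm, not_le]
      have hexp : ‖y + w - x‖ ^ 2 = s ^ 2 + 2 * inner ℝ w (y - x) + ‖w‖ ^ 2 := by
        rw [show y + w - x = (y - x) + w by abel, norm_add_sq_real, real_inner_comm]
      have hsq : r ^ 2 < ‖y + w - x‖ ^ 2 := by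
        rw [hexp]
        have h6 : a * (ρ * s) ≤ ‖w‖ * (ρ * s) :=
          mul_le_mul_of_nonneg_right haw.le (by positivity)
        have h7 : a ^ 2 ≤ ‖w‖ ^ 2 := pow_le_pow_left₀ ha0.le haw.le 2
        have h8 : ρ ^ 2 * s ^ 2 ≤ s ^ 2 := by
          have : ρ ^ 2 ≤ 1 := pow_le_one₀ hρ.le hρ1
          nlinarith [sq_nonneg s]
        have h9 : 0 < r * ρ * s := by positivity
        have h10 : a ^ 2 + a * (ρ * s) + s ^ 2
          = r ^ 2 + r * ρ * s / 2 + s ^ 2 - 3 * (ρ ^ 2 * s ^ 2) / 16 := by rw [ha]; ring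
        have h11 : 0 < s ^ 2 := by positivity
        nlinarith
      exact lt_of_pow_lt_pow_left₀ 2 (norm_nonneg _) hsq
  have hSfin : volume S ≠ ∞ := measure_ne_top_of_subset
    (fun w hw => by rw [mem_closedBall_zero_iff]; exact hw.1)
    (measure_closedBall_lt_top (x := (0 : Euc d)) (r := 1)).ne
  have hscale : ∀ b : ℝ, 0 ≤ b → volume.real (b • S) = b ^ d * volume.real S := fun b hb => by
    rw [measureReal_def, Measure.addHaar_smul_of_nonneg volume hb, finrank_euclideanSpace_fin,
      ENNReal.toReal_mul, ENNReal.toReal_ofReal (by positivity), measureReal_def]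
  have hbfin : volume (r • S) ≠ ∞ := by
    rw [Measure.addHaar_smul]; exact ENNReal.mul_ne_top ENNReal.ofReal_ne_top hSfin
  have hafin : volume (a • S) ≠ ∞ := by
    rw [Measure.addHaar_smul]; exact ENNReal.mul_ne_top ENNReal.ofReal_ne_top hSfin
  have hpow : r ^ (d - 1) * (ρ * s / 4) ≤ r ^ d - a ^ d := by
    obtain ⟨m, rfl⟩ : ∃ m, d = m + 1 := ⟨d - 1, by omega⟩
    have har : a ≤ r := by rw [ha]; have := mul_pos hρ hspos; linarith
    have : a ^ m ≤ r ^ m := pow_le_pow_left₀ ha0.le har m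
    have h1 : r - a = ρ * s / 4 := by rw [ha]; ring
    rw [← h1, Nat.add_sub_cancel, pow_succ, pow_succ]
    nlinarith
  have hSvol : volume.real (Metric.closedBall (0 : Euc d) (ρ / 2)) ≤ volume.real S := by
    have : Metric.closedBall ((1 / 2 : ℝ) • p) (ρ / 2) ⊆ S := by
      intro w hw
      have hu : (2 : ℝ) • w ∈ Metric.closedBall p ρ := by
        rw [Metric.mem_closedBall, dist_eq_norm] at hw ⊢
        have : (2 : ℝ) • w - p = (2 : ℝ) • (w - (1 / 2 : ℝ) • p) := by
          rw [smul_sub, smul_smul]; norm_num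
        rw [this, norm_smul]; norm_num; linarith
      refine ⟨?_, 1 / 2, by norm_num, (2 : ℝ) • w, hu, by rw [smul_smul]; norm_num⟩
      have := (hun _ hu).2
      rw [norm_smul] at this
      norm_num at this
      linarith
    calc volume.real (Metric.closedBall (0 : Euc d) (ρ / 2))
        = volume.real (Metric.closedBall ((1 / 2 : ℝ) • p) (ρ / 2)) :=
          (Measure.addHaar_real_closedBall_center volume _ _).symm
      _ ≤ _ := measureReal_mono this hSfin
  calc volume.real (Metric.closedBall (0 : Euc d) (ρ / 2)) * (ρ / 4) * (r ^ (d - 1) * s)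
      = (r ^ (d - 1) * (ρ * s / 4)) * volume.real (Metric.closedBall (0 : Euc d) (ρ / 2)) := by ring
    _ ≤ (r ^ d - a ^ d) * volume.real S := by
        refine mul_le_mul hpow hSvol measureReal_nonneg (le_trans (by positivity) hpow)
    _ = volume.real (r • S) - volume.real (a • S) := by
        rw [hscale r hr.le, hscale a ha0.le]; ring
    _ ≤ volume.real (r • S \ a • S) := le_measureReal_sdiff hafin
    _ = volume.real ((fun w => y + w) '' (r • S \ a • S)) := by
        rw [measureReal_def, measureReal_def, image_add_left, measure_preimage_add]
    _ ≤ _ := measureReal_mono hsub (measure_ne_top_of_subset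
        (inter_subset_right.trans sdiff_subset) (measure_closedBall_lt_top).ne)

/-- The two volume estimates that the Poisson approximation needs: neighbourhoods in `A` have volume
of order `r ^ d`, and the neighbourhoods of two points differ by a volume of order at least
`r ^ (d - 1)` times the distance of the points. -/
def HasBallGrowth (A : Set (Euc d)) : Prop :=
  ∃ c > 0, ∃ r₀ > 0, ∀ r, 0 < r → r ≤ r₀ →
    (∀ x ∈ A, c * r ^ d ≤ volume.real (A ∩ Metric.closedBall x r)) ∧
    ∀ x ∈ A, ∀ y ∈ A, dist x y ≤ 2 * r →
      c * (r ^ (d - 1) * dist x y)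
          ≤ volume.real (A ∩ (Metric.closedBall y r \ Metric.closedBall x r)) ∨
      c * (r ^ (d - 1) * dist x y)
          ≤ volume.real (A ∩ (Metric.closedBall x r \ Metric.closedBall y r))

/-- The local cone condition at all points of a compact set implies the volume estimates. -/
lemma hasBallGrowth_of_hasLocalCones (hd : 1 ≤ d) {A : Set (Euc d)} (hA : IsCompact A)
    (h : ∀ x ∈ A, HasLocalCones A x) : HasBallGrowth A := by
  obtain ⟨ρ, hρ, δ, hδ, hρ1, h⟩ := exists_uniform_pairCone hA h
  set V := volume.real (Metric.closedBall (0 : Euc d) (ρ / 2)) with hV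
  have hVpos : 0 < V := ENNReal.toReal_pos
    (Metric.measure_closedBall_pos volume _ (by positivity)).ne' measure_closedBall_lt_top.ne
  have hle : V * (ρ / 4) ≤ V := mul_le_of_le_one_right hVpos.le (by linarith)
  refine ⟨V * (ρ / 4), by positivity, min (ρ * δ) (δ / 4), by positivity, fun r hr hr₀ => ?_⟩
  have h1 : r ≤ ρ * δ := hr₀.trans (min_le_left _ _)
  have h2 : r ≤ δ / 4 := hr₀.trans (min_le_right _ _)
  refine ⟨fun x hx => ?_, fun x hx y hy hxy => ?_⟩
  · have hc : PairCone A x x ρ δ := (h x hx x hx (by simpa using hδ)).elim id id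
    refine le_trans ?_ (hc.volume_closedBall_ge hρ1 hr (by linarith))
    gcongr
  · rcases h x hx y hy (by linarith) with hc | hc
    · exact Or.inl (hc.volume_diff_ge hd hρ hρ1 hr h1 hxy)
    · refine Or.inr ?_
      rw [dist_comm] at hxy ⊢
      exact hc.volume_diff_ge hd hρ hρ1 hr h1 hxy

end ConeCondition

/-! ### Sets with `C²` boundary -/

section SmoothBoundary

/-- Near a `C²` boundary point the cone around the inner direction of the graph works, because the
defining function is locally Lipschitz. -/
lemma HasC2Boundary.hasLocalCones {d : ℕ} {A : Set (Euc d)} (hA : HasC2Boundary A)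
    {x₀ : Euc d} (hx₀ : x₀ ∈ frontier A) : HasLocalCones A x₀ := by
  obtain ⟨e, U, φ, hU, hxU, hφ, heq⟩ := hA x₀ hx₀
  set L := e.toRealAffineIsometryEquiv with hL
  have hLe : ∀ z, e z = L z := fun z => rfl
  obtain ⟨δ₁, hδ₁, hball⟩ := Metric.isOpen_iff.1 hU x₀ hxU
  obtain ⟨K, W, hW, hlip⟩ := (hφ.contDiffAt (x := (e x₀).fst)).of_le
    (by norm_num : (1 : WithTop ℕ∞) ≤ 2) |>.exists_lipschitzOnWith
  obtain ⟨δ₂, hδ₂, hW2⟩ := Metric.mem_nhds_iff.1 hW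
  have hmem : ∀ z ∈ U, z ∈ A ↔ φ (e z).fst ≤ (e z).snd := by
    intro z hz
    constructor
    · intro hzA
      have : e z ∈ e '' U ∩ closedEpigraph φ := heq ▸ mem_image_of_mem _ ⟨hzA, hz⟩
      exact this.2
    · intro hle
      have : e z ∈ e '' (A ∩ U) := heq ▸ ⟨mem_image_of_mem _ hz, hle⟩
      obtain ⟨z', hz', he⟩ := this
      rw [← e.injective he]; exact hz'.1
  set v : Euc d := L.linearIsometryEquiv.symm (WithLp.toLp 2 (0, 1)) with hv
  -- the opening `κ` satisfies `K * κ ≤ 1 - κ`, so that moving along the cone the height increases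
  -- at least as fast as the `K`-Lipschitz function `φ`
  set κ : ℝ := 1 / (2 * (1 + K)) with hκ
  have hK : (0 : ℝ) ≤ K := K.coe_nonneg
  have hκ0 : 0 < κ := by positivity
  have hκ1 : κ ≤ 1 / 2 := by
    rw [hκ]; exact one_div_le_one_div_of_le (by norm_num) (by linarith)
  have hκK : K * κ ≤ 1 / 2 := by
    rw [hκ, mul_one_div, div_le_iff₀ (by positivity)]; linarith
  have hvn : ‖v‖ = 1 := by
    rw [hv, LinearIsometryEquiv.norm_map, WithLp.prod_norm_eq_of_L2]; simp
  set δ := min δ₁ δ₂ / 4 with hδ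
  have hδ0 : 0 < δ := by positivity
  have hδ1 : 4 * δ ≤ δ₁ := by rw [hδ]; linarith [min_le_left δ₁ δ₂]
  have hδ2 : 4 * δ ≤ δ₂ := by rw [hδ]; linarith [min_le_right δ₁ δ₂]
  have hfst : ∀ z, dist z x₀ < 4 * δ → (e z).fst ∈ W := by
    intro z hz
    refine hW2 (lt_of_le_of_lt ?_ (hz.trans_le hδ2))
    rw [dist_eq_norm]
    calc ‖(e z).fst - (e x₀).fst‖ = ‖(e z - e x₀).fst‖ := rfl
      _ ≤ ‖e z - e x₀‖ := WithLp.norm_fst_le _ _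
      _ = dist z x₀ := by rw [← dist_eq_norm, e.dist_eq]
  refine hasLocalCones_of_common (v := v) hκ0 hδ0 fun x hx u hu t ht => ?_
  have hxx : dist x x₀ < δ := hx.2
  have hun : ‖u‖ ≤ 3 / 2 := by
    rw [Metric.mem_closedBall, dist_eq_norm] at hu
    calc ‖u‖ = ‖(u - v) + v‖ := by rw [sub_add_cancel]
      _ ≤ ‖u - v‖ + ‖v‖ := norm_add_le _ _
      _ ≤ 3 / 2 := by rw [hvn]; linarith
  have hdist : dist (x + t • u) x₀ < 4 * δ := by
    calc dist (x + t • u) x₀ ≤ dist (x + t • u) x + dist x x₀ := dist_triangle _ _ _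
      _ = ‖t • u‖ + dist x x₀ := by rw [dist_eq_norm, add_sub_cancel_left]
      _ ≤ δ * (3 / 2) + dist x x₀ := by
          rw [norm_smul, Real.norm_of_nonneg ht.1]
          gcongr
          exact ht.2
      _ < 4 * δ := by linarith
  have hxU' : x ∈ U := hball (by rw [Metric.mem_ball]; linarith)
  have hzU : x + t • u ∈ U := hball (by rw [Metric.mem_ball]; linarith)
  rw [hmem _ hzU]
  have hxe := (hmem x hxU').1 hx.1
  set w := L.linearIsometryEquiv u with hw
  have hez : e (x + t • u) = e x + t • w := by
    rw [hLe, hLe, add_comm x, ← vadd_eq_add, AffineIsometryEquiv.map_vadd, map_smul, vadd_eq_add,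
      add_comm]
  have hwv : ‖w - WithLp.toLp 2 (0, 1)‖ ≤ κ := by
    have : (WithLp.toLp 2 (0, 1) : WithLp 2 (Euc (d - 1) × ℝ)) = L.linearIsometryEquiv v := by
      rw [hv, LinearIsometryEquiv.apply_symm_apply]
    rw [hw, this, ← map_sub, LinearIsometryEquiv.norm_map, ← dist_eq_norm]
    exact hu
  have hw1 : ‖w.fst‖ ≤ κ := by
    have h1 := (WithLp.norm_fst_le _ (w - WithLp.toLp 2 (0, 1))).trans hwv
    simpa using h1
  have hw2 : 1 - κ ≤ w.snd := by
    have h1 := (WithLp.norm_snd_le _ (w - WithLp.toLp 2 (0, 1))).trans hwv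
    have h2 : (WithLp.toLp 2 ((0 : Euc (d - 1)), (1 : ℝ))).snd = 1 := rfl
    rw [WithLp.sub_snd, Real.norm_eq_abs, h2] at h1
    linarith [(abs_le.1 h1).1]
  have hlip' := hlip.dist_le_mul _ (hfst (x + t • u) hdist) _ (hfst x (by linarith))
  rw [hez] at hlip' ⊢
  have hd1 : dist (e x + t • w).fst (e x).fst ≤ t * κ := by
    rw [dist_eq_norm, WithLp.add_fst, add_sub_cancel_left, WithLp.smul_fst, norm_smul,
      Real.norm_of_nonneg ht.1]
    exact mul_le_mul_of_nonneg_left hw1 ht.1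
  have hφle : φ (e x + t • w).fst ≤ φ (e x).fst + t * (1 / 2) := by
    have h1 := (abs_le.1 ((Real.dist_eq _ _).symm.trans_le hlip')).2
    have h2 : K * dist (e x + t • w).fst (e x).fst ≤ t * (1 / 2) := by
      calc K * dist (e x + t • w).fst (e x).fst ≤ K * (t * κ) := by gcongr
        _ = t * (K * κ) := by ring
        _ ≤ t * (1 / 2) := mul_le_mul_of_nonneg_left hκK ht.1
    linarith
  have hsnd : (e x + t • w).snd = (e x).snd + t * w.snd := by
    rw [WithLp.add_snd, WithLp.smul_snd, smul_eq_mul]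
  rw [hsnd]
  have : t * (1 / 2) ≤ t * w.snd := mul_le_mul_of_nonneg_left (by linarith) ht.1
  linarith

end SmoothBoundary

/-! ### Planar cones -/

section PlanarCones

variable {d : ℕ}

/-- A point `w` of a cone can be left radially, tilted into a cone of directions `v`, and this
leads away from every point `w'` from which the radial direction leads away. -/
lemma pairCone_radial {K : Set (Euc d)} {w w' v : Euc d} {κ τ δ : ℝ} (hκ : 0 < κ) (hτ : 0 < τ)
    (hw0 : w ≠ 0) (hv : ‖v‖ ≤ 2)
    (hK : ∀ s > (0 : ℝ), ∀ u ∈ Metric.closedBall v κ, ∀ t ≥ (0 : ℝ), s • w + t • u ∈ K)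
    (hin : 2 * τ * ‖w - w'‖ ≤ inner ℝ (‖w‖⁻¹ • w) (w - w')) :
    PairCone K w' w ((τ * κ) / (4 * (1 + ‖‖w‖⁻¹ • w + τ • v‖ + τ * κ))) δ := by
  have hwn : 0 < ‖w‖ := norm_pos_iff.2 hw0
  refine pairCone_of_inner_nonneg (mul_pos hτ hκ) (fun u hu t ht => ?_) ?_
  · set z := τ⁻¹ • (u - ‖w‖⁻¹ • w) with hz
    have hu' : u = ‖w‖⁻¹ • w + τ • z := by
      rw [hz, smul_smul, mul_inv_cancel₀ hτ.ne', one_smul, add_sub_cancel]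
    have hzv : z ∈ Metric.closedBall v κ := by
      rw [Metric.mem_closedBall, dist_eq_norm] at hu ⊢
      rw [hu', add_sub_add_left_eq_sub, ← smul_sub, norm_smul, Real.norm_of_nonneg hτ.le] at hu
      exact le_of_mul_le_mul_left hu hτ
    have hs : 0 < 1 + t * ‖w‖⁻¹ := by
      have := mul_nonneg ht.1 (inv_nonneg.2 hwn.le)
      linarith
    have := hK (1 + t * ‖w‖⁻¹) hs z hzv (t * τ) (mul_nonneg ht.1 hτ.le)
    convert this using 1
    rw [hu']
    module
  · rw [inner_add_left, real_inner_smul_left (v) _ τ]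
    have h1 : -(‖v‖ * ‖w - w'‖) ≤ inner ℝ v (w - w') :=
      (abs_le.1 (abs_real_inner_le_norm v (w - w'))).1
    have h2 : ‖v‖ * ‖w - w'‖ ≤ 2 * ‖w - w'‖ := by gcongr
    nlinarith

/-- A closed cone that is, near each of its unit vectors, invariant under a cone of directions
satisfies the cone condition for pairs. -/
lemma exists_pairCone_of_cone {K : Set (Euc d)} (hK : IsClosed K)
    (hcone : ∀ w ∈ K, ∀ t > (0 : ℝ), t • w ∈ K) (hne : ∃ w ∈ K, w ≠ 0)
    (hloc : ∀ θ ∈ K, ‖θ‖ = 1 → ∃ ε > 0, ∃ κ > 0, ∃ v : Euc d, ‖v‖ ≤ 2 ∧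
      ∀ x ∈ K, ‖x - θ‖ < ε → ∀ u ∈ Metric.closedBall v κ, ∀ t ≥ (0 : ℝ), x + t • u ∈ K) :
    ∃ ρ > 0, ρ ≤ 1 ∧ ∀ x ∈ K, ∀ y ∈ K, ∀ δ, PairCone K x y ρ δ ∨ PairCone K y x ρ δ := by
  -- uniform constants, by compactness of the set of unit vectors of `K`
  have hunif : ∃ ε > 0, ∃ κ > 0, ∀ θ ∈ K ∩ Metric.sphere 0 1, ∃ v : Euc d, ‖v‖ ≤ 2 ∧
      ∀ x ∈ K, ‖x - θ‖ < ε → ∀ u ∈ Metric.closedBall v κ, ∀ t ≥ (0 : ℝ), x + t • u ∈ K := by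
    have hcpt : IsCompact (K ∩ Metric.sphere (0 : Euc d) 1) :=
      (isCompact_sphere _ _).inter_left hK
    refine hcpt.induction_on (p := fun S => ∃ ε > 0, ∃ κ > 0, ∀ θ ∈ S, ∃ v : Euc d, ‖v‖ ≤ 2 ∧
      ∀ x ∈ K, ‖x - θ‖ < ε → ∀ u ∈ Metric.closedBall v κ, ∀ t ≥ (0 : ℝ), x + t • u ∈ K) ?_ ?_ ?_ ?_
    · exact ⟨1, one_pos, 1, one_pos, fun x hx => absurd hx (notMem_empty x)⟩
    · rintro S T hST ⟨ε, hε, κ, hκ, hT⟩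
      exact ⟨ε, hε, κ, hκ, fun θ hθ => hT θ (hST hθ)⟩
    · rintro S T ⟨ε, hε, κ, hκ, hS⟩ ⟨ε', hε', κ', hκ', hT⟩
      refine ⟨min ε ε', lt_min hε hε', min κ κ', lt_min hκ hκ', ?_⟩
      rintro θ (hθ | hθ)
      · obtain ⟨v, hv, h⟩ := hS θ hθ
        exact ⟨v, hv, fun x hx hxθ u hu => h x hx (hxθ.trans_le (min_le_left _ _)) u
          (Metric.closedBall_subset_closedBall (min_le_left _ _) hu)⟩
      · obtain ⟨v, hv, h⟩ := hT θ hθ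
        exact ⟨v, hv, fun x hx hxθ u hu => h x hx (hxθ.trans_le (min_le_right _ _)) u
          (Metric.closedBall_subset_closedBall (min_le_right _ _) hu)⟩
    · intro θ hθ
      obtain ⟨ε, hε, κ, hκ, v, hv, h⟩ := hloc θ hθ.1 (by simpa using hθ.2)
      refine ⟨Metric.ball θ (ε / 2), mem_nhdsWithin_of_mem_nhds
        (Metric.ball_mem_nhds _ (by positivity)), ε / 2, by positivity, κ, hκ,
        fun θ' hθ' => ⟨v, hv, fun x hx hxθ => h x hx ?_⟩⟩
      rw [Metric.mem_ball, dist_eq_norm] at hθ'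
      calc ‖x - θ‖ = ‖(x - θ') + (θ' - θ)‖ := by rw [sub_add_sub_cancel]
        _ ≤ ‖x - θ'‖ + ‖θ' - θ‖ := norm_add_le _ _
        _ < ε := by linarith
  obtain ⟨ε, hε, κ, hκ, hunif⟩ := hunif
  -- the unit vector of `w`
  have hunit : ∀ w ∈ K, w ≠ 0 → ‖w‖⁻¹ • w ∈ K ∩ Metric.sphere (0 : Euc d) 1 := by
    intro w hw hw0
    refine ⟨hcone w hw _ (inv_pos.2 (norm_pos_iff.2 hw0)), ?_⟩
    rw [mem_sphere_zero_iff_norm, norm_smul, norm_inv, norm_norm,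
      inv_mul_cancel₀ (norm_ne_zero_iff.2 hw0)]
  have hscale : ∀ (θ v : Euc d), (∀ x ∈ K, ‖x - θ‖ < ε → ∀ u ∈ Metric.closedBall v κ,
      ∀ t ≥ (0 : ℝ), x + t • u ∈ K) → ∀ w ∈ K, w ≠ 0 → ‖‖w‖⁻¹ • w - θ‖ < ε →
      ∀ s > (0 : ℝ), ∀ u ∈ Metric.closedBall v κ, ∀ t ≥ (0 : ℝ), s • w + t • u ∈ K := by
    intro θ v h w hw hw0 hwθ s hs u hu t ht
    have hwn : 0 < ‖w‖ := norm_pos_iff.2 hw0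
    have h1 := h _ (hunit w hw hw0).1 hwθ u hu (t / (s * ‖w‖)) (by positivity)
    have h2 := hcone _ h1 (s * ‖w‖) (by positivity)
    convert h2 using 1
    rw [smul_add, smul_smul, smul_smul]
    congr 2
    · field_simp
    · field_simp
  set τ : ℝ := min (1 / 2) (ε ^ 2 / 8) with hτ
  have hτ0 : 0 < τ := by positivity
  have hτ1 : τ ≤ 1 / 2 := min_le_left _ _
  have hτ2 : τ ≤ ε ^ 2 / 8 := min_le_right _ _
  have hτκ : 0 < τ * κ := mul_pos hτ0 hκ
  set ρ := (τ * κ) / (4 * (1 + 3 + τ * κ)) with hρ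
  have hρle : ∀ v : Euc d, ‖v‖ ≤ 3 → ρ ≤ (τ * κ) / (4 * (1 + ‖v‖ + τ * κ)) := by
    intro v hv
    rw [hρ]; gcongr
  -- moving radially from `w` away from `w'`
  have hrad : ∀ w ∈ K, w ≠ 0 → ∀ w', 2 * τ * ‖w - w'‖ ≤ inner ℝ (‖w‖⁻¹ • w) (w - w') →
      ∀ δ, PairCone K w' w ρ δ := by
    intro w hw hw0 w' hin δ
    obtain ⟨v, hv, h⟩ := hunif _ (hunit w hw hw0)
    have hK' := hscale _ v h w hw hw0 (by simpa using hε)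
    refine (pairCone_radial hκ hτ0 hw0 hv hK' hin).mono (hρle _ ?_) le_rfl
    refine (norm_add_le _ _).trans ?_
    have h1 : ‖‖w‖⁻¹ • w‖ = 1 := by simpa using (hunit w hw hw0).2
    rw [h1, norm_smul, Real.norm_of_nonneg hτ0.le]
    nlinarith
  have hzero : ∀ w ∈ K, w ≠ 0 → ∀ δ, PairCone K 0 w ρ δ := by
    intro w hw hw0 δ
    refine hrad w hw hw0 0 ?_ δ
    have hwn : 0 < ‖w‖ := norm_pos_iff.2 hw0
    rw [sub_zero, real_inner_smul_left, real_inner_self_eq_norm_sq, sq, ← mul_assoc,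
      inv_mul_cancel₀ hwn.ne', one_mul]
    nlinarith
  refine ⟨ρ, by positivity, ?_, fun x hx y hy δ => ?_⟩
  · rw [hρ, div_le_one (by positivity)]; linarith
  rcases eq_or_ne x 0 with rfl | hx0
  · rcases eq_or_ne y 0 with rfl | hy0
    · -- at the apex the cone of directions itself belongs to `K`, as `K` is closed
      left
      obtain ⟨w, hw, hw0⟩ := hne
      obtain ⟨v, hv, h⟩ := hunif _ (hunit w hw hw0)
      have hK' := hscale _ v h w hw hw0 (by simpa using hε)
      refine (pairCone_of_inner_nonneg (v := v) hτκ (fun u hu t ht => ?_) (by simp)).mono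
        (hρle v (by linarith)) le_rfl
      have hu' : u ∈ Metric.closedBall v κ :=
        Metric.closedBall_subset_closedBall (by nlinarith) hu
      have hlim : Tendsto (fun s : ℝ => s • w + t • u) (𝓝[>] 0) (𝓝 (0 + t • u)) := by
        have : Continuous fun s : ℝ => s • w + t • u := by fun_prop
        have h0 := this.tendsto 0
        rw [zero_smul] at h0
        exact h0.mono_left nhdsWithin_le_nhds
      refine hK.mem_of_tendsto hlim ?_
      filter_upwards [self_mem_nhdsWithin] with s hs
      exact hK' s hs u hu' t ht.1
    · exact Or.inl (hzero y hy hy0 δ)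
  · rcases eq_or_ne y 0 with rfl | hy0
    · exact Or.inr (hzero x hx hx0 δ)
    set a := ‖x‖⁻¹ • x with ha
    set b := ‖y‖⁻¹ • y with hb
    have han : ‖a‖ = 1 := by simpa using (hunit x hx hx0).2
    have hbn : ‖b‖ = 1 := by simpa using (hunit y hy hy0).2
    rcases lt_or_ge ‖a - b‖ ε with hab | hab
    · -- nearby directions: a common cone
      obtain ⟨v, hv, h⟩ := hunif _ (hunit y hy hy0)
      have hKx := hscale _ v h x hx hx0 hab
      have hKy := hscale _ v h y hy hy0 (by simpa using hε)
      have hsub : ∀ u ∈ Metric.closedBall v (τ * κ), u ∈ Metric.closedBall v κ := fun u hu =>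
        Metric.closedBall_subset_closedBall (by nlinarith) hu
      rcases le_total 0 (inner ℝ v (y - x)) with hi | hi
      · refine Or.inl ((pairCone_of_inner_nonneg hτκ (fun u hu t ht => ?_) hi).mono
          (hρle v (by linarith)) le_rfl)
        simpa using hKy 1 one_pos u (hsub u hu) t ht.1
      · refine Or.inr ((pairCone_of_inner_nonneg (v := v) hτκ (fun u hu t ht => ?_) ?_).mono
          (hρle v (by linarith)) le_rfl)
        · simpa using hKx 1 one_pos u (hsub u hu) t ht.1
        · rw [← neg_sub, inner_neg_right]; linarith
    · -- separated directions: one of the two radial directions leads away from the other point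
      have hxa : x = ‖x‖ • a := by
        rw [ha, smul_smul, mul_inv_cancel₀ (norm_ne_zero_iff.2 hx0), one_smul]
      have hyb : y = ‖y‖ • b := by
        rw [hb, smul_smul, mul_inv_cancel₀ (norm_ne_zero_iff.2 hy0), one_smul]
      have hsum : inner ℝ b (y - x) + inner ℝ a (x - y)
          = (‖x‖ + ‖y‖) * (1 - inner ℝ a b) := by
        have h1 : inner ℝ b y = ‖y‖ := by
          nth_rewrite 1 [hyb]
          rw [real_inner_smul_right, real_inner_self_eq_norm_sq, hbn]; ring
        have h2 : inner ℝ a x = ‖x‖ := by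
          nth_rewrite 1 [hxa]
          rw [real_inner_smul_right, real_inner_self_eq_norm_sq, han]; ring
        have h3 : inner ℝ b x = ‖x‖ * inner ℝ a b := by
          nth_rewrite 1 [hxa]
          rw [real_inner_smul_right, real_inner_comm]
        have h4 : inner ℝ a y = ‖y‖ * inner ℝ a b := by
          nth_rewrite 1 [hyb]
          rw [real_inner_smul_right]
        rw [inner_sub_right, inner_sub_right, h1, h2, h3, h4]; ring
      have hinner : ε ^ 2 / 2 ≤ 1 - inner ℝ a b := by
        have h1 := norm_sub_sq_real a b
        rw [han, hbn] at h1
        have h2 : ε ^ 2 ≤ ‖a - b‖ ^ 2 := pow_le_pow_left₀ hε.le hab 2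
        linarith
      have hdist : ‖y - x‖ ≤ ‖x‖ + ‖y‖ := (norm_sub_le y x).trans (by linarith)
      have hbig : 4 * τ * ‖y - x‖ ≤ inner ℝ b (y - x) + inner ℝ a (x - y) := by
        rw [hsum]
        calc 4 * τ * ‖y - x‖ ≤ ε ^ 2 / 2 * (‖x‖ + ‖y‖) := by
              apply mul_le_mul _ hdist (norm_nonneg _) (by positivity)
              linarith
          _ ≤ _ := by rw [mul_comm]; gcongr
      rcases le_total (inner ℝ a (x - y)) (inner ℝ b (y - x)) with hle | hle
      · exact Or.inl (hrad y hy hy0 x (by linarith) δ)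
      · refine Or.inr (hrad x hx hx0 y ?_ δ)
        rw [norm_sub_rev x y]; linarith

/-- The cone condition for pairs passes from a cone to a set that coincides with the cone near
its apex. -/
lemma hasLocalCones_of_eq_cone {A K : Set (Euc d)} {x₀ : Euc d} {δ : ℝ} (hδ : 0 < δ)
    (hAK : ∀ w, ‖w‖ < δ → (x₀ + w ∈ A ↔ w ∈ K))
    {ρ : ℝ} (hρ : 0 < ρ) (hρ1 : ρ ≤ 1)
    (hK : ∀ x ∈ K, ∀ y ∈ K, ∀ δ, PairCone K x y ρ δ ∨ PairCone K y x ρ δ) :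
    HasLocalCones A x₀ := by
  have key : ∀ x y : Euc d, ‖y - x₀‖ < δ / 8 → PairCone K (x - x₀) (y - x₀) ρ (δ / 8) →
      PairCone A x y ρ (δ / 8) := by
    rintro x y hy ⟨p, hp, h⟩
    refine ⟨p, hp, fun u hu => ⟨fun t ht => ?_, by simpa using (h u hu).2⟩⟩
    have h1 := (h u hu).1 t ht
    have hun : ‖u‖ ≤ 2 := by
      rw [Metric.mem_closedBall, dist_eq_norm] at hu
      calc ‖u‖ = ‖(u - p) + p‖ := by rw [sub_add_cancel]
        _ ≤ ‖u - p‖ + ‖p‖ := norm_add_le _ _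
        _ ≤ 2 := by linarith
    have h2 : ‖y - x₀ + t • u‖ < δ := by
      calc ‖y - x₀ + t • u‖ ≤ ‖y - x₀‖ + ‖t • u‖ := norm_add_le _ _
        _ ≤ ‖y - x₀‖ + δ / 8 * 2 := by
          rw [norm_smul, Real.norm_of_nonneg ht.1]
          gcongr
          exact ht.2
        _ < δ := by linarith
    have h3 := (hAK _ h2).2 h1
    rwa [← add_assoc, add_sub_cancel] at h3
  refine ⟨ρ, hρ, δ / 8, by positivity, fun x hx y hy => ?_⟩
  have hmem : ∀ z ∈ A ∩ Metric.ball x₀ (δ / 8), ‖z - x₀‖ < δ / 8 ∧ z - x₀ ∈ K := by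
    intro z hz
    have h1 : ‖z - x₀‖ < δ / 8 := by rw [← dist_eq_norm]; exact hz.2
    exact ⟨h1, (hAK _ (by linarith)).1 (by rw [add_sub_cancel]; exact hz.1)⟩
  exact (hK _ (hmem x hx).2 _ (hmem y hy).2 (δ / 8)).imp (key x y (hmem y hy).1)
    (key y x (hmem x hx).1)

end PlanarCones

/-! ### Polygonal boundaries as cones -/

section Polygon

/-- A preconnected set that meets `s` but not the boundary of `s` is contained in `s`. -/
lemma IsPreconnected.subset_of_disjoint_frontier {X : Type*} [TopologicalSpace X] {s t : Set X}
    (ht : IsPreconnected t) (hd : ∀ x ∈ t, x ∉ frontier s) (hne : (t ∩ s).Nonempty) : t ⊆ s := by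
  have hcov : t ⊆ interior s ∪ (closure s)ᶜ := fun x hx => by
    by_cases hi : x ∈ interior s
    · exact Or.inl hi
    · exact Or.inr fun hc => hd x hx ⟨hc, hi⟩
  refine (ht.subset_left_of_subset_union isOpen_interior isClosed_closure.isOpen_compl ?_ hcov
    ?_).trans interior_subset
  · exact disjoint_compl_right.mono_left (interior_subset.trans subset_closure)
  · obtain ⟨x, hx, hxs⟩ := hne
    refine ⟨x, hx, (hcov hx).resolve_right fun h => h (subset_closure hxs)⟩

variable {d : ℕ}

lemma isClosed_segment_euc (p q : Euc d) : IsClosed (segment ℝ p q) := by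
  rw [segment_eq_image']
  exact (isCompact_Icc.image (by fun_prop)).isClosed

/-- Near one of its points, a finite union of segments is a union of finitely many rays. -/
lemma exists_rays_of_segments {F : Set (Euc d)} {s : Finset (Euc d × Euc d)}
    (hF : F = ⋃ p ∈ s, segment ℝ p.1 p.2) (x₀ : Euc d) :
    ∃ V : Finset (Euc d), ∃ δ > 0, ∀ w, ‖w‖ < δ →
      (x₀ + w ∈ F ↔ ∃ v ∈ V, ∃ t ≥ (0 : ℝ), w = t • v) := by
  classical
  set s₀ := s.filter fun p => x₀ ∈ segment ℝ p.1 p.2 with hs₀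
  set V : Finset (Euc d) := s₀.image (fun p => p.1 - x₀) ∪ s₀.image (fun p => p.2 - x₀) with hV
  have h1 : ∀ᶠ δ in 𝓝[>] (0 : ℝ), ∀ p ∈ s, x₀ ∉ segment ℝ p.1 p.2 →
      Metric.ball x₀ δ ⊆ (segment ℝ p.1 p.2)ᶜ := by
    refine (Finset.eventually_all s).2 fun p _ => ?_
    by_cases hx : x₀ ∈ segment ℝ p.1 p.2
    · exact Eventually.of_forall fun δ h => absurd hx h
    · obtain ⟨δ₀, hδ₀, hb⟩ := Metric.isOpen_iff.1 (isClosed_segment_euc p.1 p.2).isOpen_compl x₀ hx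
      filter_upwards [Ioo_mem_nhdsGT hδ₀] with δ hδ _
      exact (Metric.ball_subset_ball hδ.2.le).trans hb
  have h2 : ∀ᶠ δ in 𝓝[>] (0 : ℝ), ∀ v ∈ V, v ≠ 0 → δ < ‖v‖ := by
    refine (Finset.eventually_all V).2 fun v _ => ?_
    by_cases hv : v = 0
    · exact Eventually.of_forall fun δ h => absurd hv h
    · filter_upwards [Ioo_mem_nhdsGT (norm_pos_iff.2 hv)] with δ hδ _ using hδ.2
  obtain ⟨δ, ⟨hδ1, hδ2⟩, hδ⟩ := ((h1.and h2).and self_mem_nhdsWithin).exists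
  refine ⟨V, δ, hδ, fun w hw => ⟨fun hmem => ?_, ?_⟩⟩
  · rw [hF] at hmem
    simp only [mem_iUnion, exists_prop] at hmem
    obtain ⟨p, hp, hwp⟩ := hmem
    have hx₀ : x₀ ∈ segment ℝ p.1 p.2 := by
      by_contra hx
      exact hδ1 p hp hx (by simpa using hw) hwp
    have hps : p ∈ s₀ := Finset.mem_filter.2 ⟨hp, hx₀⟩
    rw [segment_eq_image'] at hx₀ hwp
    obtain ⟨a, ha, hxa⟩ := hx₀
    obtain ⟨b, hb, hxb⟩ := hwp
    simp only at hxa hxb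
    have hwab : w = (b - a) • (p.2 - p.1) := by
      rw [sub_smul, ← add_sub_cancel_left x₀ w, ← hxb, ← hxa]; abel
    have hp2 : p.2 - x₀ = (1 - a) • (p.2 - p.1) := by
      rw [← hxa]; module
    have hp1 : p.1 - x₀ = (-a) • (p.2 - p.1) := by
      rw [← hxa]; module
    rcases le_or_gt a b with hab | hab
    · refine ⟨p.2 - x₀, Finset.mem_union_right _ (Finset.mem_image_of_mem _ hps),
        (b - a) / (1 - a), div_nonneg (by linarith) (by linarith [ha.2]), ?_⟩
      rw [hp2, smul_smul, hwab]
      rcases ha.2.eq_or_lt with h | h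
      · have : b - a = 0 := by linarith [hb.2]
        simp [this]
      · rw [div_mul_cancel₀ _ (by linarith)]
    · refine ⟨p.1 - x₀, Finset.mem_union_left _ (Finset.mem_image_of_mem _ hps),
        (a - b) / a, div_nonneg (by linarith) ha.1, ?_⟩
      have ha0 : a ≠ 0 := by linarith [hb.1]
      rw [hp1, smul_smul, hwab]
      congr 1
      field_simp
      ring
  · rintro ⟨v, hv, t, ht, rfl⟩
    have hend : ∃ p ∈ s, x₀ ∈ segment ℝ p.1 p.2 ∧ x₀ + v ∈ segment ℝ p.1 p.2 := by
      rcases Finset.mem_union.1 hv with h | h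
      · obtain ⟨p, hp, rfl⟩ := Finset.mem_image.1 h
        have hp' := Finset.mem_filter.1 hp
        exact ⟨p, hp'.1, hp'.2, by rw [add_sub_cancel]; exact left_mem_segment _ _ _⟩
      · obtain ⟨p, hp, rfl⟩ := Finset.mem_image.1 h
        have hp' := Finset.mem_filter.1 hp
        exact ⟨p, hp'.1, hp'.2, by rw [add_sub_cancel]; exact right_mem_segment _ _ _⟩
    obtain ⟨p, hp, hx₀, hxv⟩ := hend
    rw [hF]
    simp only [mem_iUnion, exists_prop]
    refine ⟨p, hp, ?_⟩
    rcases eq_or_ne v 0 with rfl | hv0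
    · simpa using hx₀
    have ht1 : t ≤ 1 := by
      have h3 := hδ2 v hv hv0
      rw [norm_smul, Real.norm_of_nonneg ht] at hw
      have h4 : 0 < ‖v‖ := norm_pos_iff.2 hv0
      by_contra hcon
      push Not at hcon
      nlinarith
    have := (convex_segment p.1 p.2).add_smul_sub_mem hx₀ hxv ⟨ht, ht1⟩
    simpa using this

/-- A closed set whose boundary is, near `x₀`, a union of finitely many rays coincides near `x₀`
with a closed cone whose boundary lies in these rays. -/
lemma exists_cone_of_rays {A : Set (Euc d)} (hA : IsClosed A) {x₀ : Euc d}
    {V : Finset (Euc d)} {δ : ℝ} (hδ : 0 < δ)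
    (hV : ∀ w, ‖w‖ < δ → (x₀ + w ∈ frontier A ↔ ∃ v ∈ V, ∃ t ≥ (0 : ℝ), w = t • v)) :
    ∃ K : Set (Euc d), IsClosed K ∧ (∀ w ∈ K, ∀ t > (0 : ℝ), t • w ∈ K) ∧
      (∀ w ∈ frontier K, ∃ v ∈ V, ∃ t ≥ (0 : ℝ), w = t • v) ∧
      ∀ w, ‖w‖ < δ → (x₀ + w ∈ A ↔ w ∈ K) := by
  -- `A` is conical near `x₀`, since a radial segment that meets the boundary lies in it
  have hconic : ∀ w, ‖w‖ < δ → x₀ + w ∈ A → ∀ t > (0 : ℝ), ‖t • w‖ < δ → x₀ + t • w ∈ A := by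
    intro w hw hwA t ht htw
    by_contra hcon
    have hnorm : ∀ τ ∈ uIcc 1 t, 0 < τ ∧ ‖τ • w‖ < δ := by
      intro τ hτ
      have hτ0 : 0 < τ := lt_of_lt_of_le (lt_min one_pos ht) hτ.1
      refine ⟨hτ0, ?_⟩
      rw [norm_smul, Real.norm_of_nonneg hτ0.le]
      rw [norm_smul, Real.norm_of_nonneg ht.le] at htw
      rcases le_max_iff.1 hτ.2 with h | h
      · nlinarith [norm_nonneg w]
      · nlinarith [norm_nonneg w]
    have hpre : IsPreconnected ((fun τ : ℝ => x₀ + τ • w) '' uIcc 1 t) :=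
      isPreconnected_uIcc.image _ (by fun_prop)
    have hfr : ∃ τ ∈ uIcc 1 t, x₀ + τ • w ∈ frontier A := by
      by_contra hno
      push Not at hno
      refine hcon (hpre.subset_of_disjoint_frontier (s := A) ?_ ?_ ⟨t, right_mem_uIcc, rfl⟩)
      · rintro _ ⟨τ, hτ, rfl⟩; exact hno τ hτ
      · exact ⟨x₀ + w, ⟨1, left_mem_uIcc, by simp⟩, hwA⟩
    obtain ⟨τ, hτ, hτF⟩ := hfr
    obtain ⟨hτ0, hτn⟩ := hnorm τ hτ
    obtain ⟨v, hv, b, hb, hbe⟩ := (hV _ hτn).1 hτF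
    refine hcon (hA.frontier_subset ((hV _ htw).2 ⟨v, hv, t / τ * b, by positivity, ?_⟩))
    rw [← smul_smul, ← hbe, smul_smul, div_mul_cancel₀ _ hτ0.ne']
  -- a radial contraction of the space into the ball of radius `δ`
  set c : Euc d → ℝ := fun w => δ / (2 * (1 + ‖w‖)) with hc
  have hc0 : ∀ w, 0 < c w := fun w => by simp only [hc]; positivity
  have hcn : ∀ w, ‖c w • w‖ < δ := by
    intro w
    rw [norm_smul, Real.norm_of_nonneg (hc0 w).le]
    simp only [hc]
    rw [div_mul_eq_mul_div, div_lt_iff₀ (by positivity)]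
    nlinarith [norm_nonneg w]
  have hgc : Continuous fun w => x₀ + c w • w := by
    have : Continuous c := by
      refine continuous_const.div (by fun_prop) fun w => ?_
      positivity
    fun_prop
  refine ⟨(fun w => x₀ + c w • w) ⁻¹' A, hA.preimage hgc, ?_, ?_, ?_⟩
  · intro w hw t ht
    have h1 := hconic (c w • w) (hcn w) hw (c (t • w) * t / c w)
      (by have := hc0 (t • w); have := hc0 w; positivity)
    have h2 : (c (t • w) * t / c w) • c w • w = c (t • w) • t • w := by
      rw [smul_smul, smul_smul, div_mul_cancel₀ _ (hc0 w).ne']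
    rw [h2] at h1
    exact h1 (hcn _)
  · intro w hw
    have h1 := hgc.frontier_preimage_subset A hw
    obtain ⟨v, hv, t, ht, he⟩ := (hV _ (hcn w)).1 h1
    refine ⟨v, hv, (c w)⁻¹ * t, mul_nonneg (inv_nonneg.2 (hc0 w).le) ht, ?_⟩
    rw [← smul_smul, ← he, smul_smul, inv_mul_cancel₀ (hc0 w).ne', one_smul]
  · intro w hw
    constructor
    · intro h
      exact hconic w hw h _ (hc0 w) (hcn w)
    · intro h
      have h1 := hconic (c w • w) (hcn w) h (c w)⁻¹ (inv_pos.2 (hc0 w))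
      rw [smul_smul, inv_mul_cancel₀ (hc0 w).ne', one_smul] at h1
      exact h1 hw

/-- In coordinates `a`, `b` along `θ` and orthogonal to it: if the thin sector `0 < b < ε a` lies
in `K` and the opposite sector is not crossed by the boundary of `K`, then near `θ` the set `K` is
invariant under a cone of directions that point into the first sector. -/
lemma cone_invariant_of_sector {K : Set (Euc d)}
    (hcone : ∀ w ∈ K, ∀ t > (0 : ℝ), t • w ∈ K) {θ m : Euc d} (hθ : θ ∈ K)
    (hθ1 : ‖θ‖ = 1) (hm1 : ‖m‖ = 1) (hθm : inner ℝ θ m = 0)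
    (hdec : ∀ w : Euc d, w = inner ℝ θ w • θ + inner ℝ m w • m)
    {ε : ℝ} (hε : 0 < ε) (hε1 : ε ≤ 1)
    (hpos : ∀ w, 0 < inner ℝ m w → inner ℝ m w < ε * inner ℝ θ w → w ∈ K)
    (hneg : (∃ w ∈ K, inner ℝ m w < 0 ∧ -inner ℝ m w < ε * inner ℝ θ w) →
      ∀ w, inner ℝ m w < 0 → -inner ℝ m w < ε * inner ℝ θ w → w ∈ K) :
    ∃ ε > 0, ∃ κ > 0, ∃ v : Euc d, ‖v‖ ≤ 2 ∧
      ∀ x ∈ K, ‖x - θ‖ < ε → ∀ u ∈ Metric.closedBall v κ, ∀ t ≥ (0 : ℝ), x + t • u ∈ K := by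
  have hθθ : inner ℝ θ θ = 1 := by rw [real_inner_self_eq_norm_sq, hθ1]; norm_num
  have hmm : inner ℝ m m = 1 := by rw [real_inner_self_eq_norm_sq, hm1]; norm_num
  have hmθ : inner ℝ m θ = 0 := by rw [real_inner_comm]; exact hθm
  refine ⟨ε / 4, by positivity, ε / 8, by positivity, θ + (ε / 2) • m, ?_, ?_⟩
  · refine (norm_add_le _ _).trans ?_
    rw [norm_smul, Real.norm_of_nonneg (by positivity), hθ1, hm1]; linarith
  intro x hx hxθ u hu t ht
  rcases ht.eq_or_lt with h0 | htpos
  · rw [← h0, zero_smul, add_zero]; exact hx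
  -- coordinates of `u` and `x`
  have hau : |inner ℝ θ u - 1| ≤ ε / 8 := by
    have h1 := abs_real_inner_le_norm θ (u - (θ + (ε / 2) • m))
    rw [inner_sub_right, inner_add_right, real_inner_smul_right, hθθ, hθm, hθ1, mul_zero, add_zero,
      one_mul, ← dist_eq_norm] at h1
    exact h1.trans hu
  have hbu : |inner ℝ m u - ε / 2| ≤ ε / 8 := by
    have h1 := abs_real_inner_le_norm m (u - (θ + (ε / 2) • m))
    rw [inner_sub_right, inner_add_right, real_inner_smul_right, hmm, hmθ, hm1, mul_one, zero_add,
      one_mul, ← dist_eq_norm] at h1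
    exact h1.trans hu
  have hax : |inner ℝ θ x - 1| < ε / 4 := by
    have h1 := abs_real_inner_le_norm θ (x - θ)
    rw [inner_sub_right, hθθ, hθ1, one_mul] at h1
    exact h1.trans_lt hxθ
  have hbx : |inner ℝ m x| < ε / 4 := by
    have h1 := abs_real_inner_le_norm m (x - θ)
    rw [inner_sub_right, hmθ, hm1, sub_zero, one_mul] at h1
    exact h1.trans_lt hxθ
  rw [abs_le] at hau hbu
  rw [abs_lt] at hax hbx
  have ha : inner ℝ θ (x + t • u) = inner ℝ θ x + t * inner ℝ θ u := by
    rw [inner_add_right, real_inner_smul_right]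
  have hb : inner ℝ m (x + t • u) = inner ℝ m x + t * inner ℝ m u := by
    rw [inner_add_right, real_inner_smul_right]
  have hxN : inner ℝ m x < ε * inner ℝ θ x ∧ -inner ℝ m x < ε * inner ℝ θ x := by
    constructor <;> nlinarith
  have huN : 0 < inner ℝ m u ∧ inner ℝ m u < ε * inner ℝ θ u := by
    constructor <;> nlinarith
  have htb : 0 < t * inner ℝ m u := mul_pos htpos huN.1
  have htN : t * inner ℝ m u < ε * (t * inner ℝ θ u) := by nlinarith
  rcases lt_trichotomy (inner ℝ m (x + t • u)) 0 with h | h | h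
  · refine hneg ⟨x, hx, by linarith, hxN.2⟩ _ h ?_
    rw [ha, hb]; linarith
  · rw [hdec (x + t • u), h, zero_smul, add_zero]
    refine hcone θ hθ _ ?_
    rw [ha]
    have h1 : 0 < inner ℝ θ x := by linarith
    have h2 : 0 < inner ℝ θ u := by linarith
    positivity
  · refine hpos _ h ?_
    rw [ha, hb]; linarith

end Polygon

/-! ### Planar polygons -/

section PlanarPolygons

lemma exists_orthogonal_unit {θ : Euc 2} (hθ : ‖θ‖ = 1) :
    ∃ m : Euc 2, ‖m‖ = 1 ∧ inner ℝ θ m = 0 ∧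
      ∀ w : Euc 2, w = inner ℝ θ w • θ + inner ℝ m w • m := by
  have h : θ 0 * θ 0 + θ 1 * θ 1 = 1 := by
    have := real_inner_self_eq_norm_sq θ
    rw [hθ, PiLp.inner_apply, Fin.sum_univ_two] at this
    simpa [sq] using this
  refine ⟨!₂[-θ 1, θ 0], ?_, ?_, fun w => ?_⟩
  · have h1 := real_inner_self_eq_norm_sq (!₂[-θ 1, θ 0] : Euc 2)
    rw [PiLp.inner_apply, Fin.sum_univ_two] at h1
    simp only [Matrix.cons_val_zero, Matrix.cons_val_one, RCLike.inner_apply,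
      conj_trivial] at h1
    have h2 : ‖(!₂[-θ 1, θ 0] : Euc 2)‖ ^ 2 = 1 := by rw [← h1]; linarith
    exact (pow_eq_one_iff_of_nonneg (norm_nonneg _) two_ne_zero).1 h2
  · rw [PiLp.inner_apply, Fin.sum_univ_two]
    simp
    ring
  · ext i
    have e1 : inner ℝ θ w = w 0 * θ 0 + w 1 * θ 1 := by
      rw [PiLp.inner_apply, Fin.sum_univ_two]; simp
    have e2 : inner ℝ (!₂[-θ 1, θ 0] : Euc 2) w = - w 0 * θ 1 + w 1 * θ 0 := by
      rw [PiLp.inner_apply, Fin.sum_univ_two]; simp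
    rw [e1, e2]
    fin_cases i
    · simp
      linear_combination (-w 0) * h
    · simp
      linear_combination (-w 1) * h

variable {d : ℕ}

lemma isPreconnected_sector (θ m : Euc d) (ε : ℝ) :
    IsPreconnected {w : Euc d | 0 < inner ℝ m w ∧ inner ℝ m w < ε * inner ℝ θ w} := by
  have h1 := convex_halfSpace_gt (innerSL ℝ m).toLinearMap.isLinear 0
  have h2 := convex_halfSpace_gt (innerSL ℝ (ε • θ - m)).toLinearMap.isLinear 0
  convert (h1.inter h2).isPreconnected using 1
  ext w
  simp

lemma addHaar_inner_eq_zero {m : Euc d} (hm : m ≠ 0) (x₀ : Euc d) :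
    volume {x : Euc d | inner ℝ m (x - x₀) = 0} = 0 := by
  have h : {x : Euc d | inner ℝ m (x - x₀) = 0} =
      (fun x => x + -x₀) ⁻¹' (((innerSL ℝ m).toLinearMap.ker : Submodule ℝ (Euc d)) : Set (Euc d)) := by
    ext x
    simp [sub_eq_add_neg]
  rw [h, measure_preimage_add_right]
  refine Measure.addHaar_submodule _ _ fun htop => hm ?_
  have : m ∈ ((innerSL ℝ m).toLinearMap.ker : Submodule ℝ (Euc d)) := htop ▸ Submodule.mem_top
  simpa using this

/-- A planar closed set with polygonal boundary, every part of which has positive area, satisfies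
the local cone condition. The area hypothesis excludes isolated segments and points. -/
lemma HasPolygonalBoundary.hasLocalCones {A : Set (Euc 2)} (hA : IsClosed A)
    (hreg : ∀ z ∈ A, ∀ U ∈ 𝓝 z, volume (A ∩ U) ≠ 0) (hp : HasPolygonalBoundary A)
    {x₀ : Euc 2} (hx₀ : x₀ ∈ A) : HasLocalCones A x₀ := by
  obtain ⟨s, hs⟩ := hp
  obtain ⟨V, δ, hδ, hV⟩ := exists_rays_of_segments hs x₀
  obtain ⟨K, hK, hcone, hfr, hAK⟩ := exists_cone_of_rays hA hδ hV
  have hne : ∃ w ∈ K, w ≠ 0 := by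
    by_contra hno
    push Not at hno
    refine hreg x₀ hx₀ _ (Metric.ball_mem_nhds x₀ hδ)
      (measure_mono_null (fun x hx => ?_) (measure_singleton x₀))
    have hw : ‖x - x₀‖ < δ := by simpa [dist_eq_norm] using hx.2
    have := hno _ ((hAK _ hw).1 (by rw [add_sub_cancel]; exact hx.1))
    exact sub_eq_zero.1 this
  suffices hloc : ∀ θ ∈ K, ‖θ‖ = 1 → ∃ ε > 0, ∃ κ > 0, ∃ v : Euc 2, ‖v‖ ≤ 2 ∧
      ∀ x ∈ K, ‖x - θ‖ < ε → ∀ u ∈ Metric.closedBall v κ, ∀ t ≥ (0 : ℝ), x + t • u ∈ K by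
    obtain ⟨ρ, hρ, hρ1, hpair⟩ := exists_pairCone_of_cone hK hcone hne hloc
    exact hasLocalCones_of_eq_cone hδ hAK hρ hρ1 hpair
  intro θ hθ hθ1
  obtain ⟨m, hm1, hθm, hdec⟩ := exists_orthogonal_unit hθ1
  -- a sector around `θ` so thin that the boundary of `K` meets it at most in the axis
  have hev : ∀ᶠ ε in 𝓝[>] (0 : ℝ), ∀ v ∈ V, inner ℝ m v ≠ 0 →
      ε * inner ℝ θ v < |inner ℝ m v| := by
    refine (Finset.eventually_all V).2 fun v _ => ?_
    by_cases hv : inner ℝ m v = 0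
    · exact Eventually.of_forall fun ε h => absurd hv h
    · have ht : Tendsto (fun ε : ℝ => ε * inner ℝ θ v) (𝓝[>] 0) (𝓝 0) := by
        have : Tendsto (fun ε : ℝ => ε * inner ℝ θ v) (𝓝 0) (𝓝 (0 * inner ℝ θ v)) :=
          (continuous_id.mul continuous_const).tendsto 0
        rw [zero_mul] at this
        exact this.mono_left nhdsWithin_le_nhds
      filter_upwards [ht.eventually_lt_const (abs_pos.2 hv)] with ε hε _ using hε
  obtain ⟨ε, hεV, hε0, hε1⟩ := (hev.and (Ioo_mem_nhdsGT one_pos)).exists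
  have hfree : ∀ w ∈ frontier K, inner ℝ m w ≠ 0 → ε * inner ℝ θ w ≤ |inner ℝ m w| := by
    intro w hw hmw
    obtain ⟨v, hv, t, ht, rfl⟩ := hfr w hw
    rw [real_inner_smul_right] at hmw
    have := hεV v hv (right_ne_zero_of_mul hmw)
    rw [real_inner_smul_right, real_inner_smul_right, abs_mul, abs_of_nonneg ht]
    nlinarith
  have hsec : ∀ m' : Euc 2, (m' = m ∨ m' = -m) →
      (∃ w ∈ K, 0 < inner ℝ m' w ∧ inner ℝ m' w < ε * inner ℝ θ w) →
      ∀ w, 0 < inner ℝ m' w → inner ℝ m' w < ε * inner ℝ θ w → w ∈ K := by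
    rintro m' hm' ⟨w', hw', h1, h2⟩ w h3 h4
    refine (isPreconnected_sector θ m' ε).subset_of_disjoint_frontier (s := K) ?_
      ⟨w', ⟨h1, h2⟩, hw'⟩ ⟨h3, h4⟩
    rintro x ⟨hx1, hx2⟩ hx
    have habs : |inner ℝ m x| = inner ℝ m' x := by
      rcases hm' with rfl | rfl
      · exact abs_of_pos hx1
      · rw [inner_neg_left] at hx1 ⊢
        exact abs_of_neg (by linarith)
    have := hfree x hx (by rw [← abs_pos, habs]; exact hx1)
    linarith
  by_cases hp1 : ∃ w ∈ K, 0 < inner ℝ m w ∧ inner ℝ m w < ε * inner ℝ θ w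
  · refine cone_invariant_of_sector hcone hθ hθ1 hm1 hθm hdec hε0 hε1.le
      (hsec m (Or.inl rfl) hp1) fun ⟨w, hw, h1, h2⟩ => ?_
    have := hsec (-m) (Or.inr rfl) ⟨w, hw, by rw [inner_neg_left]; linarith,
      by rw [inner_neg_left]; exact h2⟩
    simp only [inner_neg_left, Left.neg_pos_iff] at this
    exact this
  by_cases hp2 : ∃ w ∈ K, 0 < inner ℝ (-m) w ∧ inner ℝ (-m) w < ε * inner ℝ θ w
  · refine cone_invariant_of_sector (m := -m) hcone hθ hθ1 (by rwa [norm_neg])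
      (by rw [inner_neg_right, hθm, neg_zero]) (fun w => ?_) hε0 hε1.le
      (hsec (-m) (Or.inr rfl) hp2) fun ⟨w, hw, h1, h2⟩ => ?_
    · rw [inner_neg_left, neg_smul_neg]; exact hdec w
    · simp only [inner_neg_left, neg_neg, Left.neg_neg_iff] at h1 h2
      exact absurd ⟨w, hw, h1, h2⟩ hp1
  -- otherwise `A` would be contained near `x₀ + (δ / 2) • θ` in the line through `x₀` of direction
  -- `θ`, which has zero area
  exfalso
  have hn : ‖(δ / 2) • θ‖ = δ / 2 := by
    rw [norm_smul, hθ1, Real.norm_of_nonneg (by linarith), mul_one]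
  refine hreg (x₀ + (δ / 2) • θ) ((hAK _ (by rw [hn]; linarith)).2
    (hcone θ hθ _ (by linarith))) _ (Metric.ball_mem_nhds _ (show 0 < δ / 2 * (ε / 4) by positivity))
    (measure_mono_null (fun x hx => ?_)
      (addHaar_inner_eq_zero (norm_ne_zero_iff.1 (hm1 ▸ one_ne_zero)) x₀))
  have hx2 : ‖(x - x₀) - (δ / 2) • θ‖ < δ / 2 * (ε / 4) := by
    have := hx.2
    rwa [Metric.mem_ball, dist_eq_norm, ← sub_sub] at this
  have hwδ : ‖x - x₀‖ < δ := by
    have := norm_le_norm_add_norm_sub' (x - x₀) ((δ / 2) • θ)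
    rw [hn] at this
    nlinarith
  have hwK : x - x₀ ∈ K := (hAK _ hwδ).1 (by rw [add_sub_cancel]; exact hx.1)
  have hθθ : inner ℝ θ θ = 1 := by rw [real_inner_self_eq_norm_sq, hθ1]; norm_num
  have hax := abs_real_inner_le_norm θ ((x - x₀) - (δ / 2) • θ)
  have hbx := abs_real_inner_le_norm m ((x - x₀) - (δ / 2) • θ)
  rw [inner_sub_right, real_inner_smul_right, hθθ, hθ1, one_mul, abs_le] at hax
  rw [inner_sub_right, real_inner_smul_right, real_inner_comm θ m, hθm, hm1, one_mul,
    abs_le] at hbx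
  have key : ε * inner ℝ θ (x - x₀) > δ / 2 * (ε / 4) := by nlinarith [mul_pos hδ hε0]
  rcases lt_trichotomy (inner ℝ m (x - x₀)) 0 with h | h | h
  · refine absurd ⟨_, hwK, ?_, ?_⟩ hp2
    · rw [inner_neg_left]; linarith
    · rw [inner_neg_left]; linarith
  · exact h
  · exact absurd ⟨_, hwK, h, by linarith⟩ hp1

end PlanarPolygons

section SupportGeometry

variable {d : ℕ}

/-- Every part of the support of `f` has positive volume. -/
lemma WorkingAssumption.volume_inter_ne_zero {f : Euc d → ℝ} {A : Set (Euc d)}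
    (hf : WorkingAssumption f A) {z : Euc d} (hz : z ∈ A) {U : Set (Euc d)} (hU : U ∈ 𝓝 z) :
    volume (A ∩ U) ≠ 0 := by
  intro h0
  have h1 : densityMeasure f (A ∩ U) = 0 := withDensity_absolutelyContinuous _ _ h0
  have h2 : densityMeasure f Aᶜ = 0 := by
    rw [← hf.support_eq]; exact Measure.measure_compl_support
  have h3 : 0 < densityMeasure f U :=
    (Measure.mem_support_iff_forall (μ := densityMeasure f) z).1 (hf.support_eq ▸ hz) U hU
  refine h3.ne' (measure_mono_null (t := A ∩ U ∪ Aᶜ) (fun x hx => ?_)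
    (measure_union_null h1 h2))
  by_cases hxA : x ∈ A
  · exact Or.inl ⟨hxA, hx⟩
  · exact Or.inr hxA

lemma WorkingAssumption.hasBallGrowth (hd : 2 ≤ d) {f : Euc d → ℝ} {A : Set (Euc d)}
    (hf : WorkingAssumption f A) (hA : HasC2Boundary A ∨ (d = 2 ∧ HasPolygonalBoundary A)) :
    HasBallGrowth A := by
  refine hasBallGrowth_of_hasLocalCones (by lia) hf.isCompact fun x hx => ?_
  rcases hA with hA | ⟨rfl, hA⟩
  · by_cases hi : x ∈ interior A
    · exact hasLocalCones_of_mem_interior hi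
    · exact hA.hasLocalCones ⟨subset_closure hx, hi⟩
  · exact hA.hasLocalCones hf.isCompact.isClosed (fun z hz U hU => hf.volume_inter_ne_zero hz hU) hx

end SupportGeometry

/-! ### The error terms as integrals -/

section PoissonTails

lemma poissonBelow_le_exp (k : ℕ) {t : ℝ} (ht : 0 ≤ t) :
    poissonBelow k t ≤ 2 ^ k * Real.exp (-t / 2) := by
  have h : ∀ j, poissonWeight t j ≤ 2 ^ j * Real.exp (-t / 2) := fun j => by
    have h1 := Real.pow_div_factorial_le_exp (t / 2) (by linarith) j
    have h2 : poissonWeight t j = 2 ^ j * (Real.exp (-t) * ((t / 2) ^ j / j.factorial)) := by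
      rw [poissonWeight, div_pow]; field_simp
    rw [h2]
    have h3 : Real.exp (-t / 2) = Real.exp (-t) * Real.exp (t / 2) := by
      rw [← Real.exp_add]; ring_nf
    rw [h3]
    gcongr
  calc poissonBelow k t ≤ ∑ j ∈ Finset.range k, 2 ^ j * Real.exp (-t / 2) :=
        Finset.sum_le_sum fun j _ => h j
    _ = (∑ j ∈ Finset.range k, (2 : ℝ) ^ j) * Real.exp (-t / 2) := by rw [Finset.sum_mul]
    _ ≤ 2 ^ k * Real.exp (-t / 2) := by
        gcongr
        rw [geom_sum_eq (by norm_num)]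
        norm_num

lemma exp_neg_le_poissonBelow {k : ℕ} (hk : 1 ≤ k) {t : ℝ} (ht : 0 ≤ t) :
    Real.exp (-t) ≤ poissonBelow k t := by
  have := Finset.single_le_sum (f := fun j => poissonWeight t j)
    (fun j _ => poissonWeight_nonneg ht j) (Finset.mem_range.2 hk)
  refine le_trans (le_of_eq ?_) this
  simp [poissonWeight]

end PoissonTails

section ExponentialKernel

variable {d : ℕ}

lemma integrable_exp_neg_norm : Integrable (fun y : Euc d => Real.exp (-‖y‖)) := by
  have h := (integrable_one_add_norm (E := Euc d) (μ := volume) (r := (d + 1 : ℕ))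
    (by rw [finrank_euclideanSpace_fin]; push_cast; linarith)).const_mul
      (Real.exp 1 * (d + 1).factorial)
  refine h.mono' (by fun_prop) (ae_of_all _ fun y => ?_)
  have h1 := Real.pow_div_factorial_le_exp (1 + ‖y‖) (by positivity) (d + 1)
  rw [Real.norm_of_nonneg (Real.exp_pos _).le, Real.rpow_neg (by positivity), Real.rpow_natCast,
    ← div_eq_mul_inv, le_div_iff₀ (by positivity)]
  rw [div_le_iff₀ (by positivity)] at h1
  calc Real.exp (-‖y‖) * (1 + ‖y‖) ^ (d + 1)
      ≤ Real.exp (-‖y‖) * (Real.exp (1 + ‖y‖) * (d + 1).factorial) := by gcongr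
    _ = _ := by rw [← mul_assoc, ← Real.exp_add]; ring_nf

lemma exp_neg_mul_dist_eq {a : ℝ} (ha : 0 < a) (x y : Euc d) :
    Real.exp (-(a * dist x y)) = (fun z : Euc d => Real.exp (-‖z‖)) (a • (y - x)) := by
  simp only [norm_smul, Real.norm_of_nonneg ha.le]
  rw [dist_comm, dist_eq_norm]

lemma integrable_exp_neg_mul_dist {a : ℝ} (ha : 0 < a) (x : Euc d) :
    Integrable (fun y : Euc d => Real.exp (-(a * dist x y))) := by
  simp_rw [exp_neg_mul_dist_eq ha x]
  exact ((integrable_comp_smul_iff volume (fun z : Euc d => Real.exp (-‖z‖)) ha.ne').2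
    integrable_exp_neg_norm).comp_sub_right x

lemma integral_exp_neg_mul_dist {a : ℝ} (ha : 0 < a) (x : Euc d) :
    ∫ y : Euc d, Real.exp (-(a * dist x y)) = (a ^ d)⁻¹ * ∫ y : Euc d, Real.exp (-‖y‖) := by
  simp_rw [exp_neg_mul_dist_eq ha x]
  rw [integral_sub_right_eq_self (fun z : Euc d => (fun z : Euc d => Real.exp (-‖z‖)) (a • z)) x,
    Measure.integral_comp_smul volume (fun z : Euc d => Real.exp (-‖z‖)), finrank_euclideanSpace_fin, abs_of_pos (by positivity), smul_eq_mul]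

end ExponentialKernel

section PairIntegral

variable {d : ℕ} {Λ : Measure (Euc d)} [IsFiniteMeasure Λ]

lemma measurable_isolationProb (k : ℕ) (r : ℝ) : Measurable (isolationProb k r Λ) := by
  refine (continuous_poissonBelow k).measurable.comp (Measurable.ennreal_toReal ?_)
  have hS : MeasurableSet {p : Euc d × Euc d | dist p.2 p.1 ≤ r} :=
    (isClosed_le (by fun_prop) continuous_const).measurableSet
  exact measurable_measure_prodMk_left hS

lemma isolationProb_nonneg (k : ℕ) (r : ℝ) (x : Euc d) : 0 ≤ isolationProb k r Λ x :=
  poissonBelow_nonneg k measureReal_nonneg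

lemma isolationProb_le_one (k : ℕ) (r : ℝ) (x : Euc d) : isolationProb k r Λ x ≤ 1 :=
  poissonBelow_le_one k measureReal_nonneg

lemma integrable_isolationProb (k : ℕ) (r : ℝ) : Integrable (isolationProb k r Λ) Λ :=
  Integrable.of_bound (measurable_isolationProb k r).aestronglyMeasurable 1
    (ae_of_all _ fun x => by
      rw [Real.norm_of_nonneg (isolationProb_nonneg k r x)]; exact isolationProb_le_one k r x)

open Classical in
/-- The sum of the two error terms of the Poisson approximation is bounded by a multiple of the
mean: `p` bounds the isolation probabilities and `N` the mean numbers of points in balls of radius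
`2r`, while `H` comes from the correlations of nearby points, which decay exponentially with rate
`a / 2` because the neighbourhoods of two points differ. -/
lemma integral_pairBound_le {A : Set (Euc d)} (hA : ∀ᵐ x ∂Λ, x ∈ A) {k : ℕ} {r a p N H : ℝ}
    (ha : 0 ≤ a) (hp0 : 0 ≤ p)
    (hp : ∀ x ∈ A, isolationProb k r Λ x ≤ p)
    (hdiff : ∀ x ∈ A, ∀ y ∈ A, dist x y ≤ 2 * r →
      a * dist x y ≤ Λ.real (Metric.closedBall y r \ Metric.closedBall x r) ∨
      a * dist x y ≤ Λ.real (Metric.closedBall x r \ Metric.closedBall y r))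
    (hN : ∀ x, Λ.real (Metric.closedBall x (2 * r)) ≤ N)
    (hH : ∀ x, ∫ y, Real.exp (-(a / 2 * dist x y)) ∂Λ ≤ H) :
    ∫ x, (∫ y, (if dist x y ≤ 2 * r then
        isolationProb k r Λ x * isolationProb k r Λ y
          + min (pairIsolationBound k r Λ x y) (pairIsolationBound k r Λ y x) else 0) ∂Λ) ∂Λ
      ≤ (p * N + 2 ^ k * (2 * H)) * ∫ x, isolationProb k r Λ x ∂Λ := by
  set q := isolationProb k r Λ with hq
  set e : Euc d → Euc d → ℝ := fun x y => Real.exp (-(a / 2 * dist x y)) with he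
  have hq0 : ∀ x, 0 ≤ q x := isolationProb_nonneg k r
  have hqm : Measurable q := measurable_isolationProb k r
  have he0 : ∀ x y, 0 ≤ e x y := fun x y => (Real.exp_pos _).le
  have he1 : ∀ x y, e x y ≤ 1 := fun x y => Real.exp_le_one_iff.2 (by
    have := mul_nonneg (div_nonneg ha zero_le_two) (dist_nonneg (x := x) (y := y)); linarith)
  have hem : Measurable (Function.uncurry e) := by
    have : Continuous (Function.uncurry e) := by
      simp only [he, Function.uncurry_def]; fun_prop
    exact this.measurable
  have hpair0 : ∀ x y, 0 ≤ pairIsolationBound k r Λ x y := fun x y =>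
    mul_nonneg (poissonBelow_nonneg k measureReal_nonneg) (poissonBelow_nonneg k measureReal_nonneg)
  have hpairle : ∀ x y, a * dist x y ≤ Λ.real (Metric.closedBall y r \ Metric.closedBall x r) →
      pairIsolationBound k r Λ x y ≤ 2 ^ k * (q x * e x y) := by
    intro x y h
    have h1 : poissonBelow k (Λ.real (Metric.closedBall y r \ Metric.closedBall x r))
        ≤ 2 ^ k * e x y := by
      refine (poissonBelow_le_exp k measureReal_nonneg).trans ?_
      simp only [he]
      gcongr
      linarith
    calc pairIsolationBound k r Λ x y ≤ q x * (2 ^ k * e x y) :=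
          mul_le_mul_of_nonneg_left h1 (hq0 x)
      _ = _ := by ring
  have hsymm : ∀ x y, e x y = e y x := fun x y => by simp only [he, dist_comm]
  -- the three terms of the bound, with their integrals
  set b₁ : Euc d × Euc d → ℝ := fun z => q z.1 * p *
    (Metric.closedBall z.1 (2 * r)).indicator (fun _ => 1) z.2 with hb₁
  set b₂ : Euc d × Euc d → ℝ := fun z => q z.1 * e z.1 z.2 with hb₂
  set b₃ : Euc d × Euc d → ℝ := fun z => q z.2 * e z.1 z.2 with hb₃
  have hq1 : ∀ x, q x ≤ 1 := isolationProb_le_one k r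
  have hi₂ : Integrable b₂ (Λ.prod Λ) := Integrable.of_bound
    ((hqm.comp measurable_fst).mul hem).aestronglyMeasurable 1 (ae_of_all _ fun z => by
      rw [Real.norm_of_nonneg (mul_nonneg (hq0 _) (he0 _ _))]
      exact mul_le_one₀ (hq1 _) (he0 _ _) (he1 _ _))
  have hi₃ : Integrable b₃ (Λ.prod Λ) := Integrable.of_bound
    ((hqm.comp measurable_snd).mul hem).aestronglyMeasurable 1 (ae_of_all _ fun z => by
      rw [Real.norm_of_nonneg (mul_nonneg (hq0 _) (he0 _ _))]
      exact mul_le_one₀ (hq1 _) (he0 _ _) (he1 _ _))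
  have hbm₁ : Measurable b₁ := by
    have hS : MeasurableSet {z : Euc d × Euc d | dist z.2 z.1 ≤ 2 * r} :=
      (isClosed_le (by fun_prop) continuous_const).measurableSet
    have : b₁ = fun z => q z.1 * p *
        {z : Euc d × Euc d | dist z.2 z.1 ≤ 2 * r}.indicator (fun _ => 1) z := by
      ext z; simp [hb₁, indicator, Metric.mem_closedBall]
    rw [this]
    exact ((hqm.comp measurable_fst).mul_const p).mul (measurable_const.indicator hS)
  have hi₁ : Integrable b₁ (Λ.prod Λ) := Integrable.of_bound hbm₁.aestronglyMeasurable p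
    (ae_of_all _ fun z => by
      have h1 : (0 : ℝ) ≤ (Metric.closedBall z.1 (2 * r)).indicator (fun _ => 1) z.2 :=
        indicator_nonneg (fun _ _ => zero_le_one) _
      have h2 : (Metric.closedBall z.1 (2 * r)).indicator (fun _ => (1 : ℝ)) z.2 ≤ 1 :=
        indicator_le_self' (fun _ _ => zero_le_one) _
      rw [Real.norm_of_nonneg (mul_nonneg (mul_nonneg (hq0 _) hp0) h1)]
      calc q z.1 * p * _ ≤ 1 * p * 1 := by
            gcongr
            exact hq1 _
        _ = p := by ring)
  have hI₁ : ∫ x, ∫ y, b₁ (x, y) ∂Λ ∂Λ ≤ p * N * ∫ x, q x ∂Λ := by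
    rw [← integral_const_mul]
    refine integral_mono hi₁.integral_prod_left ((integrable_isolationProb k r).const_mul _)
      fun x => ?_
    simp only [hb₁]
    rw [integral_const_mul, integral_indicator_const _ Metric.isClosed_closedBall.measurableSet,
      smul_eq_mul, mul_one]
    calc q x * p * _ ≤ q x * p * N := by
          gcongr
          · exact mul_nonneg (hq0 x) hp0
          · exact hN x
      _ = _ := by ring
  have hI₂ : ∫ x, ∫ y, b₂ (x, y) ∂Λ ∂Λ ≤ H * ∫ x, q x ∂Λ := by
    rw [← integral_const_mul]
    refine integral_mono hi₂.integral_prod_left ((integrable_isolationProb k r).const_mul _)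
      fun x => ?_
    simp only [hb₂]
    rw [integral_const_mul, mul_comm]
    exact mul_le_mul_of_nonneg_right (hH x) (hq0 x)
  have hI₃ : ∫ x, ∫ y, b₃ (x, y) ∂Λ ∂Λ ≤ H * ∫ x, q x ∂Λ := by
    rw [integral_integral_swap hi₃]
    refine le_trans (le_of_eq ?_) hI₂
    refine integral_congr_ae (ae_of_all _ fun x => integral_congr_ae (ae_of_all _ fun y => ?_))
    simp only [hb₂, hb₃]
    rw [hsymm]
  set b : Euc d × Euc d → ℝ := fun z => b₁ z + 2 ^ k * (b₂ z + b₃ z) with hb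
  have hi : Integrable b (Λ.prod Λ) := hi₁.add ((hi₂.add hi₃).const_mul _)
  have hle : ∀ x ∈ A, ∀ y ∈ A, (if dist x y ≤ 2 * r then q x * q y
      + min (pairIsolationBound k r Λ x y) (pairIsolationBound k r Λ y x) else 0) ≤ b (x, y) := by
    intro x hx y hy
    have h2 : 0 ≤ b₂ (x, y) := mul_nonneg (hq0 _) (he0 _ _)
    have h3 : 0 ≤ b₃ (x, y) := mul_nonneg (hq0 _) (he0 _ _)
    split_ifs with hxy
    · have hy' : y ∈ Metric.closedBall x (2 * r) := by rwa [Metric.mem_closedBall, dist_comm]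
      have hk : (0 : ℝ) < 2 ^ k := by positivity
      refine add_le_add ?_ ?_
      · simp only [hb₁, indicator_of_mem hy', mul_one]
        exact mul_le_mul_of_nonneg_left (hp y hy) (hq0 x)
      · rcases hdiff x hx y hy hxy with h | h
        · refine (min_le_left _ _).trans ((hpairle x y h).trans ?_)
          exact mul_le_mul_of_nonneg_left (le_add_of_nonneg_right h3) hk.le
        · refine (min_le_right _ _).trans ((hpairle y x (by rwa [dist_comm])).trans ?_)
          rw [hsymm y x]
          exact mul_le_mul_of_nonneg_left (le_add_of_nonneg_left h2) hk.le
    · have h1 : 0 ≤ b₁ (x, y) := mul_nonneg (mul_nonneg (hq0 _) hp0)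
        (indicator_nonneg (fun _ _ => zero_le_one) _)
      have : (0 : ℝ) ≤ 2 ^ k * (b₂ (x, y) + b₃ (x, y)) := by positivity
      simp only [hb]; linarith
  have hnn : ∀ x y, 0 ≤ (if dist x y ≤ 2 * r then q x * q y
      + min (pairIsolationBound k r Λ x y) (pairIsolationBound k r Λ y x) else 0) := by
    intro x y
    split_ifs
    · exact add_nonneg (mul_nonneg (hq0 x) (hq0 y)) (le_min (hpair0 _ _) (hpair0 _ _))
    · exact le_rfl
  calc _ ≤ ∫ x, ∫ y, b (x, y) ∂Λ ∂Λ := by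
        refine integral_mono_of_nonneg (ae_of_all _ fun x => integral_nonneg (hnn x))
          hi.integral_prod_left ?_
        filter_upwards [hA, hi.prod_right_ae] with x hx hix
        refine integral_mono_of_nonneg (ae_of_all _ (hnn x)) hix ?_
        filter_upwards [hA] with y hy using hle x hx y hy
    _ = ∫ z, b z ∂(Λ.prod Λ) := (integral_prod _ hi).symm
    _ = ∫ z, b₁ z ∂(Λ.prod Λ) + 2 ^ k * (∫ z, b₂ z ∂(Λ.prod Λ) + ∫ z, b₃ z ∂(Λ.prod Λ)) := by
        change ∫ z, b₁ z + 2 ^ k * (b₂ + b₃) z ∂(Λ.prod Λ) = _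
        rw [integral_add hi₁ ((hi₂.add hi₃).const_mul (2 ^ k)), integral_const_mul,
          integral_add' hi₂ hi₃]
    _ ≤ p * N * ∫ x, q x ∂Λ + 2 ^ k * (H * ∫ x, q x ∂Λ + H * ∫ x, q x ∂Λ) := by
        rw [integral_prod _ hi₁, integral_prod _ hi₂, integral_prod _ hi₃]
        gcongr
    _ = _ := by ring

end PairIntegral

/-! ### The largest link, and bounds for the density -/

section LargestLink

variable {d : ℕ}

/-- The inequality is strict because the ball around `x` also contains `x` itself. -/
lemma numIsolated_eq_zero_iff {X : Set (Euc d)} (hX : X.Finite) {k : ℕ} {r : ℝ} (hr : 0 ≤ r) :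
    numIsolated k X r = 0 ↔ ∀ x ∈ X, (k : ℕ∞) < (X ∩ Metric.closedBall x r).encard := by
  have hdeg : ∀ x : X, (X ∩ Metric.closedBall (x : Euc d) r).encard
      = ((geometricGraph X r).neighborSet x).encard + 1 := by
    intro x
    have h1 : X ∩ Metric.closedBall (x : Euc d) r
        = insert (x : Euc d) (Subtype.val '' (geometricGraph X r).neighborSet x) := by
      ext y
      simp only [mem_inter_iff, Metric.mem_closedBall, mem_insert_iff, mem_image,
        SimpleGraph.mem_neighborSet]
      constructor
      · rintro ⟨hy, hyr⟩
        refine or_iff_not_imp_left.2 fun hne => ⟨⟨y, hy⟩, ⟨?_, ?_⟩, rfl⟩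
        · exact fun h => hne (congrArg Subtype.val h).symm
        · rwa [dist_comm]
      · rintro (rfl | ⟨z, ⟨_, hz⟩, rfl⟩)
        · exact ⟨x.2, by simpa using hr⟩
        · exact ⟨z.2, by rw [dist_comm]; exact hz⟩
    rw [h1, encard_insert_of_notMem, Subtype.val_injective.encard_image]
    rintro ⟨z, hz, hzx⟩
    exact hz.1 (Subtype.ext hzx).symm
  have : Finite X := hX
  rw [numIsolated, ncard_eq_zero (toFinite _), eq_empty_iff_forall_notMem, Subtype.forall]
  refine forall₂_congr fun x hx => ?_
  rw [hdeg ⟨x, hx⟩, mem_ofPred_eq, not_lt]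
  exact (ENat.lt_add_one_iff' (ENat.natCast_ne_top k)).symm

/-- For a finite set with more than `k` points, the largest `k`-nearest-neighbour link is at most
`r` exactly if every point has at least `k` neighbours within distance `r`. -/
lemma largestLink_le_iff {X : Set (Euc d)} (hX : X.Finite) {k : ℕ}
    (hk : ((k + 1 : ℕ) : ℕ∞) ≤ X.encard) {r : ℝ} (hr : 0 < r) :
    largestLink k X ≤ r ↔ numIsolated k X r = 0 := by
  have : Finite X := hX
  have hne : Nonempty X := by
    refine nonempty_coe_sort.2 (encard_pos.1 (lt_of_lt_of_le ?_ hk))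
    exact_mod_cast Nat.succ_pos k
  have hklt : (k : ℕ∞) < X.encard := lt_of_lt_of_le (by exact_mod_cast Nat.lt_succ_self k) hk
  rw [numIsolated_eq_zero_iff hX hr.le, largestLink, if_pos hk,
    ciSup_le_iff (finite_range _).bddAbove, Subtype.forall]
  refine forall₂_congr fun x hx => ?_
  simp only
  set S := {s : ℝ | 0 < s ∧ (k : ℕ∞) < (X ∩ Metric.closedBall x s).encard} with hS
  constructor
  · intro h
    -- slightly larger balls contain no further points of the finite set `X`
    have hev : ∀ᶠ s in 𝓝[>] r, ∀ y ∈ X, dist y x ≤ s → dist y x ≤ r := by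
      refine (eventually_all_finite hX).2 fun y _ => ?_
      rcases le_or_gt (dist y x) r with hy | hy
      · exact Eventually.of_forall fun s _ => hy
      · filter_upwards [Ioo_mem_nhdsGT hy] with s hs hys
        exact absurd hys (not_le.2 hs.2)
    obtain ⟨s, hs, hrs⟩ := (hev.and self_mem_nhdsWithin).exists
    have hSne : S.Nonempty := by
      obtain ⟨R, hR⟩ := hX.isBounded.subset_closedBall x
      refine ⟨max R 1, lt_of_lt_of_le one_pos (le_max_right _ _), ?_⟩
      rwa [inter_eq_left.2 (hR.trans (Metric.closedBall_subset_closedBall (le_max_left _ _)))]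
    obtain ⟨t, ht, hts⟩ := exists_lt_of_csInf_lt hSne (lt_of_le_of_lt h hrs)
    refine ht.2.trans_le (encard_le_encard fun y hy => ⟨hy.1, hs y hy.1 ?_⟩)
    exact le_trans hy.2 hts.le
  · intro h
    exact csInf_le ⟨0, fun s hs => hs.1.le⟩ ⟨hr, h⟩

/-- The two events differ only if there are at most `k` points. They need not be measurable, which is
why only the monotonicity and subadditivity of `P` are used. -/
lemma IsPoissonProcess.abs_largestLink_sub_le {Ω : Type*} [MeasurableSpace Ω] {P : Measure Ω}
    [IsProbabilityMeasure P] {η : Ω → Set (Euc d)} {Λ : Measure (Euc d)} [IsFiniteMeasure Λ]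
    (h : IsPoissonProcess P η Λ) (k : ℕ) {r : ℝ} (hr : 0 < r) :
    |P.real {ω | largestLink k (η ω) ≤ r}
        - P.real ((fun ω => numIsolated k (η ω) r) ⁻¹' {0})| ≤ poissonBelow (k + 1) (Λ.real univ) := by
  have hN : P.real ({ω | (η ω ∩ univ).encard < (k + 1 : ℕ)} ∪ {ω | (η ω).Finite}ᶜ)
      ≤ poissonBelow (k + 1) (Λ.real univ) := by
    refine (measureReal_union_le _ _).trans (le_of_eq ?_)
    have h0 : P.real {ω | (η ω).Finite}ᶜ = 0 := by
      rw [measureReal_def, show P {ω | (η ω).Finite}ᶜ = 0 from h.ae_finite]; rfl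
    rw [h.measureReal_count_lt MeasurableSet.univ, h0, add_zero]
  have hiff : ∀ ω, ω ∉ {ω | (η ω ∩ univ).encard < (k + 1 : ℕ)} ∪ {ω | (η ω).Finite}ᶜ →
      (largestLink k (η ω) ≤ r ↔ numIsolated k (η ω) r = 0) := by
    intro ω hω
    simp only [mem_union, mem_ofPred_eq, mem_compl_iff, not_or, not_lt, not_not, inter_univ] at hω
    exact largestLink_le_iff hω.2 hω.1 hr
  rw [abs_sub_le_iff]
  constructor
  · rw [sub_le_iff_le_add']
    refine le_trans ((measureReal_mono fun ω hω => ?_).trans (measureReal_union_le _ _))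
      (add_le_add_right hN _)
    by_contra hcon
    rw [mem_union, not_or] at hcon
    exact hcon.1 ((hiff ω hcon.2).1 hω)
  · rw [sub_le_iff_le_add']
    refine le_trans ((measureReal_mono fun ω hω => ?_).trans (measureReal_union_le _ _))
      (add_le_add_right hN _)
    by_contra hcon
    rw [mem_union, not_or] at hcon
    exact hcon.1 ((hiff ω hcon.2).2 hω)

end LargestLink

section DensityBounds

variable {d : ℕ} {f : Euc d → ℝ} {A : Set (Euc d)}

lemma WorkingAssumption.ae_mem (hf : WorkingAssumption f A) : ∀ᵐ x ∂densityMeasure f, x ∈ A := by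
  have : densityMeasure f Aᶜ = 0 := by
    rw [← hf.support_eq]; exact Measure.measure_compl_support
  exact mem_ae_iff.2 this

lemma WorkingAssumption.exists_le_smul_volume (hf : WorkingAssumption f A) :
    ∃ C > 0, densityMeasure f ≤ ENNReal.ofReal C • volume := by
  obtain ⟨C, hC⟩ := hf.isCompact.exists_bound_of_continuousOn hf.continuousOn
  refine ⟨max C 1, lt_of_lt_of_le one_pos (le_max_right _ _), Measure.le_iff.2 fun E hE => ?_⟩
  have hAm : MeasurableSet A := hf.isCompact.isClosed.measurableSet
  have h1 : densityMeasure f E = densityMeasure f (E ∩ A) := by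
    refine measure_congr ?_
    filter_upwards [hf.ae_mem] with x hx
    exact propext ⟨fun h => ⟨h, hx⟩, fun h => h.1⟩
  rw [h1, densityMeasure, withDensity_apply _ (hE.inter hAm), Measure.smul_apply, smul_eq_mul]
  calc ∫⁻ x in E ∩ A, ENNReal.ofReal (f x) ≤ ∫⁻ _ in E ∩ A, ENNReal.ofReal (max C 1) := by
        refine setLIntegral_mono measurable_const fun x hx => ?_
        exact ENNReal.ofReal_le_ofReal
          ((le_abs_self _).trans ((hC x hx.2).trans (le_max_left _ _)))
    _ = ENNReal.ofReal (max C 1) * volume (E ∩ A) := setLIntegral_const _ _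
    _ ≤ _ := by gcongr; exact inter_subset_left

lemma WorkingAssumption.exists_mul_volume_le (hf : WorkingAssumption f A) :
    ∃ c > 0, ∀ E, MeasurableSet E →
      c * volume.real (A ∩ E) ≤ (densityMeasure f).real E := by
  have := hf.isProbability
  obtain ⟨c, hc, hcf⟩ := hf.bounded_below
  refine ⟨c, hc, fun E hE => ?_⟩
  have hAm : MeasurableSet A := hf.isCompact.isClosed.measurableSet
  have h1 : ENNReal.ofReal c * volume (A ∩ E) ≤ densityMeasure f E := by
    calc ENNReal.ofReal c * volume (A ∩ E) = ∫⁻ _ in A ∩ E, ENNReal.ofReal c :=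
          (setLIntegral_const _ _).symm
      _ ≤ ∫⁻ x in A ∩ E, ENNReal.ofReal (f x) :=
          setLIntegral_mono hf.measurable.ennreal_ofReal fun x hx =>
            ENNReal.ofReal_le_ofReal (hcf x hx.1)
      _ = densityMeasure f (A ∩ E) := (withDensity_apply _ (hAm.inter hE)).symm
      _ ≤ _ := measure_mono inter_subset_right
  have h2 := ENNReal.toReal_mono (measure_ne_top _ _) h1
  rwa [ENNReal.toReal_mul, ENNReal.toReal_ofReal hc.le] at h2

lemma densityMeasure_sphere (hd : 1 ≤ d) (f : Euc d → ℝ) (x : Euc d) (ρ : ℝ) :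
    densityMeasure f (Metric.sphere x ρ) = 0 := by
  have : Nonempty (Fin d) := ⟨⟨0, hd⟩⟩
  exact withDensity_absolutelyContinuous _ _ (Measure.addHaar_sphere volume x ρ)

/-- The density is comparable to the volume on the support, so the estimates for volumes of balls
transfer to the measure with density `f`. -/
lemma WorkingAssumption.exists_ballGrowth (hf : WorkingAssumption f A) (h : HasBallGrowth A) :
    ∃ c > 0, ∃ r₀ > 0, ∀ r, 0 < r → r ≤ r₀ →
      (∀ x ∈ A, c * r ^ d ≤ (densityMeasure f).real (Metric.closedBall x r)) ∧
      ∀ x ∈ A, ∀ y ∈ A, dist x y ≤ 2 * r →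
        c * (r ^ (d - 1) * dist x y)
          ≤ (densityMeasure f).real (Metric.closedBall y r \ Metric.closedBall x r) ∨
        c * (r ^ (d - 1) * dist x y)
          ≤ (densityMeasure f).real (Metric.closedBall x r \ Metric.closedBall y r) := by
  obtain ⟨c₁, hc₁, h1⟩ := hf.exists_mul_volume_le
  obtain ⟨c₂, hc₂, r₀, hr₀, h2⟩ := h
  refine ⟨c₁ * c₂, by positivity, r₀, hr₀, fun r hr hrr => ⟨fun x hx => ?_, fun x hx y hy hxy => ?_⟩⟩
  · refine le_trans ?_ (h1 _ Metric.isClosed_closedBall.measurableSet)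
    rw [mul_assoc]
    exact mul_le_mul_of_nonneg_left ((h2 r hr hrr).1 x hx) hc₁.le
  · have hm : ∀ x y : Euc d, MeasurableSet (Metric.closedBall y r \ Metric.closedBall x r) :=
      fun x y => Metric.isClosed_closedBall.measurableSet.diff
        Metric.isClosed_closedBall.measurableSet
    refine ((h2 r hr hrr).2 x hx y hy hxy).imp (fun h => ?_) fun h => ?_
    all_goals
      refine le_trans ?_ (h1 _ (hm _ _))
      rw [mul_assoc]
      exact mul_le_mul_of_nonneg_left h hc₁.le

lemma measureReal_closedBall_le {ν : Measure (Euc d)} {C : ℝ} (hC : 0 ≤ C)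
    (hν : ν ≤ ENNReal.ofReal C • volume) (x : Euc d) {r : ℝ} (hr : 0 ≤ r) :
    ν.real (Metric.closedBall x r)
      ≤ C * volume.real (Metric.closedBall (0 : Euc d) 1) * r ^ d := by
  have h1 := hν (Metric.closedBall x r)
  rw [Measure.smul_apply, smul_eq_mul] at h1
  have h2 := ENNReal.toReal_mono
    (ENNReal.mul_ne_top ENNReal.ofReal_ne_top measure_closedBall_lt_top.ne) h1
  rw [ENNReal.toReal_mul, ENNReal.toReal_ofReal hC] at h2
  refine h2.trans (le_of_eq ?_)
  rw [Measure.addHaar_closedBall' _ _ hr, finrank_euclideanSpace_fin, ENNReal.toReal_mul,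
    ENNReal.toReal_ofReal (by positivity), measureReal_def]
  ring

end DensityBounds

/-! ### Scaled intensities -/

section ScaledIntensity

variable {d k : ℕ} {ν : Measure (Euc d)} [IsProbabilityMeasure ν]

lemma integral_isolationProb_smul {n : ℝ} (hn : 0 ≤ n) (r : ℝ) :
    ∫ x, isolationProb k r (ENNReal.ofReal n • ν) x ∂(ENNReal.ofReal n • ν)
      = n * ∫ x, poissonBelow k (n * ν.real (Metric.closedBall x r)) ∂ν := by
  rw [integral_smul_measure, ENNReal.toReal_ofReal hn, smul_eq_mul]
  simp only [isolationProb, measureReal_ennreal_smul_apply, ENNReal.toReal_ofReal hn]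

lemma integrable_poissonBelow_measureReal {n : ℝ} (hn : 0 ≤ n) (r : ℝ) :
    Integrable (fun x => poissonBelow k (n * ν.real (Metric.closedBall x r))) ν := by
  refine Integrable.of_bound (C := 1) ?_ (ae_of_all _ fun x => ?_)
  · have : IsFiniteMeasure (ENNReal.ofReal n • ν) := Measure.smul_finite ν ENNReal.ofReal_ne_top
    refine Measurable.aestronglyMeasurable ?_
    convert measurable_isolationProb (Λ := ENNReal.ofReal n • ν) k r using 1
    ext x
    simp only [isolationProb, measureReal_ennreal_smul_apply, ENNReal.toReal_ofReal hn]
  · have h0 : 0 ≤ n * ν.real (Metric.closedBall x r) := mul_nonneg hn measureReal_nonneg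
    rw [Real.norm_of_nonneg (poissonBelow_nonneg k h0)]
    exact poissonBelow_le_one k h0

/-- The right-hand side is at least the expected number of points without any other point within
distance `r`, because `1 ≤ k`. -/
lemma le_integral_isolationProb (hk : 1 ≤ k) {n : ℝ} (hn : 0 ≤ n) {r m : ℝ}
    (hm : ∀ x, ν.real (Metric.closedBall x r) ≤ m) :
    n * Real.exp (-(n * m))
      ≤ ∫ x, isolationProb k r (ENNReal.ofReal n • ν) x ∂(ENNReal.ofReal n • ν) := by
  rw [integral_isolationProb_smul hn]
  refine mul_le_mul_of_nonneg_left ?_ hn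
  have := integral_mono (μ := ν) (integrable_const (Real.exp (-(n * m))))
    (integrable_poissonBelow_measureReal (k := k) hn r) fun x => by
      refine le_trans ?_ (exp_neg_le_poissonBelow hk (mul_nonneg hn measureReal_nonneg))
      refine Real.exp_le_exp.2 (neg_le_neg (mul_le_mul_of_nonneg_left (hm x) hn))
  simpa using this

lemma integral_isolationProb_le {n : ℝ} (hn : 0 ≤ n) {r m : ℝ}
    (hm : ∀ᵐ x ∂ν, m ≤ ν.real (Metric.closedBall x r)) :
    ∫ x, isolationProb k r (ENNReal.ofReal n • ν) x ∂(ENNReal.ofReal n • ν)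
      ≤ n * (2 ^ k * Real.exp (-(n * m) / 2)) := by
  rw [integral_isolationProb_smul hn]
  refine mul_le_mul_of_nonneg_left ?_ hn
  have := integral_mono_ae (μ := ν) (integrable_poissonBelow_measureReal (k := k) hn r)
    (integrable_const (2 ^ k * Real.exp (-(n * m) / 2))) (by
      filter_upwards [hm] with x hx
      refine (poissonBelow_le_exp k (mul_nonneg hn measureReal_nonneg)).trans ?_
      have := mul_le_mul_of_nonneg_left hx hn
      gcongr)
  simpa using this

open Classical in
/-- The error terms of the Poisson approximation for the intensity `n • ν`, in terms of the mean
number `n * r ^ d` of points at distance of order `r` from a given point. -/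
lemma exists_integral_pairBound_le (hd : 1 ≤ d) {A : Set (Euc d)} (hA : ∀ᵐ x ∂ν, x ∈ A)
    {c C r₀ : ℝ} (hc : 0 < c) (hC : 0 < C) (hν : ν ≤ ENNReal.ofReal C • volume)
    (hgrowth : ∀ r, 0 < r → r ≤ r₀ →
      (∀ x ∈ A, c * r ^ d ≤ ν.real (Metric.closedBall x r)) ∧
      ∀ x ∈ A, ∀ y ∈ A, dist x y ≤ 2 * r →
        c * (r ^ (d - 1) * dist x y)
          ≤ ν.real (Metric.closedBall y r \ Metric.closedBall x r) ∨
        c * (r ^ (d - 1) * dist x y)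
          ≤ ν.real (Metric.closedBall x r \ Metric.closedBall y r)) (k : ℕ) :
    ∃ K ≥ 0, ∀ n r : ℝ, 0 < n → 0 < r → r ≤ r₀ → ∀ Λ, Λ = ENNReal.ofReal n • ν →
      ∫ x, (∫ y, (if dist x y ≤ 2 * r then
          isolationProb k r Λ x * isolationProb k r Λ y
            + min (pairIsolationBound k r Λ x y) (pairIsolationBound k r Λ y x) else 0) ∂Λ) ∂Λ
        ≤ K * ((n * r ^ d) ^ (d - 1))⁻¹ * ∫ x, isolationProb k r Λ x ∂Λ := by
  set D := C * volume.real (Metric.closedBall (0 : Euc d) 1) with hD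
  set I := ∫ y : Euc d, Real.exp (-‖y‖) with hI
  have hD0 : 0 ≤ D := by positivity
  have hI0 : 0 ≤ I := integral_nonneg fun y => (Real.exp_pos _).le
  refine ⟨2 ^ k * (d.factorial * (2 / c) ^ d * (D * 2 ^ d)) + 2 ^ k * (2 * (C * I * (2 / c) ^ d)),
    by positivity, fun n r hn hr hrr Λ hΛ => ?_⟩
  set T := n * r ^ d with hT
  have hT0 : 0 < T := by positivity
  have hreal : ∀ E, Λ.real E = n * ν.real E := fun E => by
    rw [hΛ, measureReal_ennreal_smul_apply, ENNReal.toReal_ofReal hn.le]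
  have : IsFiniteMeasure Λ := by
    rw [hΛ]; exact Measure.smul_finite _ ENNReal.ofReal_ne_top
  obtain ⟨h1, h2⟩ := hgrowth r hr hrr
  have hAΛ : ∀ᵐ x ∂Λ, x ∈ A := by rw [hΛ]; exact Measure.ae_smul_measure hA _
  set a := n * (c * r ^ (d - 1)) with ha
  have ha0 : 0 < a := by positivity
  refine (integral_pairBound_le (A := A) hAΛ (k := k) (r := r) (a := a)
    (p := 2 ^ k * Real.exp (-(c * T) / 2)) (N := n * (D * (2 * r) ^ d))
    (H := n * (C * (((a / 2) ^ d)⁻¹ * I))) ha0.le (by positivity) ?_ ?_ ?_ ?_).trans ?_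
  · intro x hx
    refine (poissonBelow_le_exp k measureReal_nonneg).trans ?_
    have h3 := mul_le_mul_of_nonneg_left (h1 x hx) hn.le
    have h4 : c * T ≤ Λ.real (Metric.closedBall x r) := by
      rw [hreal]; exact le_trans (le_of_eq (by rw [hT]; ring)) h3
    gcongr
  · intro x hx y hy hxy
    rw [hreal, hreal]
    refine (h2 x hx y hy hxy).imp (fun h => ?_) fun h => ?_
    all_goals
      refine le_trans (le_of_eq ?_) (mul_le_mul_of_nonneg_left h hn.le)
      rw [ha]; ring
  · intro x
    rw [hreal]
    exact mul_le_mul_of_nonneg_left (measureReal_closedBall_le hC.le hν x (by positivity)) hn.le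
  · intro x
    have ha2 : 0 < a / 2 := by positivity
    rw [hΛ, integral_smul_measure, ENNReal.toReal_ofReal hn.le, smul_eq_mul]
    refine mul_le_mul_of_nonneg_left ?_ hn.le
    refine (integral_mono_measure hν (ae_of_all _ fun y => (Real.exp_pos _).le)
      ((integrable_exp_neg_mul_dist ha2 x).smul_measure ENNReal.ofReal_ne_top)).trans ?_
    rw [integral_smul_measure, ENNReal.toReal_ofReal hC.le, smul_eq_mul,
      integral_exp_neg_mul_dist ha2 x]
  · refine mul_le_mul_of_nonneg_right ?_ (integral_nonneg (isolationProb_nonneg k r))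
    obtain ⟨e, rfl⟩ : ∃ e, d = e + 1 := ⟨d - 1, by lia⟩
    simp only [Nat.add_sub_cancel] at *
    rw [add_mul]
    refine add_le_add ?_ (le_of_eq ?_)
    · have h3 := Real.pow_div_factorial_le_exp (c * T / 2) (by positivity) (e + 1)
      have h4 : T * Real.exp (-(c * T) / 2)
          ≤ ((e + 1).factorial * (2 / c) ^ (e + 1)) * (T ^ e)⁻¹ := by
        rw [neg_div, Real.exp_neg, ← div_eq_mul_inv, ← div_eq_mul_inv, div_le_div_iff₀
          (Real.exp_pos _) (by positivity)]
        rw [div_le_iff₀ (by positivity)] at h3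
        calc T * T ^ e = (2 / c) ^ (e + 1) * (c * T / 2) ^ (e + 1) := by
              rw [← mul_pow, ← pow_succ']; congr 1; field_simp
          _ ≤ (2 / c) ^ (e + 1) * (Real.exp (c * T / 2) * (e + 1).factorial) := by gcongr
          _ = _ := by ring
      calc 2 ^ k * Real.exp (-(c * T) / 2) * (n * (D * (2 * r) ^ (e + 1)))
          = 2 ^ k * (D * 2 ^ (e + 1)) * (T * Real.exp (-(c * T) / 2)) := by
            rw [mul_pow, hT]; ring
        _ ≤ 2 ^ k * (D * 2 ^ (e + 1)) * (((e + 1).factorial * (2 / c) ^ (e + 1)) * (T ^ e)⁻¹) := by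
            gcongr
        _ = _ := by ring
    · have h5 : n * ((a / 2) ^ (e + 1))⁻¹ = (2 / c) ^ (e + 1) * (T ^ e)⁻¹ := by
        rw [ha, hT]
        simp only [div_pow, mul_pow, ← pow_mul]
        field_simp
        ring
      calc 2 ^ k * (2 * (n * (C * (((a / 2) ^ (e + 1))⁻¹ * I))))
          = 2 ^ k * (2 * (C * I * (n * ((a / 2) ^ (e + 1))⁻¹))) := by ring
        _ = _ := by rw [h5]; ring

end ScaledIntensity

/-! ### Asymptotics -/

section Asymptotics

lemma poissonBelow_le_inv_log_pow (k e : ℕ) {n : ℝ} (hn : 1 < n) :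
    poissonBelow k n ≤ 2 ^ k * (e.factorial * 2 ^ e) * (Real.log n ^ e)⁻¹ := by
  have hlog := Real.log_pos hn
  refine (poissonBelow_le_exp k (by linarith)).trans ?_
  rw [mul_assoc]
  refine mul_le_mul_of_nonneg_left ?_ (by positivity)
  have h3 := Real.pow_div_factorial_le_exp (n / 2) (by linarith) e
  rw [div_le_iff₀ (by positivity)] at h3
  rw [neg_div, Real.exp_neg, ← div_eq_mul_inv, inv_eq_one_div, div_le_div_iff₀ (Real.exp_pos _)
    (by positivity), one_mul]
  calc Real.log n ^ e ≤ n ^ e := by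
        gcongr
        exact Real.log_le_self (by linarith)
    _ = 2 ^ e * (n / 2) ^ e := by rw [← mul_pow]; congr 1; ring
    _ ≤ 2 ^ e * (Real.exp (n / 2) * e.factorial) := by gcongr
    _ = _ := by ring

variable {d k : ℕ} {f : Euc d → ℝ} {A : Set (Euc d)} {Ω : Type*} [MeasurableSpace Ω]
  {P : Measure Ω} [IsProbabilityMeasure P] {S : Set ℝ} {η : ℝ → Ω → Set (Euc d)}
  {β' : ℝ} {r : ℝ → ℝ}

/-- If the mean number of isolated vertices converges, then the mean number of points in balls of
radius `r n` is at least of order `log n`. The bound for the total variation distance then follows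
from the Poisson approximation for a fixed intensity. -/
lemma WorkingAssumption.exists_eventually_poisson_bound (hf : WorkingAssumption f A)
    (hd : 2 ≤ d) (hk : 1 ≤ k)
    (hA : HasC2Boundary A ∨ (d = 2 ∧ HasPolygonalBoundary A))
    (hη : ∀ n ∈ S, IsPoissonProcess P (η n) (ENNReal.ofReal n • densityMeasure f))
    (hβ' : 0 < β') (hr : ∀ n ∈ S, 0 ≤ r n)
    (hE : Tendsto (fun n => meanIsolated P (η n) k (r n)) (atTop ⊓ 𝓟 S) (𝓝 β')) :
    ∃ K, ∀ᶠ n in atTop ⊓ 𝓟 S, 0 < r n ∧ ∀ B : Set ℕ,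
      |P.real ((fun ω => numIsolated k (η n ω) (r n)) ⁻¹' B)
          - (poissonMeasure (meanIsolated P (η n) k (r n)).toNNReal).real B|
        ≤ K * (Real.log n ^ (d - 1))⁻¹ := by
  have := hf.isProbability
  obtain ⟨C, hC, hν⟩ := hf.exists_le_smul_volume
  obtain ⟨c, hc, r₀, hr₀, hgrowth⟩ := hf.exists_ballGrowth (hf.hasBallGrowth hd hA)
  obtain ⟨K, hK, hpair⟩ := exists_integral_pairBound_le (by lia) hf.ae_mem hc hC hν hgrowth k
  set ν := densityMeasure f with hνdef
  set D := C * volume.real (Metric.closedBall (0 : Euc d) 1) with hD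
  have hD0 : 0 < D := by
    refine mul_pos hC (ENNReal.toReal_pos ?_ measure_closedBall_lt_top.ne)
    exact (Metric.measure_closedBall_pos volume _ one_pos).ne'
  have hsphere : ∀ (n : ℝ) (x : Euc d) (ρ : ℝ),
      (ENNReal.ofReal n • ν) (Metric.sphere x ρ) = 0 := fun n x ρ => by
    rw [Measure.smul_apply, densityMeasure_sphere (by lia), smul_zero]
  have hmean : ∀ n ∈ S, meanIsolated P (η n) k (r n)
      = ∫ x, isolationProb k (r n) (ENNReal.ofReal n • ν) x ∂(ENNReal.ofReal n • ν) := by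
    intro n hn
    have : IsFiniteMeasure (ENNReal.ofReal n • ν) := Measure.smul_finite ν ENNReal.ofReal_ne_top
    exact (hη n hn).meanIsolated_eq (hsphere n) k (r n)
  -- for radii above `r₀` the mean would tend to zero
  set m := c * r₀ ^ d with hm
  have hm0 : 0 < m := by positivity
  have hsmall : ∀ᶠ n : ℝ in atTop, n * (2 ^ k * Real.exp (-(n * m) / 2)) < β' / 2 := by
    have h1 := (tendsto_rpow_mul_exp_neg_mul_atTop_nhds_zero 1 (m / 2) (by positivity)).const_mul
      ((2 : ℝ) ^ k)
    rw [mul_zero] at h1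
    filter_upwards [h1.eventually_lt_const (half_pos hβ')] with n hn
    rw [Real.rpow_one] at hn
    refine lt_of_eq_of_lt ?_ hn
    rw [show -(n * m) / 2 = -(m / 2) * n by ring]
    ring
  have hlog : Tendsto Real.log atTop atTop := Real.tendsto_log_atTop
  refine ⟨2 * Real.exp (2 * β') * (K * (2 * D) ^ (d - 1) * (2 * β')), ?_⟩
  filter_upwards [mem_inf_of_left hsmall,
    mem_inf_of_left (hlog.eventually_ge_atTop (2 * Real.log (2 * β'))),
    mem_inf_of_left (eventually_gt_atTop (1 : ℝ)), mem_inf_of_right (mem_principal_self S),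
    hE.eventually_const_lt (half_lt_self hβ'),
    hE.eventually_lt_const (show β' < 2 * β' by linarith)] with n hn1 hn2 hn3 hnS hn4 hn5
  have hn0 : 0 < n := by linarith
  have hL := Real.log_pos hn3
  set M := meanIsolated P (η n) k (r n) with hM
  have hM0 : 0 < M := by linarith
  have hT : Real.log n ≤ 2 * D * (n * r n ^ d) := by
    have h1 : n * Real.exp (-(n * (D * r n ^ d))) ≤ 2 * β' := by
      refine le_trans ?_ hn5.le
      rw [hM, hmean n hnS]
      exact le_integral_isolationProb hk hn0.le fun x =>
        measureReal_closedBall_le hC.le hν x (hr n hnS)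
    have h2 := Real.log_le_log (by positivity) h1
    rw [Real.log_mul hn0.ne' (Real.exp_pos _).ne', Real.log_exp] at h2
    linarith
  have hrpos : 0 < r n := by
    refine (hr n hnS).lt_of_ne fun h0 => ?_
    rw [← h0, zero_pow (by lia)] at hT
    linarith
  have hrr₀ : r n ≤ r₀ := by
    by_contra hcon
    push Not at hcon
    have h1 : M ≤ n * (2 ^ k * Real.exp (-(n * m) / 2)) := by
      rw [hM, hmean n hnS]
      refine integral_isolationProb_le hn0.le ?_
      filter_upwards [hf.ae_mem] with x hx
      exact ((hgrowth r₀ hr₀ le_rfl).1 x hx).trans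
        (measureReal_mono (Metric.closedBall_subset_closedBall hcon.le))
    linarith
  refine ⟨hrpos, fun B => ?_⟩
  have : IsFiniteMeasure (ENNReal.ofReal n • ν) := Measure.smul_finite ν ENNReal.ofReal_ne_top
  refine ((hη n hnS).abs_numIsolated_sub_le (hsphere n) k hrpos.le hM0 B).trans ?_
  have h1 := hpair n (r n) hn0 hrpos hrr₀ _ rfl
  rw [← hmean n hnS, ← hM] at h1
  have h2 : ((n * r n ^ d) ^ (d - 1))⁻¹ ≤ (2 * D) ^ (d - 1) * (Real.log n ^ (d - 1))⁻¹ := by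
    rw [← div_eq_mul_inv, inv_eq_one_div, div_le_div_iff₀ (by positivity) (by positivity), one_mul,
      ← mul_pow]
    gcongr
  rw [mul_assoc (2 * Real.exp (2 * β'))]
  have h3 : 2 * Real.exp M ≤ 2 * Real.exp (2 * β') :=
    mul_le_mul_of_nonneg_left (Real.exp_le_exp.2 hn5.le) zero_le_two
  refine mul_le_mul h3 (h1.trans ?_) ?_ (by positivity)
  · calc K * ((n * r n ^ d) ^ (d - 1))⁻¹ * M
        ≤ K * ((2 * D) ^ (d - 1) * (Real.log n ^ (d - 1))⁻¹) * (2 * β') := by gcongr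
      _ = _ := by ring
  · refine integral_nonneg fun x => integral_nonneg fun y => ?_
    have h0 : ∀ (x : Euc d) s, 0 ≤ poissonBelow k ((ENNReal.ofReal n • ν).real s) := fun x s =>
      poissonBelow_nonneg k measureReal_nonneg
    dsimp only
    split_ifs
    · exact add_nonneg (mul_nonneg (h0 x _) (h0 x _))
        (le_min (mul_nonneg (h0 x _) (h0 x _)) (mul_nonneg (h0 x _) (h0 x _)))
    · exact le_rfl

end Asymptotics

/-- The intensity parameter `n` tends to infinity through a set `S ⊆ [1, ∞)` of reals, for example
the positive integers or all of `[1, ∞)`. -/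
theorem proposition3p1 (d k : ℕ) (hd : 2 ≤ d) (hk : 1 ≤ k)
    (f : Euc d → ℝ) (A : Set (Euc d)) (hf : WorkingAssumption f A)
    (hA : HasC2Boundary A ∨ (d = 2 ∧ HasPolygonalBoundary A))
    {Ω : Type*} [MeasurableSpace Ω] (P : Measure Ω) [IsProbabilityMeasure P]
    (S : Set ℝ) (hS : S ⊆ Set.Ici 1)
    (η : ℝ → Ω → Set (Euc d))
    (hη : ∀ n ∈ S, IsPoissonProcess P (η n) (ENNReal.ofReal n • densityMeasure f))
    (β' : ℝ) (hβ' : 0 < β')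
    (r : ℝ → ℝ) (hr : ∀ n ∈ S, 0 ≤ r n)
    (hE : Tendsto (fun n => meanIsolated P (η n) k (r n)) (atTop ⊓ 𝓟 S) (𝓝 β')) :
    ((fun n => dTV (fun ω => numIsolated k (η n ω) (r n)) P
        (id : ℕ → ℕ) (poissonMeasure (meanIsolated P (η n) k (r n)).toNNReal))
      =O[atTop ⊓ 𝓟 S] fun n => Real.log n ^ (1 - (d : ℤ))) ∧
    ((fun n => P.real {ω | largestLink k (η n ω) ≤ r n}
        - Real.exp (-meanIsolated P (η n) k (r n)))
      =O[atTop ⊓ 𝓟 S] fun n => Real.log n ^ (1 - (d : ℤ))) := by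
  have := hf.isProbability
  obtain ⟨K, hK⟩ := hf.exists_eventually_poisson_bound hd hk hA hη hβ' hr hE
  have hpow : ∀ n : ℝ, 1 < n → ‖Real.log n ^ (1 - (d : ℤ))‖ = (Real.log n ^ (d - 1))⁻¹ := by
    intro n hn
    have h0 := Real.log_pos hn
    rw [show (1 - (d : ℤ)) = -((d - 1 : ℕ) : ℤ) by lia, zpow_neg, zpow_natCast,
      Real.norm_of_nonneg (by positivity)]
  have h1 : ∀ᶠ n : ℝ in atTop ⊓ 𝓟 S, 1 < n := mem_inf_of_left (eventually_gt_atTop 1)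
  refine ⟨Asymptotics.IsBigO.of_bound K ?_,
    Asymptotics.IsBigO.of_bound (2 ^ (k + 1) * ((d - 1).factorial * 2 ^ (d - 1)) + K) ?_⟩
  · filter_upwards [hK, h1] with n hn hn1
    rw [hpow n hn1, dTV, Real.norm_of_nonneg (Real.iSup_nonneg fun B => abs_nonneg _)]
    exact ciSup_le fun B => hn.2 B
  · filter_upwards [hK, h1, hE.eventually_const_lt hβ',
      mem_inf_of_right (mem_principal_self S)] with n hn hn1 hM hnS
    have hn0 : 0 < n := by linarith
    have : IsFiniteMeasure (ENNReal.ofReal n • densityMeasure f) :=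
      Measure.smul_finite _ ENNReal.ofReal_ne_top
    have e1 := (hη n hnS).abs_largestLink_sub_le k hn.1
    rw [measureReal_ennreal_smul_apply, ENNReal.toReal_ofReal hn0.le, probReal_univ, mul_one] at e1
    have e2 := poissonBelow_le_inv_log_pow (k + 1) (d - 1) hn1
    have e3 := hn.2 {0}
    rw [poissonMeasure_real_singleton] at e3
    simp only [Real.coe_toNNReal _ hM.le, pow_zero, mul_one, Nat.factorial_zero, Nat.cast_one,
      div_one] at e3
    rw [hpow n hn1, Real.norm_eq_abs, add_mul]
    exact (abs_sub_le _ _ _).trans (add_le_add (e1.trans e2) e3)
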